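/- **Setting.** Let $\Omega=(a,b)$ with $a<b$, let $T>0$, $\alpha>0$, and let $r,k\ge 1$ be integers. Let $u$ be a solution of the Allen–Cahn problem $$\partial_t u-\partial_{xx}u=f(u)\ \text{ in }\Omega\times(0,T],\qquad \partial_n u=0\ \text{ on }\partial\Omega\times(0,T],\qquad u|_{t=0}=u_0 .$$ (The equation holds almost everywhere in $\Omega$ for each $t\in(0,T]$, and $u(\cdot,t)$ is continuous on $\overline\Omega$ for each $t\in[0,T]$.) Assume that $|u_0|\le\alpha$ on $\overline\Omega$ and that the maximum principle holds for $u$: $\max_{\overline\Omega}|u_0|\le\alpha$ implies $|u(x,t)|\le\alpha$ for all $(x,t)\in\overline\Omega\times[0,T]$. **Space discretization.** For an integer $M\ge 1$ divide $[a,b]$ into $M$ intervals $I_1,\dots,I_M$ of length $h=(b-a)/M$, and let $a=x_0<x_1<\dots<x_{Mr}=b$ be such that $x_{(i-1)r},\dots,x_{ir}$ are the points of the $(r+1)$-point Gauss–Lobatto quadrature on $I_i$. Let $S_h^r$ be the space of continuous functions on $[a,b]$ whose restriction to each $I_i$ is a polynomial of degree at most $r$, with nodal basis $\phi_0,\dots,\phi_{Mr}$.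 Let $\mathbf M$ be the diagonal lumped mass matrix whose entries are the weights of the piecewise (composite) Gauss–Lobatto quadrature, and let $\mathbf A_{ij}=-\int_a^b\phi_i'\phi_j'\,dx$. **Time discretization.** For an integer $N\ge1$ let $\tau=T/N$ and $t_n=n\tau$. Given starting values $u_h^0,\dots,u_h^{k-1}\in S_h^r$, the functions $u_h^n\in S_h^r$, $n=k,\dots,N$, with nodal vectors $\mathbf u^n$ are defined by $$\hat{\mathbf u}^n=e^{\tau\mathbf M^{-1}\mathbf A}\mathbf u^{n-1}+\int_{t_{n-1}}^{t_n}e^{(t_n-s)\mathbf M^{-1}\mathbf A}\sum_{j=1}^kL_j(s)f(\mathbf u^{n-j})\,ds,\qquad \mathbf u^n=\min(\max(\hat{\mathbf u}^n,-\alpha),\alpha)\ \text{ (componentwise)},$$ where $L_j$ is the polynomial of degree $k-1$ with $L_j(t_{n-i})=\delta_{ij}$ for $i,j=1,\dots,k$. **Theorem.** (i) For all $M,N\ge1$: if the starting values satisfy $$|u_h^n(x_j)|\le\alpha,\qquad j=0,\dots,Mr,\quad n=0,\dots,k-1,$$ then $$|u_h^n(x_j)|\le\alpha,\qquad j=0,\dots,Mr,\quad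 n=k,\dots,N .$$ (ii) Suppose moreover that $u\in C^1([0,T];H^{2r}(\Omega))$, that $f$ is locally Lipschitz continuous on $[-\alpha,\alpha]$, and that $f(u)\in C^k([0,T];L^2(\Omega))\cap C([0,T];H^{2r}(\Omega))$. Then there is a constant $c>0$, independent of $M$, $N$ (that is, of $h$ and $\tau$, without any restriction on them), of $n$ and of the starting values, such that for all $M,N\ge1$ and all starting values with $|u_h^n(x_j)|\le\alpha$ for $j=0,\dots,Mr$ and $n=0,\dots,k-1$, $$\|u(t_n)-u_h^n\|_{L^2(\Omega)}\le c\,(\tau^k+h^r)+c\sum_{m=0}^{k-1}\|u(t_m)-u_h^m\|_{L^2(\Omega)},\qquad n=k,\dots,N .$$ -/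

import Mathlib

open Set MeasureTheory
open scoped ContDiff Matrix

noncomputable section

namespace ExpCutoff

/-! ## Sobolev spaces on a bounded interval -/

/-- `w` is the weak derivative of `v` on the open interval `(a, b)`. -/
def IsWeakDeriv (a b : ℝ) (v w : ℝ → ℝ) : Prop :=
  ∀ φ : ℝ → ℝ, ContDiff ℝ ∞ φ → HasCompactSupport φ → tsupport φ ⊆ Ioo a b →
    ∫ x in Ioo a b, v x * deriv φ x = -∫ x in Ioo a b, w x * φ x

/-- The real space `L²(a, b)`. -/
abbrev L2 (a b : ℝ) : Type := Lp ℝ 2 (volume.restrict (Ioo a b))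

lemma integrable_mul_test {a b : ℝ} (g : L2 a b) {φ : ℝ → ℝ} (hφ : Continuous φ)
    (hc : HasCompactSupport φ) :
    Integrable (fun x => g x * φ x) (volume.restrict (Ioo a b)) := by
  have hg : Integrable (g : ℝ → ℝ) (volume.restrict (Ioo a b)) :=
    (Lp.memLp g).integrable (by norm_num)
  obtain ⟨C, hC⟩ := hc.exists_bound_of_continuous hφ
  exact hg.mul_bdd (c := C) hφ.aestronglyMeasurable (Filter.Eventually.of_forall hC)

/-- The Sobolev space `H^m(a, b)`, with its Hilbert norm
`‖v‖² = ∑_{j ≤ m} ‖∂ₓʲ v‖²_{L²(a, b)}`. An element is stored as the tuple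
`(v, ∂ₓ v, …, ∂ₓᵐ v)` of its weak derivatives, all of them in `L²(a, b)`. -/
def sobolev (a b : ℝ) (m : ℕ) :
    Submodule ℝ (PiLp 2 (fun _ : Fin (m + 1) => L2 a b)) where
  carrier := {g | ∀ j : Fin m, IsWeakDeriv a b (g j.castSucc) (g j.succ)}
  zero_mem' := by
    intro j φ _ _ _
    have h : ∀ ψ : ℝ → ℝ, ∫ x in Ioo a b, (0 : L2 a b) x * ψ x = 0 := by
      intro ψ
      rw [← integral_zero ℝ ℝ (μ := volume.restrict (Ioo a b))]
      refine integral_congr_ae ?_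
      filter_upwards [Lp.coeFn_zero ℝ 2 (volume.restrict (Ioo a b))] with x hx
      rw [hx, Pi.zero_apply, zero_mul]
    simp only [PiLp.zero_apply]
    rw [h, h, neg_zero]
  add_mem' := by
    intro g g' hg hg' j φ h1 h2 h3
    have h : ∀ (p q : L2 a b) (ψ : ℝ → ℝ), Continuous ψ → HasCompactSupport ψ →
        ∫ x in Ioo a b, (p + q : L2 a b) x * ψ x =
          (∫ x in Ioo a b, p x * ψ x) + ∫ x in Ioo a b, q x * ψ x := by
      intro p q ψ hψ hc
      rw [← integral_add (integrable_mul_test p hψ hc) (integrable_mul_test q hψ hc)]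
      refine integral_congr_ae ?_
      filter_upwards [Lp.coeFn_add p q] with x hx
      rw [hx, Pi.add_apply, add_mul]
    simp only [PiLp.add_apply]
    rw [h _ _ _ (h1.continuous_deriv (by simp)) h2.deriv, h _ _ _ h1.continuous h2,
      hg j φ h1 h2 h3, hg' j φ h1 h2 h3]
    ring
  smul_mem' := by
    intro c g hg j φ h1 h2 h3
    have h : ∀ (p : L2 a b) (ψ : ℝ → ℝ),
        ∫ x in Ioo a b, (c • p : L2 a b) x * ψ x = c * ∫ x in Ioo a b, p x * ψ x := by
      intro p ψ
      rw [← integral_const_mul]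
      refine integral_congr_ae ?_
      filter_upwards [Lp.coeFn_smul c p] with x hx
      rw [hx, Pi.smul_apply, smul_eq_mul, mul_assoc]
    simp only [PiLp.smul_apply]
    rw [h, h, hg j φ h1 h2 h3]
    ring

/-- `v ∈ C^l([0, T]; H^m(a, b))`, for a function `v` of time and space (in this order);
`m = 0` gives `C^l([0, T]; L²(a, b))`. -/
def MemCSobolev (a b T : ℝ) (l m : ℕ) (v : ℝ → ℝ → ℝ) : Prop :=
  ∃ V : ℝ → sobolev a b m, ContDiffOn ℝ l V (Icc 0 T) ∧
    ∀ t ∈ Icc 0 T,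
      v t =ᵐ[volume.restrict (Ioo a b)] ((V t : PiLp 2 (fun _ : Fin (m + 1) => L2 a b)) 0 : L2 a b)

/-- The norm of `L²(a, b)`, for functions that are square integrable on `(a, b)`. -/
def l2norm (a b : ℝ) (v : ℝ → ℝ) : ℝ := √(∫ x in a..b, v x ^ 2)

/-! ## The Allen–Cahn equation -/

/-- `u` is a strong solution of `∂ₜ u - ∂ₓₓ u = f(u)` in `(a, b) × (0, T]`, `∂ₙ u = 0` on
`{a, b} × (0, T]`, `u = u₀` at `t = 0`. At each time `u` is given by its continuous
representative; the equation holds for almost every `x`, since `∂ₓₓ u(t)` is only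
square integrable when `u(t)` is no better than `H²`. Time derivatives at `T` are one-sided. -/
structure IsSolution (a b T : ℝ) (f u₀ : ℝ → ℝ) (u : ℝ → ℝ → ℝ) : Prop where
  continuousOn : ∀ t ∈ Icc 0 T, ContinuousOn (u t) (Icc a b)
  equation : ∀ t ∈ Ioc 0 T, ∀ᵐ x ∂(volume.restrict (Ioo a b)), ∃ ut uxx : ℝ,
    HasDerivWithinAt (fun s => u s x) ut (Icc 0 T) t ∧
    HasDerivAt (deriv (u t)) uxx x ∧
    ut - uxx = f (u t x)
  neumann : ∀ t ∈ Ioc 0 T,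
    HasDerivWithinAt (u t) 0 (Icc a b) a ∧ HasDerivWithinAt (u t) 0 (Icc a b) b
  initial : ∀ x ∈ Icc a b, u 0 x = u₀ x

/-! ## Gauss–Lobatto quadrature on the reference interval `[0, 1]` -/

/-- The polynomial `x (x - 1) P_r'(x)`, where `P_r` is the Legendre polynomial of degree `r`
of the interval `[0, 1]`. -/
def lobattoPoly (r : ℕ) : Polynomial ℝ :=
  Polynomial.X * (Polynomial.X - 1) *
    Polynomial.derivative ((Polynomial.shiftedLegendre r).map (Int.castRingHom ℝ))

/-- The points `0 = ξ_0 < ξ_1 < ⋯ < ξ_r = 1` of the `(r + 1)`-point Gauss–Lobatto quadrature on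
`[0, 1]`: the zeros of `x (x - 1) P_r'(x)` in increasing order. -/
def lobattoNode (r j : ℕ) : ℝ :=
  ((lobattoPoly r).roots.toFinset.sort).getD j 0

/-- The Lagrange basis polynomials of degree `r` at the Gauss–Lobatto points of `[0, 1]`. -/
def lobattoBasis (r j : ℕ) : Polynomial ℝ :=
  Lagrange.basis (Finset.range (r + 1)) (lobattoNode r) j

/-- The weights of the Gauss–Lobatto quadrature on `[0, 1]`. -/
def lobattoWeight (r j : ℕ) : ℝ := ∫ x in (0 : ℝ)..1, (lobattoBasis r j).eval x

/-! ## The lumped mass finite element method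

`[a, b]` is divided into `M` intervals `[a + i h, a + (i + 1) h]`, `i = 0, …, M - 1`, and the
node of number `i r + j` is the `j`-th Gauss–Lobatto point of the `i`-th interval. -/

/-- The mesh size `h`. -/
def meshSize (a b : ℝ) (M : ℕ) : ℝ := (b - a) / M

/-- The nodes `a = x_0 < x_1 < ⋯ < x_{Mr} = b`. -/
def node (a b : ℝ) (M r : ℕ) (g : Fin (M * r + 1)) : ℝ :=
  a + ((g.val / r : ℕ) + lobattoNode r (g.val % r)) * meshSize a b M

/-- The finite element space `S_h^r`: the functions which on each (closed) interval of the
partition agree with a polynomial of degree at most `r`. As the values at a common endpoint of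
two neighbouring intervals agree, these functions are continuous, hence in `H¹(a, b)`. -/
def IsFEFunction (a b : ℝ) (M r : ℕ) (v : ℝ → ℝ) : Prop :=
  ∀ i < M, ∃ p : Polynomial ℝ, p.natDegree ≤ r ∧
    ∀ x ∈ Icc (a + i * meshSize a b M) (a + (i + 1) * meshSize a b M), v x = p.eval x

/-- The vector of the nodal values of a function. -/
def nodalVec (a b : ℝ) (M r : ℕ) (v : ℝ → ℝ) : Fin (M * r + 1) → ℝ :=
  fun g => v (node a b M r g)

/-- The nodal basis functions of `S_h^r` (on `[a, b]`): the interval that contains `x` has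
number `⌊(x - a) / h⌋`, or `M - 1` if `x = b`. -/
def nodalBasis (a b : ℝ) (M r : ℕ) (g : Fin (M * r + 1)) (x : ℝ) : ℝ :=
  ∑ j ∈ Finset.range (r + 1),
    if min ⌊(x - a) / meshSize a b M⌋₊ (M - 1) * r + j = g.val then
      (lobattoBasis r j).eval
        ((x - a) / meshSize a b M - (min ⌊(x - a) / meshSize a b M⌋₊ (M - 1) : ℕ))
    else 0

/-- The weights of the piecewise Gauss–Lobatto quadrature on `[a, b]`. A node shared by two
intervals collects the weights of both. -/
def nodeWeight (a b : ℝ) (M r : ℕ) (g : Fin (M * r + 1)) : ℝ :=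
  ∑ i ∈ Finset.range M, ∑ j ∈ Finset.range (r + 1),
    if i * r + j = g.val then meshSize a b M * lobattoWeight r j else 0

/-- The lumped (diagonal) mass matrix. -/
def massMatrix (a b : ℝ) (M r : ℕ) : Matrix (Fin (M * r + 1)) (Fin (M * r + 1)) ℝ :=
  Matrix.diagonal (nodeWeight a b M r)

/-- The matrix `A` of the semidiscrete problem `M u' - A u = M f`, i.e. the matrix of the bilinear
form `-(∂ₓ v, ∂ₓ w)_{L²(a, b)}` in the nodal basis. -/
def stiffMatrix (a b : ℝ) (M r : ℕ) : Matrix (Fin (M * r + 1)) (Fin (M * r + 1)) ℝ :=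
  Matrix.of fun g g' =>
    -∫ x in a..b, deriv (nodalBasis a b M r g) x * deriv (nodalBasis a b M r g') x

/-! ## The exponential cut-off method -/

/-- The Lagrange basis polynomial `L_j` of degree `k - 1` in time, with
`L_j(t_{n-i}) = δ_{ij}` for `i, j = 1, …, k`, where `t_m = m τ`. -/
def extrapBasis (τ : ℝ) (k n j : ℕ) : Polynomial ℝ :=
  Lagrange.basis (Finset.Icc 1 k) (fun i : ℕ => ((n : ℝ) - i) * τ) j

/-- One step of the `k`-step extrapolated exponential integrator, before the cut-off:
`e^{τ M⁻¹ A} u^{n-1} + ∫_{t_{n-1}}^{t_n} e^{(t_n - s) M⁻¹ A} ∑_{j=1}^k L_j(s) f(u^{n-j}) ds`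
for the nodal vectors `u^m = U m`. -/
def expStep (a b : ℝ) (M r : ℕ) (τ : ℝ) (k : ℕ) (f : ℝ → ℝ)
    (U : ℕ → Fin (M * r + 1) → ℝ) (n : ℕ) : Fin (M * r + 1) → ℝ :=
  NormedSpace.exp (τ • ((massMatrix a b M r)⁻¹ * stiffMatrix a b M r)) *ᵥ U (n - 1) +
    ∫ s in (((n : ℝ) - 1) * τ)..((n : ℝ) * τ),
      NormedSpace.exp (((n : ℝ) * τ - s) • ((massMatrix a b M r)⁻¹ * stiffMatrix a b M r)) *ᵥ
        ∑ j ∈ Finset.Icc 1 k, (extrapBasis τ k n j).eval s • fun g => f (U (n - j) g)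

/-- `uh 0, …, uh N` are finite element functions such that `uh k, …, uh N` arise from the starting
values `uh 0, …, uh (k - 1)` by the exponential cut-off method: the nodal values of `uh n` are
those of the exponential integrator, clamped to `[-α, α]`. -/
structure IsExpCutoff (a b : ℝ) (M r : ℕ) (τ : ℝ) (k N : ℕ) (α : ℝ) (f : ℝ → ℝ)
    (uh : ℕ → ℝ → ℝ) : Prop where
  isFEFunction : ∀ n ≤ N, IsFEFunction a b M r (uh n)
  step : ∀ n, k ≤ n → n ≤ N → ∀ g : Fin (M * r + 1),
    uh n (node a b M r g) =
      min (max (expStep a b M r τ k f (fun m => nodalVec a b M r (uh m)) n g) (-α)) α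

end ExpCutoff

end

open ExpCutoff

/-! The cut-off can only move the numerical values into `[-α, α]`, which gives the first part, and
it does not increase their distance to the exact solution, which takes values in `[-α, α]`. The
error estimate is therefore that of the exponential integrator, and it is carried out in the
discrete norm `lumpedNorm` of the Gauss–Lobatto quadrature.

*Stability.* The Gauss–Lobatto weights are positive (`lobattoWeight_pos`) and the stiffness matrix
is negative semidefinite, so `exp (t M⁻¹ A)` is a contraction in the lumped norm
(`lumpedNorm_exp_le`). No relation between `τ` and `h` is needed.

*Consistency.* The exact solution satisfies the variation of constants formula of the semidiscrete
problem up to two defects. The first one comes from the space discretization. Tested with a finite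
element function, it is a sum of local errors of quadrature and of interpolation, because the
Neumann condition removes the boundary terms. The quadrature is exact up to degree `2 r - 1`
(`lobattoQuad_eq_polyInt`), so these errors vanish for polynomials of degree `r + 1`
(`lobatto_consistency_polynomial`), and a Taylor polynomial gives the order `hʳ` in terms of
`∂ₓ^(r+2) u` (`exists_lumpedNorm_residual_le`). The hypotheses bound this derivative uniformly in
time, as `∂ₓₓ u = ∂ₜ u - f(u)` is bounded in `H²ʳ`, which embeds into `Cʳ`
(`exists_contDiff_solution`). This also covers `r = 1`, where `H²ʳ` itself does not control three
derivatives. The second defect is the extrapolation error, of order `τᵏ` in `L²`; its `r`-th space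
derivative is bounded as well, so the lumped norm of its nodal values is at most of order `τᵏ + hʳ`
(`exists_lumpedNorm_extrapolation_le`).

*Conclusion.* The error recursion `IsExpCutoff.error_recursion` and the discrete Gronwall inequality
`multistep_gronwall` bound the nodal errors, and `exists_l2norm_error_equiv` translates between the
lumped norm and the `L²` norm at the price of the interpolation error `hʳ`. -/

namespace ExpCutoff

/-! ### Integrals of polynomials and orthogonality of the Legendre polynomials -/

section Legendre

open Polynomial

/-- Integration of polynomials over the reference interval `[0, 1]`. -/
noncomputable def polyInt : ℝ[X] →ₗ[ℝ] ℝ where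
  toFun p := ∫ x in (0 : ℝ)..1, p.eval x
  map_add' p q := by
    simp only [eval_add]
    exact intervalIntegral.integral_add (p.continuous.intervalIntegrable _ _)
      (q.continuous.intervalIntegrable _ _)
  map_smul' c p := by
    simp [intervalIntegral.integral_const_mul]

lemma polyInt_apply (p : ℝ[X]) : polyInt p = ∫ x in (0 : ℝ)..1, p.eval x := rfl

lemma polyInt_derivative (p : ℝ[X]) : polyInt (derivative p) = p.eval 1 - p.eval 0 := by
  rw [polyInt_apply]
  exact intervalIntegral.integral_eq_sub_of_hasDerivAt (fun x _ => p.hasDerivAt x)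
    (p.derivative.continuous.intervalIntegrable _ _)

lemma polyInt_derivative_mul (p q : ℝ[X]) :
    polyInt (derivative p * q) =
      p.eval 1 * q.eval 1 - p.eval 0 * q.eval 0 - polyInt (p * derivative q) := by
  have h := polyInt_derivative (p * q)
  rw [derivative_mul, map_add, eval_mul, eval_mul] at h
  linarith

lemma polyInt_nonneg {p : ℝ[X]} (hp : ∀ x ∈ Icc (0 : ℝ) 1, 0 ≤ p.eval x) : 0 ≤ polyInt p :=
  intervalIntegral.integral_nonneg zero_le_one hp

lemma polyInt_iterate_derivative_mul (w : ℝ[X]) (n : ℕ)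
    (h0 : ∀ j < n, (derivative^[j] w).eval 0 = 0) (h1 : ∀ j < n, (derivative^[j] w).eval 1 = 0)
    (q : ℝ[X]) :
    polyInt (derivative^[n] w * q) = (-1) ^ n * polyInt (w * derivative^[n] q) := by
  induction n generalizing q with
  | zero => simp
  | succ n ih =>
    rw [Function.iterate_succ_apply' _ _ w, polyInt_derivative_mul, h0 n n.lt_succ_self,
      h1 n n.lt_succ_self,
      ih (fun j hj => h0 j (hj.trans n.lt_succ_self)) (fun j hj => h1 j (hj.trans n.lt_succ_self)),
      ← Function.iterate_succ_apply derivative n q, pow_succ]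
    ring

/-- The Legendre polynomial of `[0, 1]` with real coefficients. -/
noncomputable def legendre (r : ℕ) : ℝ[X] := (shiftedLegendre r).map (Int.castRingHom ℝ)

lemma natDegree_legendre (r : ℕ) : (legendre r).natDegree = r := by
  rw [legendre, natDegree_map_eq_of_injective (RingHom.injective_int _), natDegree_shiftedLegendre]

lemma coeff_legendre (r k : ℕ) :
    (legendre r).coeff k = (-1) ^ k * (r.choose k * (r + k).choose r : ℝ) := by
  rw [legendre, coeff_map, coeff_shiftedLegendre]
  simp [mul_assoc]

lemma iterate_derivative_bubble (r : ℕ) :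
    derivative^[r] ((X : ℝ[X]) ^ r * (1 - X) ^ r) = (r.factorial : ℝ[X]) * legendre r := by
  have h := congrArg (Polynomial.map (Int.castRingHom ℝ)) (factorial_mul_shiftedLegendre_eq r)
  rw [← iterate_derivative_map] at h
  simpa [legendre] using h.symm

lemma eval_iterate_derivative_bubble {r j : ℕ} (hj : j < r) :
    (derivative^[j] ((X : ℝ[X]) ^ r * (1 - X) ^ r)).eval 0 = 0 ∧
    (derivative^[j] ((X : ℝ[X]) ^ r * (1 - X) ^ r)).eval 1 = 0 := by
  constructor
  · have h := pow_sub_dvd_iterate_derivative_of_pow_dvd j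
      (Dvd.intro ((1 - X) ^ r) rfl : (X : ℝ[X]) ^ r ∣ X ^ r * (1 - X) ^ r)
    have h2 : (X : ℝ[X]) ∣ derivative^[j] ((X : ℝ[X]) ^ r * (1 - X) ^ r) :=
      (dvd_pow_self _ (by omega)).trans h
    obtain ⟨q, hq⟩ := h2
    rw [hq]; simp
  · have h := pow_sub_dvd_iterate_derivative_of_pow_dvd j
      (Dvd.intro_left (X ^ r) rfl : (1 - X : ℝ[X]) ^ r ∣ X ^ r * (1 - X) ^ r)
    have h2 : (1 - X : ℝ[X]) ∣ derivative^[j] ((X : ℝ[X]) ^ r * (1 - X) ^ r) :=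
      (dvd_pow_self _ (by omega)).trans h
    obtain ⟨q, hq⟩ := h2
    rw [hq]; simp

lemma polyInt_legendre_mul {r : ℕ} {q : ℝ[X]} (hq : q.natDegree < r) :
    polyInt (legendre r * q) = 0 := by
  have h := polyInt_iterate_derivative_mul ((X : ℝ[X]) ^ r * (1 - X) ^ r) r
    (fun j hj => (eval_iterate_derivative_bubble hj).1)
    (fun j hj => (eval_iterate_derivative_bubble hj).2) q
  rw [iterate_derivative_eq_zero hq, iterate_derivative_bubble, mul_zero, map_zero, mul_zero,
    mul_assoc, ← C_eq_natCast, ← smul_eq_C_mul, map_smul, smul_eq_mul] at h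
  exact (mul_eq_zero.mp h).resolve_left (by exact_mod_cast r.factorial_ne_zero)

/-! ### The Gauss–Lobatto points -/

lemma legendre_ne_zero (r : ℕ) : legendre r ≠ 0 := by
  intro h
  have h1 := coeff_legendre r 0
  rw [h] at h1
  simp at h1

lemma derivative_legendre_ne_zero {r : ℕ} (hr : 1 ≤ r) : derivative (legendre r) ≠ 0 := by
  intro h
  have := derivative_eq_zero.mp h
  rw [natDegree_legendre] at this
  omega

lemma iterate_derivative_bubble_ne_zero {r j : ℕ} (hj : j ≤ r) :
    derivative^[j] ((X : ℝ[X]) ^ r * (1 - X) ^ r) ≠ 0 := by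
  intro h
  have h2 := iterate_derivative_bubble r
  rw [show r = (r - j) + j by omega, Function.iterate_add_apply, show r - j + j = r by omega, h,
    iterate_derivative_zero] at h2
  have := mul_ne_zero (a := (r.factorial : ℝ[X])) (by exact_mod_cast r.factorial_ne_zero)
    (legendre_ne_zero r)
  exact this h2.symm

/-- Rolle's theorem, applied `j` times to `xʳ (1 - x)ʳ`, whose derivatives of order less than `r`
keep the zeros `0` and `1`. -/
lemma card_roots_iterate_derivative_bubble {r j : ℕ} (hj : j < r) :
    j + 2 ≤ (derivative^[j] ((X : ℝ[X]) ^ r * (1 - X) ^ r)).roots.toFinset.card := by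
  have h01 : ∀ i < r, ({0, 1} : Finset ℝ) ⊆
      (derivative^[i] ((X : ℝ[X]) ^ r * (1 - X) ^ r)).roots.toFinset := by
    intro i hi x hx
    rw [Multiset.mem_toFinset, mem_roots (iterate_derivative_bubble_ne_zero hi.le)]
    have := eval_iterate_derivative_bubble hi
    simp only [Finset.mem_insert, Finset.mem_singleton] at hx
    rcases hx with rfl | rfl
    · exact this.1
    · exact this.2
  have hc : ({0, 1} : Finset ℝ).card = 2 := by simp
  induction j with
  | zero =>
    have := Finset.card_le_card (h01 0 hj)
    omega
  | succ j ih =>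
    have h1 := ih (by omega)
    have h2 := card_roots_toFinset_le_card_roots_derivative_sdiff_roots_succ
      (derivative^[j] ((X : ℝ[X]) ^ r * (1 - X) ^ r))
    rw [← Function.iterate_succ_apply' derivative, Nat.succ_eq_add_one] at h2
    have hA := h01 j (by omega)
    have hB := h01 (j + 1) hj
    generalize (derivative^[j] ((X : ℝ[X]) ^ r * (1 - X) ^ r)).roots.toFinset = A at *
    generalize (derivative^[j + 1] ((X : ℝ[X]) ^ r * (1 - X) ^ r)).roots.toFinset = B at *
    have hd : Disjoint (B \ A) {0, 1} := Finset.sdiff_disjoint.mono_right hA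
    have h4 := Finset.card_le_card (Finset.union_subset Finset.sdiff_subset hB : B \ A ∪ {0, 1} ⊆ B)
    rw [Finset.card_union_of_disjoint hd] at h4
    omega

lemma card_roots_derivative_legendre {r : ℕ} (hr : 1 ≤ r) :
    r ≤ (derivative (legendre r)).roots.toFinset.card + 1 := by
  obtain ⟨j, rfl⟩ : ∃ j, r = j + 1 := ⟨r - 1, by omega⟩
  have h1 := card_roots_iterate_derivative_bubble (Nat.lt_add_one j)
  have h2 := card_roots_toFinset_le_derivative
    (derivative^[j] ((X : ℝ[X]) ^ (j + 1) * (1 - X) ^ (j + 1)))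
  rw [← Function.iterate_succ_apply' derivative, Nat.succ_eq_add_one,
    iterate_derivative_bubble, ← C_eq_natCast,
    roots_C_mul _ (by exact_mod_cast (j + 1).factorial_ne_zero)] at h2
  have h3 := card_roots_toFinset_le_derivative (legendre (j + 1))
  omega

/-- The coefficients of the Legendre polynomial alternate in sign, so its derivative is negative
on `(-∞, 0]`. -/
lemma eval_derivative_legendre_neg {r : ℕ} (hr : 1 ≤ r) {x : ℝ} (hx : x ≤ 0) :
    (derivative (legendre r)).eval x < 0 := by
  rw [eval_eq_sum_range' (n := r + 1)
    (by have := natDegree_derivative_le (legendre r); rw [natDegree_legendre] at this; omega)]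
  have hterm : ∀ i, (derivative (legendre r)).coeff i * x ^ i =
      -((r.choose (i + 1) * (r + (i + 1)).choose r : ℝ) * (i + 1) * (-x) ^ i) := by
    intro i
    rw [coeff_derivative, coeff_legendre, neg_pow x, pow_succ]
    have : ((-1 : ℝ) ^ i) * (-1) ^ i = 1 := by rw [← mul_pow]; simp
    linear_combination (norm := ring_nf) 0 * this
  simp_rw [hterm]
  rw [Finset.sum_neg_distrib, neg_lt_zero]
  refine Finset.sum_pos' (fun i _ => ?_) ⟨0, by simp, ?_⟩
  · have : 0 ≤ -x := by linarith
    positivity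
  · have h1 := Nat.choose_pos (show 1 ≤ r from hr)
    have h2 := Nat.choose_pos (show r ≤ r + 1 by omega)
    simp only [zero_add, pow_zero, mul_one, Nat.cast_zero]
    positivity

lemma legendre_symm (r : ℕ) : legendre r = C ((-1) ^ r) * (legendre r).comp (1 - X) := by
  have h := congrArg (Polynomial.map (Int.castRingHom ℝ))
    (neg_one_pow_mul_shiftedLegendre_comp_one_sub_X_eq r)
  simp only [Polynomial.map_mul, Polynomial.map_pow, Polynomial.map_neg, Polynomial.map_one,
    Polynomial.map_comp, Polynomial.map_sub, Polynomial.map_X] at h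
  rw [legendre, C_pow, C_neg, C_1]
  exact h.symm

lemma root_derivative_legendre_mem {r : ℕ} (hr : 1 ≤ r) {x : ℝ}
    (hx : (derivative (legendre r)).eval x = 0) : x ∈ Ioo (0 : ℝ) 1 := by
  constructor
  · by_contra! h
    exact (eval_derivative_legendre_neg hr h).ne hx
  · by_contra! h
    rw [legendre_symm, derivative_C_mul, derivative_comp] at hx
    simp at hx
    exact (eval_derivative_legendre_neg hr (sub_nonpos.mpr h)).ne hx

lemma lobattoPoly_eq (r : ℕ) : lobattoPoly r = X * (X - 1) * derivative (legendre r) := rfl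

lemma lobattoPoly_ne_zero {r : ℕ} (hr : 1 ≤ r) : lobattoPoly r ≠ 0 := by
  rw [lobattoPoly_eq]
  refine mul_ne_zero (mul_ne_zero X_ne_zero ?_) (derivative_legendre_ne_zero hr)
  exact X_sub_C_ne_zero 1

lemma natDegree_lobattoPoly {r : ℕ} (hr : 1 ≤ r) : (lobattoPoly r).natDegree = r + 1 := by
  rw [lobattoPoly_eq, natDegree_mul, natDegree_mul, natDegree_X, natDegree_derivative,
    natDegree_legendre, show (X - 1 : ℝ[X]) = X - C 1 by simp, natDegree_X_sub_C]
  · omega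
  · exact X_ne_zero
  · exact X_sub_C_ne_zero 1
  · exact mul_ne_zero X_ne_zero (X_sub_C_ne_zero 1)
  · exact derivative_legendre_ne_zero hr

lemma mem_roots_lobattoPoly {r : ℕ} (hr : 1 ≤ r) {x : ℝ} :
    x ∈ (lobattoPoly r).roots.toFinset ↔ (lobattoPoly r).eval x = 0 := by
  rw [Multiset.mem_toFinset, mem_roots (lobattoPoly_ne_zero hr), IsRoot.def]

lemma card_roots_lobattoPoly {r : ℕ} (hr : 1 ≤ r) :
    (lobattoPoly r).roots.toFinset.card = r + 1 := by
  apply le_antisymm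
  · calc _ ≤ (lobattoPoly r).roots.card := Multiset.toFinset_card_le _
      _ ≤ _ := card_roots' _
      _ = _ := natDegree_lobattoPoly hr
  · have hsub : (derivative (legendre r)).roots.toFinset ∪ {0, 1} ⊆
        (lobattoPoly r).roots.toFinset := by
      intro x hx
      rw [mem_roots_lobattoPoly hr, lobattoPoly_eq]
      rw [Finset.mem_union, Multiset.mem_toFinset, mem_roots (derivative_legendre_ne_zero hr)] at hx
      rcases hx with hx | hx
      · rw [eval_mul, hx.eq_zero, mul_zero]
      · simp only [Finset.mem_insert, Finset.mem_singleton] at hx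
        rcases hx with rfl | rfl <;> simp
    have hdisj : Disjoint (derivative (legendre r)).roots.toFinset ({0, 1} : Finset ℝ) := by
      rw [Finset.disjoint_left]
      intro x hx hx2
      rw [Multiset.mem_toFinset, mem_roots (derivative_legendre_ne_zero hr)] at hx
      have := root_derivative_legendre_mem hr hx.eq_zero
      simp only [Finset.mem_insert, Finset.mem_singleton] at hx2
      rcases hx2 with rfl | rfl
      · exact this.1.false
      · exact this.2.false
    have h1 := Finset.card_le_card hsub
    rw [Finset.card_union_of_disjoint hdisj] at h1
    have h2 := card_roots_derivative_legendre hr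
    have hc : ({0, 1} : Finset ℝ).card = 2 := by simp
    omega

lemma length_sort_lobatto {r : ℕ} (hr : 1 ≤ r) :
    ((lobattoPoly r).roots.toFinset.sort).length = r + 1 := by
  rw [Finset.length_sort, card_roots_lobattoPoly hr]

lemma lobattoNode_eq {r j : ℕ} (hr : 1 ≤ r) (hj : j < r + 1) :
    lobattoNode r j = ((lobattoPoly r).roots.toFinset.sort)[j]'
      (by rw [length_sort_lobatto hr]; exact hj) := by
  rw [lobattoNode, List.getD_eq_getElem]

lemma lobattoNode_lt {r i j : ℕ} (hr : 1 ≤ r) (hij : i < j) (hj : j < r + 1) :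
    lobattoNode r i < lobattoNode r j := by
  rw [lobattoNode_eq hr hj, lobattoNode_eq hr (hij.trans hj)]
  have h := Finset.sortedLT_sort (lobattoPoly r).roots.toFinset
  exact h.strictMono_get (a := ⟨i, by rw [length_sort_lobatto hr]; omega⟩)
    (b := ⟨j, by rw [length_sort_lobatto hr]; omega⟩) hij

lemma eval_lobattoPoly_node {r j : ℕ} (hr : 1 ≤ r) (hj : j < r + 1) :
    (lobattoPoly r).eval (lobattoNode r j) = 0 := by
  rw [← mem_roots_lobattoPoly hr, ← Finset.mem_sort (· ≤ ·), lobattoNode_eq hr hj]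
  exact List.getElem_mem _

lemma exists_lobattoNode_eq {r : ℕ} (hr : 1 ≤ r) {x : ℝ} (hx : (lobattoPoly r).eval x = 0) :
    ∃ j < r + 1, lobattoNode r j = x := by
  rw [← mem_roots_lobattoPoly hr, ← Finset.mem_sort (· ≤ ·)] at hx
  obtain ⟨j, hj, h⟩ := List.getElem_of_mem hx
  have hj' : j < r + 1 := by rwa [length_sort_lobatto hr] at hj
  exact ⟨j, hj', by rw [lobattoNode_eq hr hj', h]⟩

lemma lobattoNode_mem {r j : ℕ} (hr : 1 ≤ r) (hj : j < r + 1) :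
    lobattoNode r j ∈ Icc (0 : ℝ) 1 := by
  have h := eval_lobattoPoly_node hr hj
  rw [lobattoPoly_eq, eval_mul, eval_mul] at h
  rcases mul_eq_zero.mp h with h | h
  · rcases mul_eq_zero.mp h with h | h
    · rw [eval_X] at h; rw [h]; simp
    · rw [eval_sub, eval_X, eval_one, sub_eq_zero] at h; rw [h]; simp
  · exact Ioo_subset_Icc_self (root_derivative_legendre_mem hr h)

lemma lobattoNode_zero {r : ℕ} (hr : 1 ≤ r) : lobattoNode r 0 = 0 := by
  obtain ⟨j, hj, h⟩ := exists_lobattoNode_eq hr (x := 0) (by simp [lobattoPoly_eq])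
  rcases Nat.eq_zero_or_pos j with rfl | hj0
  · exact h
  · have h1 := lobattoNode_lt hr hj0 hj
    have h2 := (lobattoNode_mem hr (show 0 < r + 1 by omega)).1
    linarith

lemma lobattoNode_last {r : ℕ} (hr : 1 ≤ r) : lobattoNode r r = 1 := by
  obtain ⟨j, hj, h⟩ := exists_lobattoNode_eq hr (x := 1) (by simp [lobattoPoly_eq])
  rcases (Nat.lt_succ_iff.mp hj).eq_or_lt with rfl | hj0
  · exact h
  · have h1 := lobattoNode_lt hr hj0 (Nat.lt_succ_self r)
    have h2 := (lobattoNode_mem hr (Nat.lt_succ_self r)).2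
    linarith

lemma injOn_lobattoNode {r : ℕ} (hr : 1 ≤ r) :
    Set.InjOn (lobattoNode r) (Finset.range (r + 1) : Set ℕ) := by
  intro i hi j hj h
  simp only [Finset.coe_range, mem_Iio] at hi hj
  rcases lt_trichotomy i j with hij | hij | hij
  · exact absurd h (lobattoNode_lt hr hij hj).ne
  · exact hij
  · exact absurd h (lobattoNode_lt hr hij hi).ne'

/-! ### Exactness and positivity of the Gauss–Lobatto quadrature -/

lemma natDegree_lobattoBasis {r j : ℕ} (hr : 1 ≤ r) (hj : j < r + 1) :
    (lobattoBasis r j).natDegree = r := by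
  rw [lobattoBasis, Lagrange.natDegree_basis (injOn_lobattoNode hr) (by simpa using hj)]
  simp

lemma eval_lobattoBasis {r i j : ℕ} (hr : 1 ≤ r) (hi : i < r + 1) (hj : j < r + 1) :
    (lobattoBasis r i).eval (lobattoNode r j) = if i = j then 1 else 0 := by
  split_ifs with h
  · subst h
    exact Lagrange.eval_basis_self (injOn_lobattoNode hr) (by simpa using hi)
  · exact Lagrange.eval_basis_of_ne h (by simpa using hj)

/-- Lagrange interpolation at the Gauss–Lobatto points. -/
noncomputable def lobattoInterp (r : ℕ) (y : ℕ → ℝ) : ℝ[X] :=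
  ∑ j ∈ Finset.range (r + 1), C (y j) * lobattoBasis r j

lemma eval_lobattoInterp_node {r i : ℕ} (hr : 1 ≤ r) (hi : i < r + 1) (y : ℕ → ℝ) :
    (lobattoInterp r y).eval (lobattoNode r i) = y i := by
  rw [lobattoInterp, eval_finsetSum, Finset.sum_eq_single i]
  · rw [eval_mul, eval_C, eval_lobattoBasis hr hi hi]; simp
  · intro j hj hji
    rw [eval_mul, eval_lobattoBasis hr (by simpa using hj) hi]; simp [hji]
  · intro h; exact absurd (by simpa using hi) h

lemma natDegree_lobattoInterp {r : ℕ} (hr : 1 ≤ r) (y : ℕ → ℝ) :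
    (lobattoInterp r y).natDegree ≤ r := by
  refine natDegree_sum_le_of_forall_le _ _ fun j hj => ?_
  exact (natDegree_C_mul_le _ _).trans (natDegree_lobattoBasis hr (by simpa using hj)).le

/-- A polynomial of degree at most `r` is determined by its values at the Gauss–Lobatto points. -/
lemma lobattoInterp_eq_of_eval {r : ℕ} (hr : 1 ≤ r) {p : ℝ[X]} (hp : p.natDegree ≤ r) {y : ℕ → ℝ}
    (hy : ∀ j < r + 1, p.eval (lobattoNode r j) = y j) : lobattoInterp r y = p := by
  refine Polynomial.eq_of_degrees_lt_of_eval_index_eq (Finset.range (r + 1))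
    (injOn_lobattoNode hr) ?_ ?_ ?_
  · refine lt_of_le_of_lt degree_le_natDegree ?_
    have := natDegree_lobattoInterp hr y
    rw [Finset.card_range]; exact_mod_cast Nat.lt_succ_of_le this
  · refine lt_of_le_of_lt degree_le_natDegree ?_
    rw [Finset.card_range]; exact_mod_cast Nat.lt_succ_of_le hp
  · intro i hi
    have hi' : i < r + 1 := by simpa using hi
    rw [eval_lobattoInterp_node hr hi', hy i hi']

/-- The Gauss–Lobatto quadrature on `[0, 1]`. -/
noncomputable def lobattoQuad (r : ℕ) (y : ℝ → ℝ) : ℝ :=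
  ∑ j ∈ Finset.range (r + 1), lobattoWeight r j * y (lobattoNode r j)

lemma polyInt_lobattoInterp (r : ℕ) (y : ℕ → ℝ) :
    polyInt (lobattoInterp r y) = ∑ j ∈ Finset.range (r + 1), lobattoWeight r j * y j := by
  rw [lobattoInterp, map_sum]
  refine Finset.sum_congr rfl fun j _ => ?_
  rw [← smul_eq_C_mul, map_smul, smul_eq_mul, mul_comm]
  rfl

lemma lobattoQuad_eq_polyInt {r : ℕ} (hr : 1 ≤ r) {p : ℝ[X]} (hp : p.natDegree ≤ 2 * r - 1) :
    lobattoQuad r (fun x => p.eval x) = polyInt p := by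
  have hdec := EuclideanDomain.div_add_mod p (lobattoPoly r)
  set q := p / lobattoPoly r
  set s := p % lobattoPoly r
  have hs : s.natDegree ≤ r := by
    have h1 := degree_mod_lt p (lobattoPoly_ne_zero hr)
    rw [degree_eq_natDegree (lobattoPoly_ne_zero hr), natDegree_lobattoPoly hr] at h1
    refine natDegree_le_iff_coeff_eq_zero.mpr fun n hn => coeff_eq_zero_of_degree_lt ?_
    exact h1.trans_le (by exact_mod_cast hn)
  have hint : polyInt (lobattoPoly r * q) = 0 := by
    rcases eq_or_ne q 0 with hq | hq
    · rw [hq, mul_zero, map_zero]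
    have hdeg : (lobattoPoly r * q).natDegree ≤ 2 * r - 1 := by
      rw [show lobattoPoly r * q = p - s from eq_sub_of_add_eq hdec]
      exact (natDegree_sub_le _ _).trans (max_le hp (by omega))
    rw [natDegree_mul (lobattoPoly_ne_zero hr) hq, natDegree_lobattoPoly hr] at hdeg
    have h1 : lobattoPoly r * q = derivative (legendre r) * (X * (X - 1) * q) := by
      rw [lobattoPoly_eq]; ring
    rw [h1, polyInt_derivative_mul, polyInt_legendre_mul]
    · simp
    · refine (natDegree_derivative_le _).trans_lt ?_
      have h2 : (X * (X - 1) * q : ℝ[X]).natDegree ≤ (1 + max 1 0) + q.natDegree :=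
        natDegree_mul_le_of_le (natDegree_mul_le_of_le natDegree_X_le
          (natDegree_sub_le_of_le natDegree_X_le natDegree_one.le)) le_rfl
      omega
  have hval : ∀ j < r + 1, s.eval (lobattoNode r j) = p.eval (lobattoNode r j) := by
    intro j hj
    rw [← hdec, eval_add, eval_mul, eval_lobattoPoly_node hr hj]; simp
  have hi := polyInt_lobattoInterp r (fun j => p.eval (lobattoNode r j))
  rw [lobattoInterp_eq_of_eval hr hs hval] at hi
  rw [lobattoQuad, ← hi, ← hdec, map_add, hint, zero_add]

/-- A linear or quadratic factor which is nonnegative on `[0, 1]` and vanishes at the `i`-th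
Gauss–Lobatto point only. -/
noncomputable def lobattoFactor (r i : ℕ) : ℝ[X] :=
  if i = 0 then X else if i = r then 1 - X else (X - C (lobattoNode r i)) ^ 2

lemma lobattoFactor_eval_nonneg (r i : ℕ) {x : ℝ} (hx : x ∈ Icc (0 : ℝ) 1) :
    0 ≤ (lobattoFactor r i).eval x := by
  unfold lobattoFactor
  split_ifs
  · simpa using hx.1
  · simpa using hx.2
  · simpa using sq_nonneg _

lemma lobattoFactor_eval_eq_zero_iff {r i : ℕ} (hr : 1 ≤ r) (x : ℝ) :
    (lobattoFactor r i).eval x = 0 ↔ x = lobattoNode r i := by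
  unfold lobattoFactor
  split_ifs with h h'
  · rw [h, lobattoNode_zero hr]; simp
  · rw [h', lobattoNode_last hr, eval_sub, eval_one, eval_X, sub_eq_zero]; exact eq_comm
  · simp [sub_eq_zero]

/-- The product of the factors of all other Gauss–Lobatto points has degree at most `2 r - 1`, is
nonnegative on `[0, 1]` and is positive at the point itself; as the quadrature integrates it
exactly, the weight is positive. -/
lemma lobattoWeight_pos {r j : ℕ} (hr : 1 ≤ r) (hj : j < r + 1) : 0 < lobattoWeight r j := by
  set q : ℝ[X] := ∏ i ∈ (Finset.range (r + 1)).erase j, lobattoFactor r i with hq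
  have hqn : ∀ x ∈ Icc (0 : ℝ) 1, 0 ≤ q.eval x := by
    intro x hx
    rw [hq, eval_prod]
    exact Finset.prod_nonneg fun i _ => lobattoFactor_eval_nonneg r i hx
  have hqj : 0 < q.eval (lobattoNode r j) := by
    refine lt_of_le_of_ne (hqn _ (lobattoNode_mem hr hj)) (Ne.symm ?_)
    rw [hq, eval_prod, Finset.prod_ne_zero_iff]
    intro i hi h
    rw [lobattoFactor_eval_eq_zero_iff hr] at h
    rw [Finset.mem_erase] at hi
    exact hi.1 (injOn_lobattoNode hr (by simpa using hi.2) (by simpa using hj) h.symm)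
  have hdegf : ∀ i, (lobattoFactor r i).natDegree =
      if i = 0 then 1 else if i = r then 1 else 2 := by
    intro i
    unfold lobattoFactor
    split_ifs
    · simp
    · rw [← natDegree_neg, neg_sub]; exact natDegree_X_sub_C 1
    · rw [natDegree_pow, natDegree_X_sub_C]
  have hdeg : q.natDegree ≤ 2 * r - 1 := by
    refine (natDegree_prod_le _ _).trans ?_
    have htot : ∑ i ∈ Finset.range (r + 1), (lobattoFactor r i).natDegree = 2 * r := by
      obtain ⟨s, rfl⟩ : ∃ s, r = s + 1 := ⟨r - 1, by omega⟩
      rw [Finset.sum_range_succ, Finset.sum_range_succ', Finset.sum_congr rfl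
        (g := fun _ => 2)]
      · simp [hdegf]; ring
      · intro i hi
        rw [Finset.mem_range] at hi
        rw [hdegf]
        simp; omega
    have h2 := Finset.add_sum_erase (Finset.range (r + 1))
      (fun i => (lobattoFactor r i).natDegree) (a := j) (by simpa using hj)
    have h3 : 1 ≤ (lobattoFactor r j).natDegree := by
      rw [hdegf]; split_ifs <;> omega
    omega
  have hint : 0 < polyInt q :=
    intervalIntegral.integral_pos zero_lt_one q.continuous.continuousOn
      (fun x hx => hqn x (Ioc_subset_Icc_self hx)) ⟨_, lobattoNode_mem hr hj, hqj⟩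
  rw [← lobattoQuad_eq_polyInt hr hdeg, lobattoQuad, Finset.sum_eq_single j] at hint
  · exact (pos_iff_pos_of_mul_pos hint).mpr hqj
  · intro i hi hij
    have : q.eval (lobattoNode r i) = 0 := by
      rw [hq, eval_prod]
      exact Finset.prod_eq_zero (Finset.mem_erase.mpr ⟨hij, hi⟩)
        ((lobattoFactor_eval_eq_zero_iff hr _).mpr rfl)
    rw [this, mul_zero]
  · intro h; exact absurd (by simpa using hj) h

end Legendre

/-! ### Estimates on the reference element -/

section Reference

open Polynomial

/-- The discrete `L²` norm of nodal values on the reference element: the square root of the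
Gauss–Lobatto quadrature of the square. -/
noncomputable def lobattoNorm (r : ℕ) (y : ℕ → ℝ) : ℝ :=
  √(∑ j ∈ Finset.range (r + 1), lobattoWeight r j * y j ^ 2)

lemma lobattoNorm_nonneg (r : ℕ) (y : ℕ → ℝ) : 0 ≤ lobattoNorm r y := Real.sqrt_nonneg _

lemma sum_lobattoWeight_mul_sq_nonneg {r : ℕ} (hr : 1 ≤ r) (y : ℕ → ℝ) :
    0 ≤ ∑ j ∈ Finset.range (r + 1), lobattoWeight r j * y j ^ 2 :=
  Finset.sum_nonneg fun j hj =>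
    mul_nonneg (lobattoWeight_pos hr (by simpa using hj)).le (sq_nonneg _)

lemma sq_lobattoNorm {r : ℕ} (hr : 1 ≤ r) (y : ℕ → ℝ) :
    lobattoNorm r y ^ 2 = ∑ j ∈ Finset.range (r + 1), lobattoWeight r j * y j ^ 2 :=
  Real.sq_sqrt (sum_lobattoWeight_mul_sq_nonneg hr y)

lemma abs_le_lobattoNorm {r j : ℕ} (hr : 1 ≤ r) (hj : j < r + 1) (y : ℕ → ℝ) :
    |y j| ≤ (√(lobattoWeight r j))⁻¹ * lobattoNorm r y := by
  have hw := lobattoWeight_pos hr hj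
  have h1 : lobattoWeight r j * y j ^ 2 ≤
      ∑ j ∈ Finset.range (r + 1), lobattoWeight r j * y j ^ 2 :=
    Finset.single_le_sum (f := fun j => lobattoWeight r j * y j ^ 2)
      (fun i hi => mul_nonneg (lobattoWeight_pos hr (by simpa using hi)).le (sq_nonneg _))
      (by simpa using hj)
  have h2 : √(lobattoWeight r j) * |y j| ≤ lobattoNorm r y := by
    rw [← Real.sqrt_sq_eq_abs, ← Real.sqrt_mul hw.le]
    exact Real.sqrt_le_sqrt h1
  rw [inv_mul_eq_div, le_div_iff₀ (Real.sqrt_pos.mpr hw), mul_comm]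
  exact h2

/-- The sum of the weights of the quadrature, a constant (equal to `1`). -/
noncomputable def weightSum (r : ℕ) : ℝ := ∑ j ∈ Finset.range (r + 1), lobattoWeight r j

lemma weightSum_nonneg {r : ℕ} (hr : 1 ≤ r) : 0 ≤ weightSum r :=
  Finset.sum_nonneg fun _ hj => (lobattoWeight_pos hr (by simpa using hj)).le

lemma lobattoNorm_le_of_abs_le {r : ℕ} (hr : 1 ≤ r) {y : ℕ → ℝ} {K : ℝ} (hK : 0 ≤ K)
    (hy : ∀ j < r + 1, |y j| ≤ K) : lobattoNorm r y ≤ √(weightSum r) * K := by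
  rw [lobattoNorm, ← Real.sqrt_sq hK, ← Real.sqrt_mul (weightSum_nonneg hr), weightSum,
    Finset.sum_mul]
  refine Real.sqrt_le_sqrt (Finset.sum_le_sum fun j hj => ?_)
  have hj' : j < r + 1 := by simpa using hj
  exact mul_le_mul_of_nonneg_left (sq_le_sq' (abs_le.mp (hy j hj')).1 (abs_le.mp (hy j hj')).2)
    (lobattoWeight_pos hr hj').le

lemma exists_abs_sum_eval_le {r : ℕ} (hr : 1 ≤ r) (q : ℕ → ℝ[X]) :
    ∃ C : ℝ, 0 < C ∧ ∀ (y : ℕ → ℝ), ∀ x ∈ Icc (0 : ℝ) 1,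
      |∑ j ∈ Finset.range (r + 1), y j * (q j).eval x| ≤ C * lobattoNorm r y := by
  have hb : ∀ j, ∃ B : ℝ, ∀ x ∈ Icc (0 : ℝ) 1, ‖(q j).eval x‖ ≤ B := fun j =>
    isCompact_Icc.exists_bound_of_continuousOn (q j).continuous.continuousOn
  choose B hB using hb
  have hB0 : ∀ j, 0 ≤ B j := fun j => (norm_nonneg _).trans (hB j 0 (by simp))
  refine ⟨∑ j ∈ Finset.range (r + 1), (√(lobattoWeight r j))⁻¹ * B j + 1, ?_, ?_⟩
  · have : 0 ≤ ∑ j ∈ Finset.range (r + 1), (√(lobattoWeight r j))⁻¹ * B j :=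
      Finset.sum_nonneg fun j _ => mul_nonneg (by positivity) (hB0 j)
    linarith
  · intro y x hx
    have hn := lobattoNorm_nonneg r y
    calc |∑ j ∈ Finset.range (r + 1), y j * (q j).eval x|
        ≤ ∑ j ∈ Finset.range (r + 1), |y j * (q j).eval x| := Finset.abs_sum_le_sum_abs _ _
      _ ≤ ∑ j ∈ Finset.range (r + 1), (√(lobattoWeight r j))⁻¹ * B j * lobattoNorm r y := by
        refine Finset.sum_le_sum fun j hj => ?_
        rw [abs_mul]
        calc |y j| * |(q j).eval x| ≤ ((√(lobattoWeight r j))⁻¹ * lobattoNorm r y) * B j :=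
              mul_le_mul (abs_le_lobattoNorm hr (by simpa using hj) y) (hB j x hx) (abs_nonneg _)
                (by positivity)
          _ = _ := by ring
      _ ≤ _ := by rw [← Finset.sum_mul]; nlinarith

lemma exists_abs_eval_lobattoInterp_le {r : ℕ} (hr : 1 ≤ r) :
    ∃ C : ℝ, 0 < C ∧ ∀ (y : ℕ → ℝ), ∀ x ∈ Icc (0 : ℝ) 1,
      |(lobattoInterp r y).eval x| ≤ C * lobattoNorm r y ∧
      |(derivative (lobattoInterp r y)).eval x| ≤ C * lobattoNorm r y := by
  obtain ⟨C₁, h₁, H₁⟩ := exists_abs_sum_eval_le hr (lobattoBasis r)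
  obtain ⟨C₂, h₂, H₂⟩ := exists_abs_sum_eval_le hr (fun j => derivative (lobattoBasis r j))
  refine ⟨max C₁ C₂, lt_max_of_lt_left h₁, fun y x hx => ⟨?_, ?_⟩⟩
  · have h := H₁ y x hx
    rw [lobattoInterp, eval_finsetSum]
    simp only [eval_mul, eval_C]
    exact h.trans (mul_le_mul_of_nonneg_right (le_max_left _ _) (lobattoNorm_nonneg _ _))
  · have h := H₂ y x hx
    rw [lobattoInterp, derivative_sum, eval_finsetSum]
    simp only [derivative_C_mul, eval_mul, eval_C]
    exact h.trans (mul_le_mul_of_nonneg_right (le_max_right _ _) (lobattoNorm_nonneg _ _))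

lemma exists_polyInt_sq_lobattoInterp_le {r : ℕ} (hr : 1 ≤ r) :
    ∃ C : ℝ, 0 < C ∧ ∀ (y : ℕ → ℝ),
      polyInt (lobattoInterp r y ^ 2) ≤ C * lobattoNorm r y ^ 2 := by
  obtain ⟨C, hC, H⟩ := exists_abs_eval_lobattoInterp_le hr
  refine ⟨C ^ 2, by positivity, fun y => ?_⟩
  have h0 := lobattoNorm_nonneg r y
  have h := intervalIntegral.norm_integral_le_of_norm_le_const (a := 0) (b := 1)
    (f := fun x => (lobattoInterp r y ^ 2).eval x) (C := C ^ 2 * lobattoNorm r y ^ 2) ?_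
  · rw [polyInt_apply]
    refine (le_abs_self _).trans (h.trans (by simp))
  · intro x hx
    rw [uIoc_of_le zero_le_one] at hx
    have := (H y x (Ioc_subset_Icc_self hx)).1
    rw [eval_pow, Real.norm_eq_abs, abs_pow, ← mul_pow]
    exact pow_le_pow_left₀ (abs_nonneg _) this 2

/-- The inverse estimate between the discrete and the `L²` norm. The Gauss–Lobatto quadrature with
one more point integrates the squares of polynomials of degree `r` exactly, so it bounds their
values by their `L²` norm. -/
lemma exists_sq_lobattoNorm_le_polyInt {r : ℕ} (hr : 1 ≤ r) :
    ∃ C : ℝ, 0 < C ∧ ∀ (y : ℕ → ℝ),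
      lobattoNorm r y ^ 2 ≤ C * polyInt (lobattoInterp r y ^ 2) := by
  obtain ⟨C, hC, H⟩ := exists_abs_eval_lobattoInterp_le (show 1 ≤ r + 1 by omega)
  have hW := weightSum_nonneg hr
  refine ⟨weightSum r * C ^ 2 + 1, by positivity, fun y => ?_⟩
  set P := lobattoInterp r y with hP
  have hdeg : P.natDegree ≤ r := natDegree_lobattoInterp hr y
  set z : ℕ → ℝ := fun j => P.eval (lobattoNode (r + 1) j)
  have hPz : lobattoInterp (r + 1) z = P :=
    lobattoInterp_eq_of_eval (by omega) (by omega) (fun j _ => rfl)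
  have hz : lobattoNorm (r + 1) z ^ 2 = polyInt (P ^ 2) := by
    rw [sq_lobattoNorm (by omega), ← lobattoQuad_eq_polyInt (show 1 ≤ r + 1 by omega)]
    · simp only [lobattoQuad, eval_pow]; rfl
    · refine natDegree_pow_le.trans ?_
      have := Nat.mul_le_mul_left 2 hdeg
      omega
  have hI : 0 ≤ polyInt (P ^ 2) := by rw [← hz]; positivity
  have hbound : ∀ j < r + 1, |y j| ≤ C * lobattoNorm (r + 1) z := by
    intro j hj
    have := (H z _ (lobattoNode_mem hr hj)).1
    rwa [hPz, hP, eval_lobattoInterp_node hr hj] at this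
  have hn := lobattoNorm_le_of_abs_le hr
    (mul_nonneg hC.le (lobattoNorm_nonneg (r + 1) z)) hbound
  calc lobattoNorm r y ^ 2 ≤ (√(weightSum r) * (C * lobattoNorm (r + 1) z)) ^ 2 :=
        pow_le_pow_left₀ (lobattoNorm_nonneg r y) hn 2
    _ = weightSum r * C ^ 2 * polyInt (P ^ 2) := by
        rw [mul_pow, Real.sq_sqrt hW, mul_pow, hz]; ring
    _ ≤ _ := by linarith

lemma exists_antiderivative (p : ℝ[X]) (c : ℝ) :
    ∃ q : ℝ[X], derivative q = p ∧ q.eval 0 = c ∧ q.natDegree ≤ p.natDegree + 1 := by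
  refine ⟨∑ i ∈ Finset.range (p.natDegree + 1), C (p.coeff i / (i + 1)) * X ^ (i + 1) + C c,
    ?_, ?_, ?_⟩
  · conv_rhs => rw [p.as_sum_range' (p.natDegree + 1) (Nat.lt_succ_self _)]
    rw [derivative_add, derivative_C, add_zero, derivative_sum]
    refine Finset.sum_congr rfl fun i _ => ?_
    rw [derivative_C_mul_X_pow, ← C_mul_X_pow_eq_monomial]
    congr 2
    push_cast
    field_simp
  · rw [eval_add, eval_C, eval_finsetSum, Finset.sum_eq_zero, zero_add]
    intro i _
    simp
  · refine natDegree_add_le_of_degree_le (natDegree_sum_le_of_forall_le _ _ fun i hi => ?_)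
      (by simp)
    refine (natDegree_C_mul_X_pow_le _ _).trans ?_
    have := Finset.mem_range.mp hi
    omega

/-- Taylor approximation on `[0, 1]` of a function and of its derivatives at the same time. -/
lemma exists_taylor_polynomial (m : ℕ) {v : ℝ → ℝ} (hv : ContDiff ℝ (m + 1 : ℕ) v) {K : ℝ}
    (hK : ∀ x ∈ Icc (0 : ℝ) 1, |iteratedDeriv (m + 1) v x| ≤ K) :
    ∃ T : ℝ[X], T.natDegree ≤ m ∧ ∀ i ≤ m, ∀ x ∈ Icc (0 : ℝ) 1,
      |iteratedDeriv i v x - (derivative^[i] T).eval x| ≤ K := by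
  have key : ∀ w : ℝ → ℝ, Differentiable ℝ w → w 0 = 0 →
      (∀ x ∈ Icc (0 : ℝ) 1, |deriv w x| ≤ K) → ∀ x ∈ Icc (0 : ℝ) 1, |w x| ≤ K := by
    intro w hw hw0 hd x hx
    have h := (convex_Icc (0 : ℝ) 1).norm_image_sub_le_of_norm_deriv_le
      (fun y _ => hw y) hd (show (0 : ℝ) ∈ Icc (0 : ℝ) 1 by simp) hx
    have hK0 : 0 ≤ K := (abs_nonneg _).trans (hd x hx)
    rw [hw0, sub_zero, sub_zero, Real.norm_eq_abs, Real.norm_eq_abs, abs_of_nonneg hx.1] at h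
    nlinarith [hx.2]
  induction m generalizing v with
  | zero =>
    refine ⟨C (v 0), by simp, fun i hi x hx => ?_⟩
    obtain rfl : i = 0 := by omega
    simp only [iteratedDeriv_zero, Function.iterate_zero, id, eval_C]
    refine key (fun x => v x - v 0) ((hv.differentiable (by simp)).sub_const _) (by simp) ?_ x hx
    intro y hy
    have := hK y hy
    simpa [iteratedDeriv_one] using this
  | succ m ih =>
    have hd : ContDiff ℝ (m + 1 : ℕ) (deriv v) := by
      have h2 : ContDiff ℝ ((m + 1 : ℕ) + 1) v := by exact_mod_cast hv
      exact (contDiff_succ_iff_deriv.mp h2).2.2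
    obtain ⟨S, hS, HS⟩ := ih hd (fun x hx => by rw [← iteratedDeriv_succ']; exact hK x hx)
    obtain ⟨T, hT, hT0, hTd⟩ := exists_antiderivative S (v 0)
    refine ⟨T, by omega, fun i hi x hx => ?_⟩
    rcases i with _ | i
    · simp only [iteratedDeriv_zero, Function.iterate_zero, id]
      have hvd : Differentiable ℝ v := hv.differentiable (by simp)
      refine key (fun x => v x - T.eval x) (hvd.sub T.differentiable) (by simp [hT0]) ?_ x hx
      intro y hy
      have h0 := HS 0 (by omega) y hy
      rw [deriv_fun_sub (hvd y) T.differentiable.differentiableAt, Polynomial.deriv, hT]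
      simpa using h0
    · rw [iteratedDeriv_succ', Function.iterate_succ_apply, hT]
      exact HS i (by omega) x hx

/-- The interpolation error at the Gauss–Lobatto points on the reference element. -/
lemma exists_abs_sub_lobattoInterp_le {r : ℕ} (hr : 1 ≤ r) :
    ∃ C : ℝ, 0 < C ∧ ∀ (v : ℝ → ℝ) (K : ℝ), ContDiff ℝ r v →
      (∀ x ∈ Icc (0 : ℝ) 1, |iteratedDeriv r v x| ≤ K) → ∀ x ∈ Icc (0 : ℝ) 1,
        |v x - (lobattoInterp r (fun j => v (lobattoNode r j))).eval x| ≤ C * K := by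
  obtain ⟨C, hC, H⟩ := exists_abs_eval_lobattoInterp_le hr
  refine ⟨1 + C * √(weightSum r), by positivity, fun v K hv hK x hx => ?_⟩
  obtain ⟨m, rfl⟩ : ∃ m, r = m + 1 := ⟨r - 1, by omega⟩
  obtain ⟨T, hT, HT⟩ := exists_taylor_polynomial m hv hK
  have hK0 : 0 ≤ K := (abs_nonneg _).trans (hK x hx)
  have hR : ∀ x ∈ Icc (0 : ℝ) 1, |v x - T.eval x| ≤ K := fun x hx => by
    simpa using HT 0 (by omega) x hx
  have hI : lobattoInterp (m + 1) (fun j => T.eval (lobattoNode (m + 1) j)) = T :=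
    lobattoInterp_eq_of_eval hr (by omega) (fun _ _ => rfl)
  have hsub : (lobattoInterp (m + 1) (fun j => v (lobattoNode (m + 1) j))).eval x - T.eval x =
      (lobattoInterp (m + 1) (fun j => v (lobattoNode (m + 1) j) -
        T.eval (lobattoNode (m + 1) j))).eval x := by
    conv_lhs => rw [← hI]
    simp only [lobattoInterp, eval_finsetSum, eval_mul, eval_C, ← Finset.sum_sub_distrib]
    simp only [sub_mul]
  have h1 := (H (fun j => v (lobattoNode (m + 1) j) - T.eval (lobattoNode (m + 1) j)) x hx).1
  have h2 := lobattoNorm_le_of_abs_le hr hK0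
    (y := fun j => v (lobattoNode (m + 1) j) - T.eval (lobattoNode (m + 1) j))
    (fun j hj => hR _ (lobattoNode_mem hr hj))
  rw [← hsub] at h1
  have h3 := hR x hx
  calc _ = |(v x - T.eval x) - ((lobattoInterp (m + 1)
        (fun j => v (lobattoNode (m + 1) j))).eval x - T.eval x)| := by congr 1; ring
    _ ≤ K + C * (√(weightSum (m + 1)) * K) :=
        (abs_sub _ _).trans (add_le_add h3 (h1.trans (mul_le_mul_of_nonneg_left h2 hC.le)))
    _ = _ := by ring

/-- For polynomials of degree `r + 1` both the lumping of the mass matrix and the interpolation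
are consistent with the weak form of the second derivative: after an integration by parts all
integrands have degree at most `2 r - 1`, so they are integrated exactly. -/
lemma lobatto_consistency_polynomial {r : ℕ} (hr : 1 ≤ r) {T : ℝ[X]} (hT : T.natDegree ≤ r + 1)
    (y : ℕ → ℝ) :
    lobattoQuad r (fun x => (derivative (derivative T) * lobattoInterp r y).eval x) =
        polyInt (derivative (derivative T) * lobattoInterp r y) ∧
      polyInt (derivative (lobattoInterp r (fun j => T.eval (lobattoNode r j)) - T) *
        derivative (lobattoInterp r y)) = 0 := by
  have hP := natDegree_lobattoInterp hr y
  have hd1 := natDegree_derivative_le T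
  have hd2 := natDegree_derivative_le (derivative T)
  refine ⟨lobattoQuad_eq_polyInt hr (natDegree_mul_le.trans (by omega)), ?_⟩
  set I := lobattoInterp r (fun j => T.eval (lobattoNode r j))
  have hI : ∀ j < r + 1, (I - T).eval (lobattoNode r j) = 0 := by
    intro j hj
    rw [eval_sub, eval_lobattoInterp_node hr hj, sub_self]
  have h0 := hI 0 (by omega)
  have h1 := hI r (by omega)
  rw [lobattoNode_zero hr] at h0
  rw [lobattoNode_last hr] at h1
  rw [polyInt_derivative_mul, h0, h1, zero_mul, zero_mul, sub_zero, zero_sub, neg_eq_zero]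
  rcases hr.eq_or_lt with h | h
  · have : derivative (derivative (lobattoInterp r y)) = 0 :=
      iterate_derivative_eq_zero (x := 2) (by omega)
    rw [this, mul_zero, map_zero]
  · have hIT : (I - T).natDegree ≤ r + 1 :=
      (natDegree_sub_le _ _).trans (max_le ((natDegree_lobattoInterp hr _).trans (by omega)) hT)
    have hp1 := natDegree_derivative_le (lobattoInterp r y)
    have hp2 := natDegree_derivative_le (derivative (lobattoInterp r y))
    rw [← lobattoQuad_eq_polyInt hr (natDegree_mul_le.trans (by omega)), lobattoQuad]
    refine Finset.sum_eq_zero fun j hj => ?_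
    rw [eval_mul, hI j (by simpa using hj)]
    ring

/-- The consistency error of mass lumping and interpolation on the reference element. -/
lemma exists_lobatto_consistency_le {r : ℕ} (hr : 1 ≤ r) :
    ∃ C : ℝ, 0 < C ∧ ∀ (v : ℝ → ℝ) (K : ℝ) (y : ℕ → ℝ), ContDiff ℝ (r + 2 : ℕ) v →
      (∀ x ∈ Icc (0 : ℝ) 1, |iteratedDeriv (r + 2) v x| ≤ K) →
      |(∑ j ∈ Finset.range (r + 1), lobattoWeight r j * (deriv (deriv v) (lobattoNode r j) * y j)) -
          (∫ x in (0 : ℝ)..1, deriv (deriv v) x * (lobattoInterp r y).eval x) +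
          ((∫ x in (0 : ℝ)..1, (derivative (lobattoInterp r
            (fun j => v (lobattoNode r j)))).eval x * (derivative (lobattoInterp r y)).eval x) -
          ∫ x in (0 : ℝ)..1, deriv v x * (derivative (lobattoInterp r y)).eval x)| ≤
        C * K * lobattoNorm r y := by
  obtain ⟨C, hC, H⟩ := exists_abs_eval_lobattoInterp_le hr
  have hW := weightSum_nonneg hr
  refine ⟨weightSum r * C + C + (C * √(weightSum r) + 1) * C, by positivity,
    fun v K y hv hK => ?_⟩
  obtain ⟨T, hT, HT⟩ := exists_taylor_polynomial (r + 1) hv hK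
  have hK0 : 0 ≤ K := (abs_nonneg _).trans (hK 0 (by simp))
  set P := lobattoInterp r y
  have hv1 : Differentiable ℝ v := hv.differentiable (by simp)
  have hcd1 : ContDiff ℝ (r + 1 : ℕ) (deriv v) := by
    have h2 : ContDiff ℝ ((r + 1 : ℕ) + 1) v := by exact_mod_cast hv
    exact (contDiff_succ_iff_deriv.mp h2).2.2
  have hc1 : Continuous (deriv v) := hcd1.continuous
  have hc2 : Continuous (deriv (deriv v)) := hcd1.continuous_deriv (by simp)
  -- the Taylor remainders of the function and of its first two derivatives
  set R₀ : ℝ → ℝ := fun x => v x - T.eval x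
  set R₁ : ℝ → ℝ := fun x => deriv v x - (derivative T).eval x
  set R₂ : ℝ → ℝ := fun x => deriv (deriv v) x - (derivative (derivative T)).eval x
  have b₀ : ∀ x ∈ Icc (0 : ℝ) 1, |R₀ x| ≤ K := fun x hx => by
    simpa using HT 0 (by omega) x hx
  have b₁ : ∀ x ∈ Icc (0 : ℝ) 1, |R₁ x| ≤ K := fun x hx => by
    have := HT 1 (by omega) x hx
    rw [iteratedDeriv_one] at this
    exact this
  have b₂ : ∀ x ∈ Icc (0 : ℝ) 1, |R₂ x| ≤ K := fun x hx => by
    have := HT 2 (by omega) x hx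
    rw [iteratedDeriv_succ, iteratedDeriv_one] at this
    exact this
  have hR₁ : Continuous R₁ := hc1.sub (derivative T).continuous
  have hR₂ : Continuous R₂ := hc2.sub (derivative (derivative T)).continuous
  set J := lobattoInterp r (fun j => R₀ (lobattoNode r j))
  have hJ : lobattoInterp r (fun j => v (lobattoNode r j)) =
      J + lobattoInterp r (fun j => T.eval (lobattoNode r j)) := by
    simp only [J, R₀, lobattoInterp, ← Finset.sum_add_distrib]
    refine Finset.sum_congr rfl fun j _ => ?_
    rw [C_sub]; ring
  obtain ⟨hc, hd⟩ := lobatto_consistency_polynomial hr hT y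
  have hn := lobattoNorm_nonneg r y
  have hPc := P.continuous
  have hP'c := (derivative P).continuous
  have e₁ : ∑ j ∈ Finset.range (r + 1),
        lobattoWeight r j * (deriv (deriv v) (lobattoNode r j) * y j) =
      (∑ j ∈ Finset.range (r + 1), lobattoWeight r j * (R₂ (lobattoNode r j) * y j)) +
        polyInt (derivative (derivative T) * P) := by
    rw [← hc, lobattoQuad, ← Finset.sum_add_distrib]
    refine Finset.sum_congr rfl fun j hj => ?_
    rw [eval_mul, eval_lobattoInterp_node hr (by simpa using hj)]
    simp only [R₂]; ring
  have e₂ : ∫ x in (0 : ℝ)..1, deriv (deriv v) x * P.eval x =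
      (∫ x in (0 : ℝ)..1, R₂ x * P.eval x) + polyInt (derivative (derivative T) * P) := by
    rw [polyInt_apply, ← intervalIntegral.integral_add
      ((hR₂.fun_mul hPc).intervalIntegrable _ _)
      ((derivative (derivative T) * P).continuous.intervalIntegrable _ _)]
    congr 1; ext x
    simp only [R₂, eval_mul]; ring
  have e₃ : (∫ x in (0 : ℝ)..1, (derivative (lobattoInterp r
        (fun j => v (lobattoNode r j)))).eval x * (derivative P).eval x) -
      (∫ x in (0 : ℝ)..1, deriv v x * (derivative P).eval x) =
      ∫ x in (0 : ℝ)..1, ((derivative J).eval x - R₁ x) * (derivative P).eval x := by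
    have : (∫ x in (0 : ℝ)..1, ((derivative J).eval x - R₁ x) * (derivative P).eval x) =
        (∫ x in (0 : ℝ)..1, ((derivative J).eval x - R₁ x) * (derivative P).eval x) +
        polyInt (derivative (lobattoInterp r (fun j => T.eval (lobattoNode r j)) - T) *
          derivative P) := by rw [hd, add_zero]
    rw [this, polyInt_apply, ← intervalIntegral.integral_sub
        ((((derivative (lobattoInterp r (fun j => v (lobattoNode r j)))).continuous).fun_mul
          hP'c).intervalIntegrable _ _)
        ((hc1.fun_mul hP'c).intervalIntegrable _ _),
      ← intervalIntegral.integral_add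
        (((((derivative J).continuous).fun_sub hR₁).fun_mul hP'c).intervalIntegrable _ _)
        ((Polynomial.continuous _).intervalIntegrable _ _)]
    congr 1; ext x
    rw [hJ]
    simp only [R₁, eval_mul, derivative_sub, derivative_add, eval_sub, eval_add]; ring
  rw [e₁, e₂, e₃]
  have f₁ : |∑ j ∈ Finset.range (r + 1), lobattoWeight r j * (R₂ (lobattoNode r j) * y j)| ≤
      weightSum r * C * K * lobattoNorm r y := by
    calc _ ≤ ∑ j ∈ Finset.range (r + 1), lobattoWeight r j * (K * (C * lobattoNorm r y)) := by
          refine (Finset.abs_sum_le_sum_abs _ _).trans (Finset.sum_le_sum fun j hj => ?_)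
          have hj' : j < r + 1 := by simpa using hj
          have hw := lobattoWeight_pos hr hj'
          have hy := (H y _ (lobattoNode_mem hr hj')).1
          rw [eval_lobattoInterp_node hr hj'] at hy
          rw [abs_mul, abs_mul, abs_of_pos hw]
          exact mul_le_mul_of_nonneg_left
            (mul_le_mul (b₂ _ (lobattoNode_mem hr hj')) hy (abs_nonneg _) hK0) hw.le
      _ = _ := by rw [← Finset.sum_mul, ← weightSum]; ring
  have f₂ : |∫ x in (0 : ℝ)..1, R₂ x * P.eval x| ≤ K * (C * lobattoNorm r y) := by
    have h := intervalIntegral.norm_integral_le_of_norm_le_const (a := 0) (b := 1)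
      (f := fun x => R₂ x * P.eval x) (C := K * (C * lobattoNorm r y)) ?_
    · simpa using h
    · intro x hx
      rw [uIoc_of_le zero_le_one] at hx
      have hx' := Ioc_subset_Icc_self hx
      rw [Real.norm_eq_abs, abs_mul]
      exact mul_le_mul (b₂ x hx') (H y x hx').1 (abs_nonneg _) hK0
  have f₃ : |∫ x in (0 : ℝ)..1, ((derivative J).eval x - R₁ x) * (derivative P).eval x| ≤
      (C * (√(weightSum r) * K) + K) * (C * lobattoNorm r y) := by
    have h := intervalIntegral.norm_integral_le_of_norm_le_const (a := 0) (b := 1)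
      (f := fun x => ((derivative J).eval x - R₁ x) * (derivative P).eval x)
      (C := (C * (√(weightSum r) * K) + K) * (C * lobattoNorm r y)) ?_
    · simpa using h
    · intro x hx
      rw [uIoc_of_le zero_le_one] at hx
      have hx' := Ioc_subset_Icc_self hx
      rw [Real.norm_eq_abs, abs_mul]
      have hJn := lobattoNorm_le_of_abs_le hr hK0 (y := fun j => R₀ (lobattoNode r j))
        (fun j hj => b₀ _ (lobattoNode_mem hr hj))
      have hJb := (H (fun j => R₀ (lobattoNode r j)) x hx').2.trans
        (mul_le_mul_of_nonneg_left hJn hC.le)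
      exact mul_le_mul ((abs_sub _ _).trans (add_le_add hJb (b₁ x hx'))) (H y x hx').2
        (abs_nonneg _) (by positivity)
  rw [show ∀ a b c d : ℝ, a + b - (c + b) + d = a - c + d by intros; ring]
  refine (abs_add_le _ _).trans ((add_le_add ((abs_sub _ _).trans (add_le_add f₁ f₂)) f₃).trans
    (le_of_eq ?_))
  ring

end Reference

/-! ### The partition into elements -/

section Assembly

open Polynomial

lemma meshSize_pos {a b : ℝ} (hab : a < b) {M : ℕ} (hM : 1 ≤ M) : 0 < meshSize a b M :=
  div_pos (sub_pos.mpr hab) (by exact_mod_cast hM)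

lemma natCast_mul_meshSize (a b : ℝ) {M : ℕ} (hM : 1 ≤ M) : (M : ℝ) * meshSize a b M = b - a := by
  have : (M : ℝ) ≠ 0 := by positivity
  rw [meshSize]; field_simp

lemma element_mem_Icc {a b : ℝ} (hab : a < b) {M i : ℕ} (hi : i < M) {ξ : ℝ}
    (hξ : ξ ∈ Icc (0 : ℝ) 1) : a + (i + ξ) * meshSize a b M ∈ Icc a b := by
  have hM : 1 ≤ M := by omega
  have hh := meshSize_pos hab hM
  have hMh := natCast_mul_meshSize a b hM
  have hi' : (i : ℝ) + 1 ≤ M := by exact_mod_cast hi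
  constructor
  · have : (0 : ℝ) ≤ i + ξ := add_nonneg (Nat.cast_nonneg _) hξ.1
    have := mul_nonneg this hh.le
    linarith
  · have := mul_le_mul_of_nonneg_right (show (i : ℝ) + ξ ≤ M by linarith [hξ.2]) hh.le
    linarith

lemma integral_element {a b : ℝ} (hab : a < b) {M : ℕ} (hM : 1 ≤ M) (i : ℕ) (F : ℝ → ℝ) :
    ∫ x in (a + i * meshSize a b M)..(a + (i + 1) * meshSize a b M), F x =
      meshSize a b M * ∫ ξ in (0 : ℝ)..1, F (a + (i + ξ) * meshSize a b M) := by
  have hh := meshSize_pos hab hM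
  have h := intervalIntegral.integral_comp_add_mul (a := 0) (b := 1) F hh.ne'
    (a + i * meshSize a b M)
  have e : ∀ ξ : ℝ, a + (i + ξ) * meshSize a b M =
      a + i * meshSize a b M + meshSize a b M * ξ := fun ξ => by ring
  simp_rw [e]
  rw [h, smul_eq_mul, ← mul_assoc, mul_inv_cancel₀ hh.ne', one_mul]
  congr 1
  ring

lemma integral_eq_sum_elements {a b : ℝ} (hab : a < b) {M : ℕ} (hM : 1 ≤ M) {F : ℝ → ℝ}
    (hF : ∀ i < M, IntervalIntegrable F volume (a + i * meshSize a b M)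
      (a + (i + 1) * meshSize a b M)) :
    ∫ x in a..b, F x =
      ∑ i ∈ Finset.range M,
        meshSize a b M * ∫ ξ in (0 : ℝ)..1, F (a + (i + ξ) * meshSize a b M) := by
  have h := intervalIntegral.sum_integral_adjacent_intervals (f := F) (μ := volume)
    (a := fun i : ℕ => a + i * meshSize a b M) (n := M)
    (fun i hi => by simpa using hF i hi)
  simp only [Nat.cast_zero, zero_mul, add_zero, natCast_mul_meshSize a b hM, Nat.cast_add,
    Nat.cast_one, add_sub_cancel] at h
  rw [← h]
  exact Finset.sum_congr rfl fun i _ => integral_element hab hM i F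

/-! ### Local nodal values and the matrices of the method -/

/-- The values of a nodal vector at the nodes of the `i`-th element. -/
def localVals {M r : ℕ} (v : Fin (M * r + 1) → ℝ) (i j : ℕ) : ℝ :=
  if h : i * r + j < M * r + 1 then v ⟨i * r + j, h⟩ else 0

/-- The polynomial on `[0, 1]` which represents a finite element function on the `i`-th element. -/
noncomputable def localPoly {M r : ℕ} (v : Fin (M * r + 1) → ℝ) (i : ℕ) : ℝ[X] :=
  lobattoInterp r (localVals v i)

lemma localIndex_lt {M r i j : ℕ} (hi : i < M) (hj : j < r + 1) : i * r + j < M * r + 1 := by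
  have := Nat.mul_le_mul_right r (show i + 1 ≤ M from hi)
  rw [add_mul, one_mul] at this
  omega

lemma localVals_of_lt {M r i j : ℕ} (hi : i < M) (hj : j < r + 1) (v : Fin (M * r + 1) → ℝ) :
    localVals v i j = v ⟨i * r + j, localIndex_lt hi hj⟩ := by
  rw [localVals, dif_pos (localIndex_lt hi hj)]

lemma localVals_add_one {M r : ℕ} (v : Fin (M * r + 1) → ℝ) (i : ℕ) :
    localVals v i r = localVals v (i + 1) 0 := by
  simp only [localVals, add_mul, one_mul, add_zero]

lemma sum_mul_local_sum {M r i : ℕ} (hi : i < M) (v : Fin (M * r + 1) → ℝ) (c : ℕ → ℝ) :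
    ∑ g, v g * (∑ j ∈ Finset.range (r + 1), if i * r + j = g.val then c j else 0) =
      ∑ j ∈ Finset.range (r + 1), localVals v i j * c j := by
  simp_rw [Finset.mul_sum]
  rw [Finset.sum_comm]
  refine Finset.sum_congr rfl fun j hj => ?_
  have hj' : j < r + 1 := by simpa using hj
  rw [Finset.sum_eq_single ⟨i * r + j, localIndex_lt hi hj'⟩]
  · rw [if_pos rfl, localVals_of_lt hi hj']
  · intro g _ hg
    rw [if_neg, mul_zero]
    intro h
    exact hg (Fin.ext h.symm)
  · intro h; exact absurd (Finset.mem_univ _) h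

/-- The nodal basis function of number `g` on the `i`-th element, as a polynomial on `[0, 1]`. -/
noncomputable def localBasis (M r i : ℕ) (g : Fin (M * r + 1)) : ℝ[X] :=
  ∑ j ∈ Finset.range (r + 1), if i * r + j = g.val then lobattoBasis r j else 0

lemma localPoly_eq_sum {M r i : ℕ} (hi : i < M) (v : Fin (M * r + 1) → ℝ) :
    localPoly v i = ∑ g, C (v g) * localBasis M r i g := by
  refine Polynomial.funext fun x => ?_
  have h := sum_mul_local_sum hi v (fun j => (lobattoBasis r j).eval x)
  rw [localPoly, lobattoInterp, eval_finsetSum, eval_finsetSum]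
  simp only [eval_mul, eval_C, localBasis, eval_finsetSum]
  rw [← h]
  refine Finset.sum_congr rfl fun g _ => ?_
  congr 1
  refine Finset.sum_congr rfl fun j _ => ?_
  split_ifs <;> simp

lemma nodalBasis_eq_localBasis {a b : ℝ} (hab : a < b) {M r i : ℕ} (hi : i < M)
    (g : Fin (M * r + 1)) {x : ℝ}
    (hx : x ∈ Ioo (a + i * meshSize a b M) (a + (i + 1) * meshSize a b M)) :
    nodalBasis a b M r g x = (localBasis M r i g).eval ((x - a) / meshSize a b M - i) := by
  have hh := meshSize_pos hab (show 1 ≤ M by omega)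
  have hfl : ⌊(x - a) / meshSize a b M⌋₊ = i := by
    rw [Nat.floor_eq_iff]
    · constructor
      · rw [le_div_iff₀ hh]; linarith [hx.1]
      · rw [div_lt_iff₀ hh]; linarith [hx.2]
    · have : (0 : ℝ) ≤ i * meshSize a b M := by positivity
      exact div_nonneg (by linarith [hx.1]) hh.le
  have hmin : min i (M - 1) = i := by omega
  rw [nodalBasis, hfl, hmin, localBasis, eval_finsetSum]
  refine Finset.sum_congr rfl fun j _ => ?_
  split_ifs <;> simp

lemma deriv_nodalBasis {a b : ℝ} (hab : a < b) {M r i : ℕ} (hi : i < M)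
    (g : Fin (M * r + 1)) {x : ℝ}
    (hx : x ∈ Ioo (a + i * meshSize a b M) (a + (i + 1) * meshSize a b M)) :
    deriv (nodalBasis a b M r g) x =
      (derivative (localBasis M r i g)).eval ((x - a) / meshSize a b M - i) *
        (meshSize a b M)⁻¹ := by
  have he : nodalBasis a b M r g =ᶠ[nhds x]
      fun x => (localBasis M r i g).eval ((x - a) / meshSize a b M - i) := by
    filter_upwards [isOpen_Ioo.mem_nhds hx] with y hy
    exact nodalBasis_eq_localBasis hab hi g hy
  rw [he.deriv_eq]
  have h1 : HasDerivAt (fun x => (x - a) / meshSize a b M - (i : ℝ)) (meshSize a b M)⁻¹ x := by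
    simpa using (((hasDerivAt_id x).sub_const a).div_const (meshSize a b M)).sub_const (i : ℝ)
  exact (((localBasis M r i g).hasDerivAt _).comp x h1).deriv

lemma stiffMatrix_eq {a b : ℝ} (hab : a < b) {M r : ℕ} (hM : 1 ≤ M) (g g' : Fin (M * r + 1)) :
    stiffMatrix a b M r g g' = -∑ i ∈ Finset.range M, (meshSize a b M)⁻¹ *
      polyInt (derivative (localBasis M r i g) * derivative (localBasis M r i g')) := by
  have hh := meshSize_pos hab hM
  set h := meshSize a b M with hdef
  have hle : ∀ i : ℕ, a + i * h ≤ a + (i + 1) * h := fun i => by nlinarith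
  have hEq : ∀ i < M, EqOn
      (fun x => (derivative (localBasis M r i g) * derivative (localBasis M r i g')).eval
        ((x - a) / h - i) * (h⁻¹ * h⁻¹))
      (fun x => deriv (nodalBasis a b M r g) x * deriv (nodalBasis a b M r g') x)
      (uIoo (a + i * h) (a + (i + 1) * h)) := by
    intro i hi x hx
    rw [uIoo_of_le (hle i)] at hx
    simp only
    rw [deriv_nodalBasis hab hi g hx, deriv_nodalBasis hab hi g' hx, eval_mul]
    ring
  rw [stiffMatrix, Matrix.of_apply, integral_eq_sum_elements hab hM]
  · congr 1
    refine Finset.sum_congr rfl fun i hi => ?_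
    have hi' : i < M := by simpa using hi
    rw [← integral_element hab hM i (fun x => deriv (nodalBasis a b M r g) x *
        deriv (nodalBasis a b M r g') x), ← intervalIntegral.integral_congr_uIoo (hEq i hi'),
      integral_element hab hM, ← hdef, polyInt_apply, intervalIntegral.integral_mul_const]
    have : ∀ ξ : ℝ, (a + (i + ξ) * h - a) / h - i = ξ := fun ξ => by field_simp; ring
    simp_rw [this]
    field_simp
  · intro i hi
    refine IntervalIntegrable.congr_uIoo (Continuous.intervalIntegrable ?_ _ _) (hEq i hi)
    exact ((Polynomial.continuous _).comp (by fun_prop)).mul continuous_const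

/-- The stiffness matrix in terms of local polynomials. -/
lemma dotProduct_stiffMatrix_mulVec {a b : ℝ} (hab : a < b) {M r : ℕ} (hM : 1 ≤ M)
    (v w : Fin (M * r + 1) → ℝ) :
    v ⬝ᵥ (stiffMatrix a b M r *ᵥ w) = -∑ i ∈ Finset.range M, (meshSize a b M)⁻¹ *
      polyInt (derivative (localPoly v i) * derivative (localPoly w i)) := by
  have hloc : ∀ i ∈ Finset.range M,
      polyInt (derivative (localPoly v i) * derivative (localPoly w i)) =
      ∑ g, ∑ g', v g * w g' *
        polyInt (derivative (localBasis M r i g) * derivative (localBasis M r i g')) := by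
    intro i hi
    have hi' : i < M := by simpa using hi
    rw [localPoly_eq_sum hi', localPoly_eq_sum hi', derivative_sum, derivative_sum,
      Finset.sum_mul_sum, map_sum]
    refine Finset.sum_congr rfl fun g _ => ?_
    rw [map_sum]
    refine Finset.sum_congr rfl fun g' _ => ?_
    rw [derivative_C_mul, derivative_C_mul, mul_mul_mul_comm, ← C_mul, ← smul_eq_C_mul, map_smul,
      smul_eq_mul]
  rw [Finset.sum_congr rfl (fun i hi => by rw [hloc i hi])]
  simp only [dotProduct, Matrix.mulVec, stiffMatrix_eq hab hM, Finset.mul_sum, neg_mul, mul_neg,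
    Finset.sum_neg_distrib, Finset.sum_mul]
  congr 1
  symm
  rw [Finset.sum_comm]
  refine Finset.sum_congr rfl fun g _ => ?_
  rw [Finset.sum_comm]
  refine Finset.sum_congr rfl fun g' _ => Finset.sum_congr rfl fun i _ => ?_
  ring

lemma sum_mul_nodeWeight (a b : ℝ) {M r : ℕ} (v : Fin (M * r + 1) → ℝ) :
    ∑ g, v g * nodeWeight a b M r g = meshSize a b M * ∑ i ∈ Finset.range M,
      ∑ j ∈ Finset.range (r + 1), lobattoWeight r j * localVals v i j := by
  simp only [nodeWeight, Finset.mul_sum (s := Finset.range M)]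
  rw [Finset.sum_comm]
  refine Finset.sum_congr rfl fun i hi => ?_
  rw [sum_mul_local_sum (by simpa using hi), Finset.mul_sum]
  exact Finset.sum_congr rfl fun j _ => by ring

lemma nodeWeight_pos {a b : ℝ} (hab : a < b) {M r : ℕ} (hM : 1 ≤ M) (hr : 1 ≤ r)
    (g : Fin (M * r + 1)) : 0 < nodeWeight a b M r g := by
  have hh := meshSize_pos hab hM
  have hnn : ∀ i ∈ Finset.range M, ∀ j ∈ Finset.range (r + 1),
      0 ≤ if i * r + j = g.val then meshSize a b M * lobattoWeight r j else 0 := by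
    intro i _ j hj
    split_ifs
    · exact (mul_pos hh (lobattoWeight_pos hr (by simpa using hj))).le
    · exact le_rfl
  obtain ⟨i, j, hi, hj, hg⟩ : ∃ i j, i < M ∧ j < r + 1 ∧ i * r + j = g.val := by
    have hg := g.2
    rcases (Nat.lt_succ_iff.mp hg).eq_or_lt with h | h
    · obtain ⟨m, rfl⟩ : ∃ m, M = m + 1 := ⟨M - 1, by omega⟩
      exact ⟨m, r, by omega, by omega, by rw [h]; ring⟩
    · exact ⟨g.val / r, g.val % r, (Nat.div_lt_iff_lt_mul hr).mpr h,
        (Nat.mod_lt _ hr).trans (Nat.lt_succ_self r), Nat.div_add_mod' _ _⟩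
  refine Finset.sum_pos' (fun i hi => Finset.sum_nonneg (hnn i hi)) ⟨i, by simpa using hi, ?_⟩
  refine Finset.sum_pos' (hnn i (by simpa using hi)) ⟨j, by simpa using hj, ?_⟩
  rw [if_pos hg]
  exact mul_pos hh (lobattoWeight_pos hr hj)

lemma node_local {a b : ℝ} {M r i j : ℕ} (hr : 1 ≤ r) (hi : i < M) (hj : j < r + 1) :
    node a b M r ⟨i * r + j, localIndex_lt hi hj⟩ =
      a + (i + lobattoNode r j) * meshSize a b M := by
  rw [node]
  simp only
  rcases (Nat.lt_succ_iff.mp hj).eq_or_lt with h | h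
  · subst h
    rw [show i * j + j = (i + 1) * j by ring, Nat.mul_div_cancel _ (by omega), Nat.mul_mod_left,
      lobattoNode_zero hr, lobattoNode_last hr]
    push_cast; ring
  · rw [show i * r + j = j + r * i by ring, Nat.add_mul_div_left _ _ (by omega),
      Nat.add_mul_mod_self_left, Nat.div_eq_of_lt h, Nat.mod_eq_of_lt h, zero_add]

lemma node_mem_Icc {a b : ℝ} (hab : a < b) {M r : ℕ} (hM : 1 ≤ M) (hr : 1 ≤ r)
    (g : Fin (M * r + 1)) : node a b M r g ∈ Icc a b := by
  have hg := g.2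
  rcases (Nat.lt_succ_iff.mp hg).eq_or_lt with h | h
  · have : node a b M r g = b := by
      rw [node, h, Nat.mul_div_cancel _ (by omega), Nat.mul_mod_left, lobattoNode_zero hr,
        add_zero, natCast_mul_meshSize a b hM]
      ring
    rw [this]; exact right_mem_Icc.mpr hab.le
  · exact element_mem_Icc hab ((Nat.div_lt_iff_lt_mul hr).mpr h)
      (lobattoNode_mem hr ((Nat.mod_lt _ hr).trans (Nat.lt_succ_self r)))

lemma localVals_nodalVec {a b : ℝ} {M r i j : ℕ} (hr : 1 ≤ r) (hi : i < M) (hj : j < r + 1)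
    (v : ℝ → ℝ) :
    localVals (nodalVec a b M r v) i j = v (a + (i + lobattoNode r j) * meshSize a b M) := by
  rw [localVals_of_lt hi hj, nodalVec, node_local hr hi hj]

lemma localPoly_nodalVec {a b : ℝ} {M r i : ℕ} (hr : 1 ≤ r) (hi : i < M) (v : ℝ → ℝ) :
    localPoly (nodalVec a b M r v) i =
      lobattoInterp r (fun j => v (a + (i + lobattoNode r j) * meshSize a b M)) := by
  rw [localPoly, lobattoInterp, lobattoInterp]
  refine Finset.sum_congr rfl fun j hj => ?_
  rw [localVals_nodalVec hr hi (by simpa using hj)]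

/-! ### The discrete norm and the contractivity of the semidiscrete heat flow -/

/-- The norm of the inner product of the lumped mass matrix. -/
noncomputable def lumpedNorm (a b : ℝ) (M r : ℕ) (v : Fin (M * r + 1) → ℝ) : ℝ :=
  √(∑ g, v g ^ 2 * nodeWeight a b M r g)

lemma lumpedNorm_nonneg (a b : ℝ) (M r : ℕ) (v : Fin (M * r + 1) → ℝ) :
    0 ≤ lumpedNorm a b M r v := Real.sqrt_nonneg _

lemma sq_lumpedNorm {a b : ℝ} (hab : a < b) {M r : ℕ} (hM : 1 ≤ M) (hr : 1 ≤ r)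
    (v : Fin (M * r + 1) → ℝ) :
    lumpedNorm a b M r v ^ 2 = ∑ g, v g ^ 2 * nodeWeight a b M r g :=
  Real.sq_sqrt (Finset.sum_nonneg fun g _ =>
    mul_nonneg (sq_nonneg _) (nodeWeight_pos hab hM hr g).le)

lemma localVals_sq {M r : ℕ} (v : Fin (M * r + 1) → ℝ) (i j : ℕ) :
    localVals (fun g => v g ^ 2) i j = localVals v i j ^ 2 := by
  simp only [localVals]; split_ifs <;> simp

lemma localVals_mul {M r : ℕ} (v w : Fin (M * r + 1) → ℝ) (i j : ℕ) :
    localVals (fun g => v g * w g) i j = localVals v i j * localVals w i j := by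
  simp only [localVals]; split_ifs <;> simp

lemma sq_lumpedNorm_eq_sum_elements {a b : ℝ} (hab : a < b) {M r : ℕ} (hM : 1 ≤ M) (hr : 1 ≤ r)
    (v : Fin (M * r + 1) → ℝ) :
    lumpedNorm a b M r v ^ 2 =
      meshSize a b M * ∑ i ∈ Finset.range M, lobattoNorm r (localVals v i) ^ 2 := by
  rw [sq_lumpedNorm hab hM hr, sum_mul_nodeWeight a b (fun g => v g ^ 2)]
  simp only [sq_lobattoNorm hr, localVals_sq]

lemma massMatrix_mul_inv {a b : ℝ} (hab : a < b) {M r : ℕ} (hM : 1 ≤ M) (hr : 1 ≤ r) :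
    massMatrix a b M r * (massMatrix a b M r)⁻¹ = 1 := by
  refine Matrix.mul_nonsing_inv _ ?_
  rw [massMatrix, Matrix.det_diagonal, isUnit_iff_ne_zero]
  exact Finset.prod_ne_zero_iff.mpr fun g _ => (nodeWeight_pos hab hM hr g).ne'

lemma nodeWeight_mul_discreteLaplacian {a b : ℝ} (hab : a < b) {M r : ℕ} (hM : 1 ≤ M) (hr : 1 ≤ r)
    (v : Fin (M * r + 1) → ℝ) (g : Fin (M * r + 1)) :
    nodeWeight a b M r g * (((massMatrix a b M r)⁻¹ * stiffMatrix a b M r) *ᵥ v) g =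
      (stiffMatrix a b M r *ᵥ v) g := by
  rw [← Matrix.mulVec_diagonal, ← massMatrix, Matrix.mulVec_mulVec, ← mul_assoc,
    massMatrix_mul_inv hab hM hr, one_mul]

lemma hasDerivAt_exp_smul_mulVec {ι : Type*} [Fintype ι] [DecidableEq ι] (A : Matrix ι ι ℝ)
    (v : ι → ℝ) (t : ℝ) :
    HasDerivAt (fun s : ℝ => NormedSpace.exp (s • A) *ᵥ v)
      (A *ᵥ (NormedSpace.exp (t • A) *ᵥ v)) t := by
  let : NormedRing (Matrix ι ι ℝ) := Matrix.linftyOpNormedRing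
  let : NormedAlgebra ℝ (Matrix ι ι ℝ) := Matrix.linftyOpNormedAlgebra
  have h := hasDerivAt_exp_smul_const' (𝕂 := ℝ) A t
  let l : Matrix ι ι ℝ →ₗ[ℝ] (ι → ℝ) :=
    { toFun := fun N => N *ᵥ v
      map_add' := fun _ _ => Matrix.add_mulVec _ _ _
      map_smul' := fun _ _ => Matrix.smul_mulVec _ _ _ }
  have h2 := (LinearMap.toContinuousLinearMap l).hasFDerivAt.comp_hasDerivAt t h
  rw [Matrix.mulVec_mulVec]
  exact h2

lemma continuous_exp_smul {ι : Type*} [Fintype ι] [DecidableEq ι] (A : Matrix ι ι ℝ) :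
    Continuous (fun s : ℝ => NormedSpace.exp (s • A)) := by
  let : NormedRing (Matrix ι ι ℝ) := Matrix.linftyOpNormedRing
  let : NormedAlgebra ℝ (Matrix ι ι ℝ) := Matrix.linftyOpNormedAlgebra
  exact continuous_iff_continuousAt.mpr fun t =>
    (hasDerivAt_exp_smul_const' (𝕂 := ℝ) A t).continuousAt

/-- The semigroup of the semidiscrete heat equation is a contraction in the lumped norm, because
the stiffness matrix is negative semidefinite. -/
lemma lumpedNorm_exp_le {a b : ℝ} (hab : a < b) {M r : ℕ} (hM : 1 ≤ M) (hr : 1 ≤ r)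
    (v : Fin (M * r + 1) → ℝ) {t : ℝ} (ht : 0 ≤ t) :
    lumpedNorm a b M r
      (NormedSpace.exp (t • ((massMatrix a b M r)⁻¹ * stiffMatrix a b M r)) *ᵥ v) ≤
      lumpedNorm a b M r v := by
  set A := (massMatrix a b M r)⁻¹ * stiffMatrix a b M r with hA
  set y : ℝ → Fin (M * r + 1) → ℝ := fun s => NormedSpace.exp (s • A) *ᵥ v with hy
  have hd : ∀ s, HasDerivAt (fun s => ∑ g, y s g ^ 2 * nodeWeight a b M r g)
      (2 * (y s ⬝ᵥ (stiffMatrix a b M r *ᵥ y s))) s := by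
    intro s
    have h := hasDerivAt_pi.mp (hasDerivAt_exp_smul_mulVec A v s)
    have h2 := HasDerivAt.fun_sum (u := Finset.univ)
      (fun g _ => ((h g).fun_pow 2).mul_const (nodeWeight a b M r g))
    refine h2.congr_deriv ?_
    rw [dotProduct, Finset.mul_sum]
    refine Finset.sum_congr rfl fun g _ => ?_
    rw [← nodeWeight_mul_discreteLaplacian hab hM hr (y s) g, ← hA]
    simp only [hy]
    push_cast
    ring
  have hanti : Antitone (fun s => ∑ g, y s g ^ 2 * nodeWeight a b M r g) := by
    refine antitone_of_deriv_nonpos (fun s => (hd s).differentiableAt) fun s => ?_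
    rw [(hd s).deriv, dotProduct_stiffMatrix_mulVec hab hM]
    have : 0 ≤ ∑ i ∈ Finset.range M, (meshSize a b M)⁻¹ *
        polyInt (derivative (localPoly (y s) i) * derivative (localPoly (y s) i)) :=
      Finset.sum_nonneg fun i _ => mul_nonneg (inv_nonneg.mpr (meshSize_pos hab hM).le)
        (polyInt_nonneg fun x _ => by rw [eval_mul]; exact mul_self_nonneg _)
    linarith
  have h := hanti ht
  simp only [hy, zero_smul, NormedSpace.exp_zero, Matrix.one_mulVec] at h
  exact Real.sqrt_le_sqrt h

end Assembly

/-! ### Interpolation error and consistency of the semidiscretization -/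

section Consistency

open Polynomial

/-- The pullback of a function to the reference element. -/
noncomputable def pullback (a b : ℝ) (M i : ℕ) (v : ℝ → ℝ) (ξ : ℝ) : ℝ :=
  v (a + (i + ξ) * meshSize a b M)

lemma contDiff_pullback {a b : ℝ} {M i : ℕ} {n : WithTop ℕ∞} {v : ℝ → ℝ} (hv : ContDiff ℝ n v) :
    ContDiff ℝ n (pullback a b M i v) := by
  unfold pullback
  exact hv.comp (by fun_prop)

lemma hasDerivAt_pullback {a b : ℝ} {M i : ℕ} {v : ℝ → ℝ} (hv : Differentiable ℝ v) (ξ : ℝ) :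
    HasDerivAt (pullback a b M i v) (meshSize a b M * pullback a b M i (deriv v) ξ) ξ := by
  have h1 : HasDerivAt (fun ξ : ℝ => a + (i + ξ) * meshSize a b M) (meshSize a b M) ξ := by
    simpa using (((hasDerivAt_id ξ).const_add (i : ℝ)).mul_const (meshSize a b M)).const_add a
  have h2 := (hv (a + (i + ξ) * meshSize a b M)).hasDerivAt.comp ξ h1
  rw [mul_comm]
  exact h2

lemma iteratedDeriv_pullback {a b : ℝ} {M i n : ℕ} {v : ℝ → ℝ} (hv : ContDiff ℝ n v) (ξ : ℝ) :
    iteratedDeriv n (pullback a b M i v) ξ =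
      meshSize a b M ^ n * pullback a b M i (iteratedDeriv n v) ξ := by
  induction n generalizing v ξ with
  | zero => simp [pullback]
  | succ n ih =>
    have hd : ContDiff ℝ n (deriv v) := by
      have h2 : ContDiff ℝ ((n : ℕ) + 1) v := by exact_mod_cast hv
      exact (contDiff_succ_iff_deriv.mp h2).2.2
    have hdv : Differentiable ℝ v := hv.differentiable (by simp)
    have h1 : deriv (pullback a b M i v) =
        fun ξ => meshSize a b M * pullback a b M i (deriv v) ξ :=
      funext fun ξ => (hasDerivAt_pullback hdv ξ).deriv
    rw [iteratedDeriv_succ', h1, iteratedDeriv_const_mul _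
      (contDiff_pullback hd).contDiffAt, ih hd, iteratedDeriv_succ', pow_succ]
    ring

lemma abs_iteratedDeriv_pullback_le {a b : ℝ} (hab : a < b) {M i n : ℕ} (hi : i < M) {v : ℝ → ℝ}
    (hv : ContDiff ℝ n v) {K : ℝ} (hK : ∀ x ∈ Icc a b, |iteratedDeriv n v x| ≤ K)
    {ξ : ℝ} (hξ : ξ ∈ Icc (0 : ℝ) 1) :
    |iteratedDeriv n (pullback a b M i v) ξ| ≤ meshSize a b M ^ n * K := by
  have hh := meshSize_pos hab (show 1 ≤ M by omega)
  rw [iteratedDeriv_pullback hv, abs_mul, abs_of_pos (pow_pos hh n)]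
  exact mul_le_mul_of_nonneg_left (hK _ (element_mem_Icc hab hi hξ)) (pow_pos hh n).le

lemma feFunction_eq_localPoly {a b : ℝ} (hab : a < b) {M r i : ℕ} (hr : 1 ≤ r) (hi : i < M)
    {v : ℝ → ℝ} (hv : IsFEFunction a b M r v) {ξ : ℝ} (hξ : ξ ∈ Icc (0 : ℝ) 1) :
    pullback a b M i v ξ = (localPoly (nodalVec a b M r v) i).eval ξ := by
  have hh := meshSize_pos hab (show 1 ≤ M by omega)
  obtain ⟨p, hp, hpv⟩ := hv i hi
  have hval : ∀ ξ ∈ Icc (0 : ℝ) 1, pullback a b M i v ξ =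
      (p.comp (C (a + i * meshSize a b M) + C (meshSize a b M) * X)).eval ξ := by
    intro ξ hξ
    rw [pullback, hpv, eval_comp]
    · congr 1
      simp; ring
    · constructor <;> nlinarith [hξ.1, hξ.2]
  have hdeg : (p.comp (C (a + i * meshSize a b M) + C (meshSize a b M) * X)).natDegree ≤ r := by
    refine natDegree_comp_le.trans ?_
    have : (C (a + i * meshSize a b M) + C (meshSize a b M) * X : ℝ[X]).natDegree ≤ 1 :=
      natDegree_add_le_of_degree_le ((natDegree_C _).le.trans zero_le_one)
        ((natDegree_C_mul_le _ _).trans natDegree_X_le)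
    nlinarith
  rw [hval ξ hξ, localPoly_nodalVec hr hi, lobattoInterp_eq_of_eval hr hdeg]
  exact fun j hj => (hval _ (lobattoNode_mem hr hj)).symm

/-- The residual of the nodal values of a smooth function with vanishing Neumann data in the
semidiscrete equation is of order `hʳ` in the lumped norm. Tested with a finite element function,
the residual is the sum of the local consistency errors, since the weak form of the second
derivative has no boundary terms. -/
lemma exists_lumpedNorm_residual_le {a b : ℝ} (hab : a < b) {r : ℕ} (hr : 1 ≤ r) :
    ∃ C : ℝ, 0 < C ∧ ∀ M : ℕ, 1 ≤ M → ∀ (v : ℝ → ℝ) (K : ℝ), ContDiff ℝ (r + 2 : ℕ) v →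
      (∀ x ∈ Icc a b, |iteratedDeriv (r + 2) v x| ≤ K) → deriv v a = 0 → deriv v b = 0 →
      lumpedNorm a b M r (nodalVec a b M r (deriv (deriv v)) -
        ((massMatrix a b M r)⁻¹ * stiffMatrix a b M r) *ᵥ nodalVec a b M r v) ≤
        C * K * meshSize a b M ^ r := by
  obtain ⟨C, hC, H⟩ := exists_lobatto_consistency_le hr
  have hba : 0 < b - a := sub_pos.mpr hab
  refine ⟨C * √(b - a), by positivity, fun M hM v K hv hK ha hb => ?_⟩
  have hK0 : 0 ≤ K := (abs_nonneg _).trans (hK a (left_mem_Icc.mpr hab.le))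
  have hh := meshSize_pos hab hM
  have hMh := natCast_mul_meshSize a b hM
  set h := meshSize a b M with hdef
  set y := nodalVec a b M r (deriv (deriv v)) -
    ((massMatrix a b M r)⁻¹ * stiffMatrix a b M r) *ᵥ nodalVec a b M r v with hy
  have hv1 : Differentiable ℝ v := hv.differentiable (by simp)
  have hcd1 : ContDiff ℝ (r + 1 : ℕ) (deriv v) := by
    have h2 : ContDiff ℝ ((r + 1 : ℕ) + 1) v := by exact_mod_cast hv
    exact (contDiff_succ_iff_deriv.mp h2).2.2
  have hv2 : Differentiable ℝ (deriv v) := hcd1.differentiable (by simp)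
  have hc2 : Continuous (deriv (deriv v)) := hcd1.continuous_deriv (by simp)
  have hd1 : ∀ i, deriv (pullback a b M i v) = fun ξ => h * pullback a b M i (deriv v) ξ :=
    fun i => funext fun ξ => (hasDerivAt_pullback hv1 ξ).deriv
  have hd2 : ∀ i ξ, HasDerivAt (deriv (pullback a b M i v))
      (h * (h * pullback a b M i (deriv (deriv v)) ξ)) ξ := by
    intro i ξ
    rw [hd1]
    exact (hasDerivAt_pullback hv2 ξ).const_mul h
  have hd2' : ∀ i ξ, deriv (deriv (pullback a b M i v)) ξ =
      h * (h * pullback a b M i (deriv (deriv v)) ξ) := fun i ξ => (hd2 i ξ).deriv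
  have hpc : ∀ i, Continuous (pullback a b M i (deriv (deriv v))) := fun i => by
    unfold pullback; exact hc2.comp (by fun_prop)
  -- the pairing with the second derivative
  have e1 : ∑ g, y g * nodalVec a b M r (deriv (deriv v)) g * nodeWeight a b M r g =
      ∑ i ∈ Finset.range M, h⁻¹ * ∑ j ∈ Finset.range (r + 1), lobattoWeight r j *
        (deriv (deriv (pullback a b M i v)) (lobattoNode r j) * localVals y i j) := by
    rw [sum_mul_nodeWeight a b (fun g => y g * nodalVec a b M r (deriv (deriv v)) g),
      Finset.mul_sum, ← hdef]
    refine Finset.sum_congr rfl fun i hi => ?_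
    rw [Finset.mul_sum, Finset.mul_sum]
    refine Finset.sum_congr rfl fun j hj => ?_
    rw [localVals_mul, localVals_nodalVec hr (by simpa using hi) (by simpa using hj), hd2',
      pullback, ← hdef]
    field_simp
  -- the pairing with the discrete Laplacian
  have e2 : ∑ g, y g * (((massMatrix a b M r)⁻¹ * stiffMatrix a b M r) *ᵥ
        nodalVec a b M r v) g * nodeWeight a b M r g =
      -∑ i ∈ Finset.range M, h⁻¹ * ∫ x in (0 : ℝ)..1,
        (derivative (lobattoInterp r (fun j => pullback a b M i v (lobattoNode r j)))).eval x *
          (derivative (localPoly y i)).eval x := by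
    have hdot := dotProduct_stiffMatrix_mulVec hab hM y (nodalVec a b M r v)
    rw [dotProduct] at hdot
    calc _ = ∑ g, y g * (stiffMatrix a b M r *ᵥ nodalVec a b M r v) g := by
          refine Finset.sum_congr rfl fun g _ => ?_
          rw [← nodeWeight_mul_discreteLaplacian hab hM hr]
          ring
      _ = _ := by
          rw [hdot]
          congr 1
          refine Finset.sum_congr rfl fun i hi => ?_
          rw [polyInt_apply, localPoly_nodalVec hr (by simpa using hi), ← hdef]
          congr 1
          refine intervalIntegral.integral_congr fun x _ => ?_
          simp only [eval_mul, pullback, ← hdef]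
          ring
  -- integration by parts on each element
  have e3 : ∀ i, (∫ x in (0 : ℝ)..1, deriv (deriv (pullback a b M i v)) x *
        (localPoly y i).eval x) +
      (∫ x in (0 : ℝ)..1, deriv (pullback a b M i v) x * (derivative (localPoly y i)).eval x) =
      h * (deriv v (a + (i + 1 : ℕ) * h) * localVals y (i + 1) 0 -
        deriv v (a + i * h) * localVals y i 0) := by
    intro i
    have hibp := intervalIntegral.integral_mul_deriv_eq_deriv_mul (a := 0) (b := 1)
      (u := deriv (pullback a b M i v)) (v := fun x => (localPoly y i).eval x)
      (u' := deriv (deriv (pullback a b M i v)))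
      (v' := fun x => (derivative (localPoly y i)).eval x)
      (fun x _ => by rw [hd2']; exact hd2 i x) (fun x _ => (localPoly y i).hasDerivAt x)
      (by simp only [funext (hd2' i)]
          exact (continuous_const.mul (continuous_const.mul (hpc i))).intervalIntegrable _ _)
      ((Polynomial.continuous _).intervalIntegrable _ _)
    have p0 : (localPoly y i).eval 0 = localVals y i 0 := by
      have := eval_lobattoInterp_node hr (show 0 < r + 1 by omega) (localVals y i)
      rwa [lobattoNode_zero hr] at this
    have p1 : (localPoly y i).eval 1 = localVals y (i + 1) 0 := by
      have := eval_lobattoInterp_node hr (show r < r + 1 by omega) (localVals y i)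
      rwa [lobattoNode_last hr, localVals_add_one] at this
    rw [hibp, p0, p1, hd1]
    simp only [pullback, ← hdef]
    push_cast
    simp only [add_zero]
    ring
  have htel : ∑ i ∈ Finset.range M, h * (deriv v (a + (i + 1 : ℕ) * h) * localVals y (i + 1) 0 -
        deriv v (a + i * h) * localVals y i 0) = 0 := by
    rw [← Finset.mul_sum,
      Finset.sum_range_sub (fun i : ℕ => deriv v (a + i * h) * localVals y i 0)]
    rw [hMh, add_sub_cancel, hb]
    simp [ha]
  have hsq : lumpedNorm a b M r y ^ 2 = ∑ i ∈ Finset.range M, h⁻¹ *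
      ((∑ j ∈ Finset.range (r + 1), lobattoWeight r j *
          (deriv (deriv (pullback a b M i v)) (lobattoNode r j) * localVals y i j)) -
        (∫ x in (0 : ℝ)..1, deriv (deriv (pullback a b M i v)) x *
          (lobattoInterp r (localVals y i)).eval x) +
        ((∫ x in (0 : ℝ)..1, (derivative (lobattoInterp r
            (fun j => pullback a b M i v (lobattoNode r j)))).eval x *
            (derivative (lobattoInterp r (localVals y i))).eval x) -
          ∫ x in (0 : ℝ)..1, deriv (pullback a b M i v) x *
            (derivative (lobattoInterp r (localVals y i))).eval x)) := by
    have h0 : lumpedNorm a b M r y ^ 2 =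
        (∑ g, y g * nodalVec a b M r (deriv (deriv v)) g * nodeWeight a b M r g) -
        ∑ g, y g * (((massMatrix a b M r)⁻¹ * stiffMatrix a b M r) *ᵥ
          nodalVec a b M r v) g * nodeWeight a b M r g := by
      rw [sq_lumpedNorm hab hM hr, ← Finset.sum_sub_distrib]
      refine Finset.sum_congr rfl fun g _ => ?_
      have : y g = nodalVec a b M r (deriv (deriv v)) g -
        (((massMatrix a b M r)⁻¹ * stiffMatrix a b M r) *ᵥ nodalVec a b M r v) g := rfl
      linear_combination (y g * nodeWeight a b M r g) * this
    have h1 := congrArg (fun z => h⁻¹ * z) htel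
    simp only [mul_zero, ← e3, Finset.mul_sum (s := Finset.range M)] at h1
    rw [h0, e1, e2, sub_neg_eq_add, ← Finset.sum_add_distrib]
    refine (sub_zero _).symm.trans ((congrArg (fun z => _ - z) h1.symm).trans ?_)
    rw [← Finset.sum_sub_distrib]
    refine Finset.sum_congr rfl fun i _ => ?_
    simp only [localPoly]
    ring
  have hbound : lumpedNorm a b M r y ^ 2 ≤
      C * K * h ^ r * (h * ∑ i ∈ Finset.range M, lobattoNorm r (localVals y i)) := by
    rw [hsq]
    calc _ ≤ ∑ i ∈ Finset.range M,
          h⁻¹ * (C * (h ^ (r + 2) * K) * lobattoNorm r (localVals y i)) := by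
          refine Finset.sum_le_sum fun i hi => mul_le_mul_of_nonneg_left ?_ (inv_pos.mpr hh).le
          refine (le_abs_self _).trans (H (pullback a b M i v) (h ^ (r + 2) * K) (localVals y i)
            (contDiff_pullback hv) fun x hx => ?_)
          exact abs_iteratedDeriv_pullback_le hab (by simpa using hi) hv hK hx
      _ = _ := by
          rw [← Finset.mul_sum, ← Finset.mul_sum, pow_succ, pow_succ]
          field_simp
  have hcs : h * ∑ i ∈ Finset.range M, lobattoNorm r (localVals y i) ≤
      √(b - a) * lumpedNorm a b M r y := by
    refine abs_le_of_sq_le_sq' ?_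
      (mul_nonneg (Real.sqrt_nonneg _) (lumpedNorm_nonneg _ _ _ _ _)) |>.2
    rw [mul_pow, mul_pow, Real.sq_sqrt hba.le, sq_lumpedNorm_eq_sum_elements hab hM hr, ← hdef,
      ← hMh]
    have := sq_sum_le_card_mul_sum_sq (s := Finset.range M)
      (f := fun i => lobattoNorm r (localVals y i))
    rw [Finset.card_range] at this
    calc _ ≤ h ^ 2 * ((M : ℝ) * ∑ i ∈ Finset.range M, lobattoNorm r (localVals y i) ^ 2) :=
          mul_le_mul_of_nonneg_left this (sq_nonneg h)
      _ = _ := by ring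
  have hn := lumpedNorm_nonneg a b M r y
  have hfin : lumpedNorm a b M r y * lumpedNorm a b M r y ≤
      (C * √(b - a) * K * h ^ r) * lumpedNorm a b M r y := by
    rw [← sq]
    refine hbound.trans ((mul_le_mul_of_nonneg_left hcs (by positivity)).trans (le_of_eq ?_))
    ring
  rcases hn.eq_or_lt with h0 | h0
  · rw [← h0]; positivity
  · exact le_of_mul_le_mul_right hfin h0

lemma l2norm_nonneg (a b : ℝ) (v : ℝ → ℝ) : 0 ≤ l2norm a b v := Real.sqrt_nonneg _

lemma sq_l2norm {a b : ℝ} (hab : a < b) (v : ℝ → ℝ) :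
    l2norm a b v ^ 2 = ∫ x in a..b, v x ^ 2 :=
  Real.sq_sqrt (intervalIntegral.integral_nonneg hab.le fun _ _ => sq_nonneg _)

/-- For the difference of a smooth function and a finite element function, the `L²` norm and the
lumped norm of the nodal values are equivalent up to the interpolation error. -/
lemma exists_l2norm_equiv_lumpedNorm {a b : ℝ} (hab : a < b) {r : ℕ} (hr : 1 ≤ r) :
    ∃ C : ℝ, 0 < C ∧ ∀ M : ℕ, 1 ≤ M → ∀ (v w : ℝ → ℝ) (K : ℝ), ContDiff ℝ r v →
      (∀ x ∈ Icc a b, |iteratedDeriv r v x| ≤ K) → IsFEFunction a b M r w →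
      l2norm a b (fun x => v x - w x) ≤
        C * (lumpedNorm a b M r (nodalVec a b M r (fun x => v x - w x)) +
          K * meshSize a b M ^ r) ∧
      lumpedNorm a b M r (nodalVec a b M r (fun x => v x - w x)) ≤
        C * (l2norm a b (fun x => v x - w x) + K * meshSize a b M ^ r) := by
  obtain ⟨C₁, hC₁, H₁⟩ := exists_polyInt_sq_lobattoInterp_le hr
  obtain ⟨C₂, hC₂, H₂⟩ := exists_sq_lobattoNorm_le_polyInt hr
  obtain ⟨C₃, hC₃, H₃⟩ := exists_abs_sub_lobattoInterp_le hr
  have hba : 0 < b - a := sub_pos.mpr hab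
  set Q : ℝ := 2 * (C₁ + C₂ + 1) * (1 + (b - a) * C₃ ^ 2) with hQ
  have hQ1 : 2 * C₁ ≤ Q := by
    have : 0 ≤ (C₁ + C₂ + 1) * ((b - a) * C₃ ^ 2) := by positivity
    nlinarith
  have hQ2 : 2 * C₂ ≤ Q := by
    have : 0 ≤ (C₁ + C₂ + 1) * ((b - a) * C₃ ^ 2) := by positivity
    nlinarith
  have hQ3 : 2 * ((b - a) * C₃ ^ 2) ≤ Q := by
    have : 0 ≤ (C₁ + C₂) * ((b - a) * C₃ ^ 2) := by positivity
    nlinarith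
  have hQ4 : 2 * C₂ * ((b - a) * C₃ ^ 2) ≤ Q := by
    have : 0 ≤ (C₁ + 1) * ((b - a) * C₃ ^ 2) := by positivity
    nlinarith
  have hQ0 : 0 < Q := by positivity
  refine ⟨√Q, Real.sqrt_pos.mpr hQ0, fun M hM v w K hv hK hw => ?_⟩
  have hK0 : 0 ≤ K := (abs_nonneg _).trans (hK a (left_mem_Icc.mpr hab.le))
  have hh := meshSize_pos hab hM
  have hMh := natCast_mul_meshSize a b hM
  set h := meshSize a b M with hdef
  set d := nodalVec a b M r (fun x => v x - w x) with hd
  set e : ℕ → ℝ → ℝ := fun i ξ => pullback a b M i v ξ -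
    (lobattoInterp r (fun j => pullback a b M i v (lobattoNode r j))).eval ξ with he
  have he_le : ∀ i < M, ∀ ξ ∈ Icc (0 : ℝ) 1, |e i ξ| ≤ C₃ * (h ^ r * K) := fun i hi ξ hξ =>
    H₃ (pullback a b M i v) (h ^ r * K) (contDiff_pullback hv)
      (fun x hx => abs_iteratedDeriv_pullback_le hab hi hv hK hx) ξ hξ
  have hpull : ∀ i < M, ∀ ξ ∈ Icc (0 : ℝ) 1,
      pullback a b M i (fun x => v x - w x) ξ = e i ξ + (localPoly d i).eval ξ := by
    intro i hi ξ hξ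
    have h1 := feFunction_eq_localPoly hab hr hi hw hξ
    have h2 : localPoly d i = lobattoInterp r (fun j => pullback a b M i v (lobattoNode r j)) -
        localPoly (nodalVec a b M r w) i := by
      rw [hd, localPoly_nodalVec hr hi, localPoly_nodalVec hr hi]
      simp only [lobattoInterp, ← Finset.sum_sub_distrib, pullback]
      refine Finset.sum_congr rfl fun j _ => ?_
      rw [C_sub]; ring
    rw [h2, eval_sub, ← h1]
    simp only [he, pullback]; ring
  have hec : ∀ i, Continuous (e i) := fun i =>
    (contDiff_pullback hv).continuous.sub (Polynomial.continuous _)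
  have hsqint : ∀ i < M, ∫ ξ in (0 : ℝ)..1, pullback a b M i (fun x => v x - w x) ξ ^ 2 =
      ∫ ξ in (0 : ℝ)..1, (e i ξ + (localPoly d i).eval ξ) ^ 2 := by
    intro i hi
    refine intervalIntegral.integral_congr fun ξ hξ => ?_
    rw [uIcc_of_le zero_le_one] at hξ
    simp only [hpull i hi ξ hξ]
  have hl2 : l2norm a b (fun x => v x - w x) ^ 2 = h * ∑ i ∈ Finset.range M,
      ∫ ξ in (0 : ℝ)..1, (e i ξ + (localPoly d i).eval ξ) ^ 2 := by
    rw [sq_l2norm hab, integral_eq_sum_elements hab hM, Finset.mul_sum]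
    · refine Finset.sum_congr rfl fun i hi => ?_
      rw [← hsqint i (by simpa using hi)]
      rfl
    · intro i hi
      refine ContinuousOn.intervalIntegrable ?_
      obtain ⟨p, -, hp⟩ := hw i hi
      rw [uIcc_of_le (by nlinarith)]
      refine ContinuousOn.congr (f := fun x => (v x - p.eval x) ^ 2)
        ((hv.continuous.sub p.continuous).pow 2).continuousOn fun x hx => ?_
      simp only [hp x hx]
  have hδ : ∀ i < M, ∫ ξ in (0 : ℝ)..1, e i ξ ^ 2 ≤ (C₃ * (h ^ r * K)) ^ 2 := by
    intro i hi
    have hb := intervalIntegral.norm_integral_le_of_norm_le_const (a := 0) (b := 1)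
      (f := fun ξ => e i ξ ^ 2) (C := (C₃ * (h ^ r * K)) ^ 2) ?_
    · exact (le_abs_self _).trans (hb.trans (by simp))
    · intro x hx
      rw [uIoc_of_le zero_le_one] at hx
      rw [Real.norm_eq_abs, abs_pow]
      exact pow_le_pow_left₀ (abs_nonneg _) (he_le i hi x (Ioc_subset_Icc_self hx)) 2
  have hlump : lumpedNorm a b M r d ^ 2 = h * ∑ i ∈ Finset.range M,
      lobattoNorm r (localVals d i) ^ 2 := sq_lumpedNorm_eq_sum_elements hab hM hr d
  have hsum : h * ∑ _i ∈ Finset.range M, (C₃ * (h ^ r * K)) ^ 2 =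
      (b - a) * C₃ ^ 2 * (K * h ^ r) ^ 2 := by
    rw [Finset.sum_const, Finset.card_range, nsmul_eq_mul, ← hMh]; ring
  have hn := lumpedNorm_nonneg a b M r d
  have hl := l2norm_nonneg a b (fun x => v x - w x)
  have hhr : 0 ≤ K * h ^ r := by positivity
  constructor
  · refine abs_le_of_sq_le_sq' ?_ (by positivity) |>.2
    rw [mul_pow, Real.sq_sqrt hQ0.le]
    have hloc : ∀ i ∈ Finset.range M,
        ∫ ξ in (0 : ℝ)..1, (e i ξ + (localPoly d i).eval ξ) ^ 2 ≤
          2 * (C₃ * (h ^ r * K)) ^ 2 + 2 * (C₁ * lobattoNorm r (localVals d i) ^ 2) := by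
      intro i hi
      have hi' : i < M := by simpa using hi
      have c1 : Continuous (fun ξ => 2 * e i ξ ^ 2) := ((hec i).fun_pow 2).const_mul 2
      have c2 : Continuous (fun ξ => 2 * (localPoly d i ^ 2).eval ξ) :=
        (Polynomial.continuous _).const_mul 2
      have c3 : Continuous (fun ξ => (e i ξ + (localPoly d i).eval ξ) ^ 2) :=
        ((hec i).fun_add (Polynomial.continuous _)).fun_pow 2
      have hp := H₁ (localVals d i)
      have hle : ∫ ξ in (0 : ℝ)..1, (e i ξ + (localPoly d i).eval ξ) ^ 2 ≤
          ∫ ξ in (0 : ℝ)..1, (2 * e i ξ ^ 2 + 2 * (localPoly d i ^ 2).eval ξ) := by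
        refine intervalIntegral.integral_mono_on zero_le_one (c3.intervalIntegrable _ _)
          ((c1.add c2).intervalIntegrable _ _) fun ξ _ => ?_
        rw [eval_pow]
        nlinarith [sq_nonneg (e i ξ - (localPoly d i).eval ξ)]
      rw [intervalIntegral.integral_add
        (c1.intervalIntegrable _ _) (c2.intervalIntegrable _ _),
        intervalIntegral.integral_const_mul, intervalIntegral.integral_const_mul,
        ← polyInt_apply] at hle
      have := hδ i hi'
      simp only [localPoly] at hle hp ⊢
      linarith
    have htot := mul_le_mul_of_nonneg_left (Finset.sum_le_sum hloc) hh.le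
    rw [← hl2, Finset.sum_add_distrib, ← Finset.mul_sum, ← Finset.mul_sum, ← Finset.mul_sum] at htot
    have : l2norm a b (fun x => v x - w x) ^ 2 ≤
        2 * ((b - a) * C₃ ^ 2) * (K * h ^ r) ^ 2 + 2 * C₁ * lumpedNorm a b M r d ^ 2 := by
      rw [hlump]; linarith
    calc _ ≤ _ := this
      _ ≤ Q * (K * h ^ r) ^ 2 + Q * lumpedNorm a b M r d ^ 2 :=
          add_le_add (mul_le_mul_of_nonneg_right hQ3 (sq_nonneg _))
            (mul_le_mul_of_nonneg_right hQ1 (sq_nonneg _))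
      _ ≤ _ := by
          have := mul_nonneg hn hhr
          nlinarith
  · refine abs_le_of_sq_le_sq' ?_ (by positivity) |>.2
    rw [mul_pow, Real.sq_sqrt hQ0.le]
    have hloc : ∀ i ∈ Finset.range M, lobattoNorm r (localVals d i) ^ 2 ≤
        2 * C₂ * (C₃ * (h ^ r * K)) ^ 2 +
        2 * C₂ * ∫ ξ in (0 : ℝ)..1, (e i ξ + (localPoly d i).eval ξ) ^ 2 := by
      intro i hi
      have hi' : i < M := by simpa using hi
      have c1 : Continuous (fun ξ => 2 * e i ξ ^ 2) := ((hec i).fun_pow 2).const_mul 2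
      have c3 : Continuous (fun ξ => (e i ξ + (localPoly d i).eval ξ) ^ 2) :=
        ((hec i).fun_add (Polynomial.continuous _)).fun_pow 2
      have hp := H₂ (localVals d i)
      have hle : ∫ ξ in (0 : ℝ)..1, (localPoly d i ^ 2).eval ξ ≤
          ∫ ξ in (0 : ℝ)..1, (2 * e i ξ ^ 2 + 2 * (e i ξ + (localPoly d i).eval ξ) ^ 2) := by
        refine intervalIntegral.integral_mono_on zero_le_one
          ((Polynomial.continuous _).intervalIntegrable _ _)
          ((c1.add (c3.const_mul 2)).intervalIntegrable _ _) fun ξ _ => ?_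
        rw [eval_pow]
        nlinarith [sq_nonneg (2 * e i ξ + (localPoly d i).eval ξ)]
      rw [intervalIntegral.integral_add
        (c1.intervalIntegrable _ _) ((c3.const_mul 2).intervalIntegrable _ _),
        intervalIntegral.integral_const_mul, intervalIntegral.integral_const_mul,
        ← polyInt_apply] at hle
      have h3 := hδ i hi'
      simp only [localPoly] at hle hp ⊢
      have h4 := mul_le_mul_of_nonneg_left hle hC₂.le
      have h5 := mul_le_mul_of_nonneg_left h3 hC₂.le
      linarith
    have htot := mul_le_mul_of_nonneg_left (Finset.sum_le_sum hloc) hh.le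
    rw [← hlump, Finset.sum_add_distrib, ← Finset.mul_sum, ← Finset.mul_sum, mul_add,
      mul_left_comm, mul_left_comm h _ (∑ i ∈ _, _), ← hl2, hsum] at htot
    calc _ ≤ _ := htot
      _ = 2 * C₂ * ((b - a) * C₃ ^ 2) * (K * h ^ r) ^ 2 +
          2 * C₂ * l2norm a b (fun x => v x - w x) ^ 2 := by ring
      _ ≤ Q * (K * h ^ r) ^ 2 + Q * l2norm a b (fun x => v x - w x) ^ 2 :=
          add_le_add (mul_le_mul_of_nonneg_right hQ4 (sq_nonneg _))
            (mul_le_mul_of_nonneg_right hQ2 (sq_nonneg _))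
      _ ≤ _ := by
          have := mul_nonneg hl hhr
          nlinarith

end Consistency

/-! ### Weak derivatives on an interval -/

lemma exists_Icc_of_isCompact_subset_Ioo {a b : ℝ} (hab : a < b) {K : Set ℝ} (hK : IsCompact K)
    (hKab : K ⊆ Ioo a b) : ∃ p q, a < p ∧ q < b ∧ K ⊆ Icc p q := by
  rcases K.eq_empty_or_nonempty with rfl | hne
  · exact ⟨(a + b) / 2, (a + b) / 2, by linarith, by linarith, empty_subset _⟩
  · exact ⟨sInf K, sSup K, (hKab (hK.sInf_mem hne)).1, (hKab (hK.sSup_mem hne)).2,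
      fun x hx => ⟨csInf_le hK.bddBelow hx, le_csSup hK.bddAbove hx⟩⟩

lemma setIntegral_Ioo_eq {a b : ℝ} (hab : a < b) (F : ℝ → ℝ) :
    ∫ x in Ioo a b, F x = ∫ x in a..b, F x := by
  rw [intervalIntegral.integral_of_le hab.le, integral_Ioc_eq_integral_Ioo]

lemma intervalIntegrable_of_integrableOn_Ioo {a b : ℝ} (hab : a < b) {F : ℝ → ℝ}
    (hF : IntegrableOn F (Ioo a b)) : IntervalIntegrable F volume a b := by
  rwa [intervalIntegrable_iff_integrableOn_Ioo_of_le hab.le]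

/-- A test function with vanishing integral is the derivative of a test function. -/
lemma exists_test_primitive {a b : ℝ} (hab : a < b) {ψ : ℝ → ℝ} (hψ : ContDiff ℝ ∞ ψ)
    (hc : HasCompactSupport ψ) (hs : tsupport ψ ⊆ Ioo a b) (h0 : ∫ x in Ioo a b, ψ x = 0) :
    ∃ φ : ℝ → ℝ, ContDiff ℝ ∞ φ ∧ HasCompactSupport φ ∧ tsupport φ ⊆ Ioo a b ∧ deriv φ = ψ := by
  obtain ⟨p, q, hp, hq, hpq⟩ := exists_Icc_of_isCompact_subset_Ioo hab hc hs
  have hz : ∀ t, t ∉ Icc p q → ψ t = 0 := fun t ht =>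
    image_eq_zero_of_notMem_tsupport fun h => ht (hpq h)
  set φ : ℝ → ℝ := fun x => ∫ t in a..x, ψ t with hφ
  have hint : ∀ c d, IntervalIntegrable ψ volume c d := fun c d =>
    hψ.continuous.intervalIntegrable c d
  have hd : ∀ x, HasDerivAt φ (ψ x) x := fun x =>
    intervalIntegral.integral_hasDerivAt_right (hint a x)
      (hψ.continuous.stronglyMeasurableAtFilter _ _) hψ.continuous.continuousAt
  have hderiv : deriv φ = ψ := funext fun x => (hd x).deriv
  have hzero : ∀ x, x ∉ Icc p q → φ x = 0 := by
    intro x hx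
    by_cases hxp : x < p
    · rw [hφ]
      refine intervalIntegral.integral_zero_ae (Filter.Eventually.of_forall fun t ht => hz t ?_)
      intro htc
      have h1 : t ≤ max a x := ht.2
      have h2 : max a x < p := max_lt hp hxp
      linarith [htc.1]
    · have hxq : q < x := by
        by_contra! h
        exact hx ⟨not_lt.mp hxp, h⟩
      have h1 : φ x = (∫ t in a..b, ψ t) + ∫ t in b..x, ψ t :=
        (intervalIntegral.integral_add_adjacent_intervals (hint a b) (hint b x)).symm
      rw [h1, ← setIntegral_Ioo_eq hab, h0, zero_add]
      refine intervalIntegral.integral_zero_ae (Filter.Eventually.of_forall fun t ht => hz t ?_)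
      intro htc
      have h1 : min b x < t := ht.1
      have h2 : q < min b x := lt_min hq hxq
      linarith [htc.2]
  refine ⟨φ, ?_, HasCompactSupport.intro isCompact_Icc hzero, ?_, hderiv⟩
  · rw [contDiff_infty_iff_deriv, hderiv]
    exact ⟨fun x => (hd x).differentiableAt, hψ⟩
  · have : tsupport φ ⊆ Icc p q := closure_minimal
      (fun x hx => by by_contra h; exact hx (hzero x h)) isClosed_Icc
    exact this.trans fun x hx => ⟨hp.trans_le hx.1, hx.2.trans_lt hq⟩

/-- A function with an integrable weak derivative is, up to a constant, the integral of its
derivative (the du Bois-Reymond lemma). -/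
lemma IsWeakDeriv.ae_eq_const_add_integral {a b : ℝ} (hab : a < b) {v w : ℝ → ℝ}
    (h : IsWeakDeriv a b v w) (hv : IntegrableOn v (Ioo a b)) (hw : IntegrableOn w (Ioo a b)) :
    ∃ c : ℝ, v =ᵐ[volume.restrict (Ioo a b)] fun x => c + ∫ t in a..x, w t := by
  have hwI := intervalIntegrable_of_integrableOn_Ioo hab hw
  set W : ℝ → ℝ := fun x => ∫ t in a..x, w t with hWdef
  have hWac : AbsolutelyContinuousOnInterval W a b :=
    hwI.absolutelyContinuousOnInterval_intervalIntegral left_mem_uIcc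
  have hWc : ContinuousOn W (Icc a b) := by
    have := hWac.continuousOn
    rwa [uIcc_of_le hab.le] at this
  have hWint : IntegrableOn W (Ioo a b) :=
    (hWc.integrableOn_Icc).mono_set Ioo_subset_Icc_self
  have hvW : Integrable (fun x => v x - W x) (volume.restrict (Ioo a b)) := hv.sub hWint
  have hmul : ∀ {F g : ℝ → ℝ}, Integrable F (volume.restrict (Ioo a b)) → Continuous g →
      HasCompactSupport g → Integrable (fun x => F x * g x) (volume.restrict (Ioo a b)) := by
    intro F g hF hg hgc
    obtain ⟨C, hC⟩ := hgc.exists_bound_of_continuous hg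
    exact hF.mul_bdd (c := C) hg.aestronglyMeasurable (Filter.Eventually.of_forall hC)
  have hortho : ∀ φ : ℝ → ℝ, ContDiff ℝ ∞ φ → HasCompactSupport φ → tsupport φ ⊆ Ioo a b →
      ∫ x in Ioo a b, (v x - W x) * deriv φ x = 0 := by
    intro φ h1 h2 h3
    have hφa : φ a = 0 := image_eq_zero_of_notMem_tsupport fun hm => (h3 hm).1.false
    have hφb : φ b = 0 := image_eq_zero_of_notMem_tsupport fun hm => (h3 hm).2.false
    have hφac : AbsolutelyContinuousOnInterval φ a b :=
      (h1.of_le (by exact_mod_cast le_top)).contDiffOn.absolutelyContinuousOnInterval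
    have hibp := hWac.integral_mul_deriv_eq_deriv_mul hφac
    rw [hφa, hφb, mul_zero, mul_zero, sub_zero, zero_sub] at hibp
    have hcongr : ∫ x in a..b, deriv W x * φ x = ∫ x in a..b, w x * φ x := by
      refine intervalIntegral.integral_congr_ae ?_
      filter_upwards [hwI.ae_hasDerivAt_integral] with x hx hxm
      rw [(hx (uIoc_subset_uIcc hxm) a left_mem_uIcc).deriv]
    have hdc : Continuous (deriv φ) := h1.continuous_deriv (by simp)
    simp_rw [sub_mul]
    rw [integral_sub (hmul hv hdc h2.deriv) (hmul hWint hdc h2.deriv), h φ h1 h2 h3,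
      setIntegral_Ioo_eq hab, setIntegral_Ioo_eq hab, hibp, hcongr]
    ring
  -- a test function of integral one
  let η : ContDiffBump ((a + b) / 2) :=
    ⟨(b - a) / 8, (b - a) / 4, by linarith, by linarith⟩
  set e : ℝ → ℝ := η.normed volume with he
  have he1 : ContDiff ℝ ∞ e := η.contDiff_normed
  have he2 : HasCompactSupport e := η.hasCompactSupport_normed
  have he3 : tsupport e ⊆ Ioo a b := by
    rw [he, η.tsupport_normed_eq, Real.closedBall_eq_Icc]
    intro x hx
    have h1 : (a + b) / 2 - (b - a) / 4 ≤ x := hx.1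
    have h2 : x ≤ (a + b) / 2 + (b - a) / 4 := hx.2
    constructor <;> linarith
  have hfull : ∀ g : ℝ → ℝ, tsupport g ⊆ Ioo a b → ∀ F : ℝ → ℝ,
      ∫ x in Ioo a b, g x * F x = ∫ x, g x * F x := by
    intro g hg F
    refine setIntegral_eq_integral_of_forall_compl_eq_zero fun x hx => ?_
    rw [image_eq_zero_of_notMem_tsupport fun hm => hx (hg hm), zero_mul]
  have he4 : ∫ x in Ioo a b, e x = 1 := by
    have := hfull e he3 (fun _ => 1)
    simp only [mul_one] at this
    rw [this]
    exact η.integral_normed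
  set c : ℝ := ∫ x in Ioo a b, (v x - W x) * e x with hc
  refine ⟨c, ?_⟩
  have hloc : LocallyIntegrableOn (fun x => v x - W x - c) (Ioo a b) :=
    IntegrableOn.locallyIntegrableOn (hvW.sub (integrable_const c))
  have hae := isOpen_Ioo.ae_eq_zero_of_integral_contDiff_smul_eq_zero hloc ?_
  · rw [Filter.EventuallyEq, ae_restrict_iff' measurableSet_Ioo]
    filter_upwards [hae] with x hx hxm
    linarith [hx hxm]
  · intro g hg1 hg2 hg3
    simp only [smul_eq_mul]
    rw [← hfull g hg3]
    set m : ℝ := ∫ x in Ioo a b, g x with hm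
    have hgi : Integrable g (volume.restrict (Ioo a b)) :=
      (hg1.continuous.integrable_of_hasCompactSupport hg2).restrict
    have hei : Integrable e (volume.restrict (Ioo a b)) :=
      (he1.continuous.integrable_of_hasCompactSupport he2).restrict
    have hts : tsupport (fun x => g x - m * e x) ⊆ tsupport g ∪ tsupport e := by
      refine closure_minimal (fun x hx => ?_) ((isClosed_tsupport _).union (isClosed_tsupport _))
      by_contra hcon
      rw [mem_union, not_or] at hcon
      refine hx ?_
      simp only
      rw [image_eq_zero_of_notMem_tsupport hcon.1, image_eq_zero_of_notMem_tsupport hcon.2]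
      ring
    have hcs : HasCompactSupport (fun x => g x - m * e x) :=
      IsCompact.of_isClosed_subset (hg2.isCompact.union he2.isCompact) (isClosed_tsupport _) hts
    obtain ⟨φ, hφ1, hφ2, hφ3, hφ4⟩ := exists_test_primitive hab
      (ψ := fun x => g x - m * e x) (hg1.sub (contDiff_const.mul he1)) hcs
      (hts.trans (union_subset hg3 he3))
      (by rw [integral_sub hgi (hei.const_mul m), integral_const_mul, he4, ← hm]; ring)
    have hz := hortho φ hφ1 hφ2 hφ3
    rw [hφ4] at hz
    have e1 : ∫ x in Ioo a b, (v x - W x) * (g x - m * e x) =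
        (∫ x in Ioo a b, (v x - W x) * g x) - m * c := by
      rw [hc, ← integral_const_mul, ← integral_sub (hmul hvW hg1.continuous hg2)
        ((hmul hvW he1.continuous he2).const_mul m)]
      congr 1; ext x; ring
    have e2 : ∫ x in Ioo a b, g x * (v x - W x - c) =
        (∫ x in Ioo a b, (v x - W x) * g x) - c * m := by
      rw [hm, ← integral_const_mul, ← integral_sub (hmul hvW hg1.continuous hg2)
        (hgi.const_mul c)]
      congr 1; ext x; ring
    rw [e2]
    rw [e1] at hz
    linarith

/-- Two functions which are continuous on `[a, b]` and agree almost everywhere on `(a, b)` agree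
on `[a, b]`. -/
lemma eqOn_Icc_of_ae_eq_Ioo {a b : ℝ} (hab : a < b) {F G : ℝ → ℝ} (hF : ContinuousOn F (Icc a b))
    (hG : ContinuousOn G (Icc a b)) (h : F =ᵐ[volume.restrict (Ioo a b)] G) :
    EqOn F G (Icc a b) := by
  refine Measure.eqOn_Icc_of_ae_eq volume hab.ne ?_ hF hG
  rwa [← restrict_Ioo_eq_restrict_Icc]

/-- The continuous representative of a function with an integrable weak derivative. -/
lemma IsWeakDeriv.eqOn_integral {a b : ℝ} (hab : a < b) {v w F : ℝ → ℝ}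
    (h : IsWeakDeriv a b v w) (hv : IntegrableOn v (Ioo a b)) (hw : IntegrableOn w (Ioo a b))
    (hF : ContinuousOn F (Icc a b)) (hvF : v =ᵐ[volume.restrict (Ioo a b)] F) :
    ∀ x ∈ Icc a b, F x = F a + ∫ t in a..x, w t := by
  obtain ⟨c, hc⟩ := h.ae_eq_const_add_integral hab hv hw
  have hWc : ContinuousOn (fun x => ∫ t in a..x, w t) (Icc a b) := by
    have := ((intervalIntegrable_of_integrableOn_Ioo hab
      hw).absolutelyContinuousOnInterval_intervalIntegral left_mem_uIcc).continuousOn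
    rwa [uIcc_of_le hab.le] at this
  have hE := eqOn_Icc_of_ae_eq_Ioo hab hF (continuousOn_const.add hWc) (hvF.symm.trans hc)
  intro x hx
  have ha := hE (left_mem_Icc.mpr hab.le)
  have hx' := hE hx
  simp only [Pi.add_apply, intervalIntegral.integral_same, add_zero] at ha hx'
  rw [ha, hx']

/-- The sup norm bound of the Sobolev inequality in one dimension. -/
lemma IsWeakDeriv.abs_le {a b : ℝ} (hab : a < b) {v w F : ℝ → ℝ}
    (h : IsWeakDeriv a b v w) (hv : IntegrableOn v (Ioo a b)) (hw : IntegrableOn w (Ioo a b))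
    (hF : ContinuousOn F (Icc a b)) (hvF : v =ᵐ[volume.restrict (Ioo a b)] F) :
    ∀ x ∈ Icc a b, |F x| ≤ (b - a)⁻¹ * (∫ x in Ioo a b, |v x|) + ∫ x in Ioo a b, |w x| := by
  intro x hx
  have hwI := intervalIntegrable_of_integrableOn_Ioo hab hw
  set I : ℝ := ∫ x in Ioo a b, |w x| with hI
  have hrep := h.eqOn_integral hab hv hw hF hvF
  have hsub : ∀ c d, c ∈ Icc a b → d ∈ Icc a b → IntervalIntegrable w volume c d := by
    intro c d hc hd
    refine hwI.mono_set ?_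
    rw [uIcc_of_le hab.le]
    exact (convex_Icc a b).ordConnected.uIcc_subset hc hd
  have hdiff : ∀ y ∈ Icc a b, |F x| ≤ |F y| + I := by
    intro y hy
    have h1 : F x - F y = ∫ t in y..x, w t := by
      rw [hrep x hx, hrep y hy, ← intervalIntegral.integral_interval_sub_left
        (hsub a x (left_mem_Icc.mpr hab.le) hx) (hsub a y (left_mem_Icc.mpr hab.le) hy)]
      ring
    have h2 : |∫ t in y..x, w t| ≤ I := by
      refine (intervalIntegral.norm_integral_le_integral_norm_uIoc (f := w)).trans ?_
      rw [hI, ← integral_Ioc_eq_integral_Ioo]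
      refine setIntegral_mono_set ?_ (Filter.Eventually.of_forall fun _ => abs_nonneg _)
        (LE.le.eventuallyLE ?_)
      · exact ((intervalIntegrable_iff_integrableOn_Ioc_of_le hab.le).mp hwI).abs
      · intro t ht
        exact ⟨(le_min hy.1 hx.1).trans_lt ht.1, ht.2.trans (max_le hy.2 hx.2)⟩
    calc |F x| = |F y + ∫ t in y..x, w t| := by rw [← h1]; congr 1; ring
      _ ≤ |F y| + I := (abs_add_le _ _).trans (by linarith)
  have hba : 0 < b - a := sub_pos.mpr hab
  have hFi : IntegrableOn F (Ioo a b) := hF.integrableOn_Icc.mono_set Ioo_subset_Icc_self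
  have hint : ∫ _y in Ioo a b, |F x| ≤ ∫ y in Ioo a b, (|F y| + I) :=
    setIntegral_mono_on (integrable_const _) (hFi.abs.add (integrable_const _)) measurableSet_Ioo
      fun y hy => hdiff y (Ioo_subset_Icc_self hy)
  rw [integral_add hFi.abs (integrable_const _)] at hint
  simp only [integral_const, measureReal_restrict_apply_univ, Real.volume_real_Ioo_of_le hab.le,
    smul_eq_mul] at hint
  have hcongr : ∫ y in Ioo a b, |F y| = ∫ y in Ioo a b, |v y| := by
    refine integral_congr_ae ?_
    filter_upwards [hvF] with y hy
    rw [hy]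
  rw [hcongr] at hint
  calc |F x| = (b - a)⁻¹ * ((b - a) * |F x|) := by field_simp
    _ ≤ (b - a)⁻¹ * ((∫ y in Ioo a b, |v y|) + (b - a) * I) :=
        mul_le_mul_of_nonneg_left hint (inv_pos.mpr hba).le
    _ = _ := by field_simp

/-- One more derivative for a primitive of a `Cˢ` function. -/
lemma contDiff_primitive {s : ℕ} {G : ℝ → ℝ} (hG : ContDiff ℝ s G) (a c : ℝ) :
    ContDiff ℝ (s + 1 : ℕ) (fun x => c + ∫ t in a..x, G t) ∧
      deriv (fun x => c + ∫ t in a..x, G t) = G := by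
  have hd : ∀ x, HasDerivAt (fun x => c + ∫ t in a..x, G t) (G x) x := fun x =>
    (intervalIntegral.integral_hasDerivAt_right (hG.continuous.intervalIntegrable a x)
      (hG.continuous.stronglyMeasurableAtFilter _ _) hG.continuous.continuousAt).const_add c
  have hderiv : deriv (fun x => c + ∫ t in a..x, G t) = G := funext fun x => (hd x).deriv
  refine ⟨?_, hderiv⟩
  rw [Nat.cast_add, Nat.cast_one, contDiff_succ_iff_deriv, hderiv]
  exact ⟨fun x => (hd x).differentiableAt, by simp, hG⟩

/-- Functions with `s + 1` integrable weak derivatives are of class `Cˢ`. The representative is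
extended to the whole line, so that no one-sided derivatives are needed at `a` and `b`. -/
lemma exists_contDiff_representative {a b : ℝ} (hab : a < b) (s : ℕ) (g : ℕ → ℝ → ℝ)
    (hg : ∀ j ≤ s + 1, IntegrableOn (g j) (Ioo a b))
    (hw : ∀ j < s + 1, IsWeakDeriv a b (g j) (g (j + 1))) :
    ∃ G : ℝ → ℝ, ContDiff ℝ s G ∧
      ∀ j ≤ s, g j =ᵐ[volume.restrict (Ioo a b)] iteratedDeriv j G := by
  induction s generalizing g with
  | zero =>
    obtain ⟨c, hc⟩ := (hw 0 (by omega)).ae_eq_const_add_integral hab (hg 0 (by omega))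
      (hg 1 (by omega))
    refine ⟨fun x => c + ∫ t in a..x, (Ioo a b).indicator (g 1) t, ?_, ?_⟩
    · rw [Nat.cast_zero, contDiff_zero]
      refine continuous_const.add (intervalIntegral.continuous_primitive (fun p q => ?_) a)
      exact ((integrable_indicator_iff measurableSet_Ioo).mpr (hg 1 (by omega))).intervalIntegrable
    · intro j hj
      obtain rfl : j = 0 := by omega
      rw [iteratedDeriv_zero]
      filter_upwards [hc, ae_restrict_mem measurableSet_Ioo] with x hx hxm
      rw [hx]
      congr 1
      refine intervalIntegral.integral_congr_ae (Filter.Eventually.of_forall fun t ht => ?_)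
      rw [uIoc_of_le hxm.1.le] at ht
      exact (indicator_of_mem (show t ∈ Ioo a b from ⟨ht.1, ht.2.trans_lt hxm.2⟩) _).symm
  | succ s ih =>
    obtain ⟨G, hG, hGj⟩ := ih (fun j => g (j + 1)) (fun j hj => hg (j + 1) (by omega))
      (fun j hj => hw (j + 1) (by omega))
    obtain ⟨c, hc⟩ := (hw 0 (by omega)).ae_eq_const_add_integral hab (hg 0 (by omega))
      (hg 1 (by omega))
    obtain ⟨hP, hPd⟩ := contDiff_primitive hG a c
    refine ⟨_, hP, fun j hj => ?_⟩
    rcases j with _ | j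
    · rw [iteratedDeriv_zero]
      filter_upwards [hc, ae_restrict_mem measurableSet_Ioo] with x hx hxm
      rw [hx]
      congr 1
      refine intervalIntegral.integral_congr_ae ?_
      have h0 := hGj 0 (by omega)
      rw [iteratedDeriv_zero, Filter.EventuallyEq, ae_restrict_iff' measurableSet_Ioo] at h0
      filter_upwards [h0] with t ht htm
      rw [uIoc_of_le hxm.1.le] at htm
      exact ht ⟨htm.1, htm.2.trans_lt hxm.2⟩
    · rw [iteratedDeriv_succ', hPd]
      exact hGj j (by omega)

/-! ### The Sobolev embedding and point evaluation -/

/-- The `j`-th weak derivative of an element of the Sobolev space (zero for `j > m`). -/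
noncomputable def sobolevDeriv {a b : ℝ} {m : ℕ} (V : sobolev a b m) (j : ℕ) : ℝ → ℝ :=
  if h : j < m + 1 then ⇑((V : PiLp 2 (fun _ : Fin (m + 1) => L2 a b)) ⟨j, h⟩ : L2 a b) else 0

lemma sobolevDeriv_of_lt {a b : ℝ} {m j : ℕ} (V : sobolev a b m) (h : j < m + 1) :
    sobolevDeriv V j = ⇑((V : PiLp 2 (fun _ : Fin (m + 1) => L2 a b)) ⟨j, h⟩ : L2 a b) :=
  dif_pos h

lemma sobolevDeriv_zero {a b : ℝ} {m : ℕ} (V : sobolev a b m) :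
    sobolevDeriv V 0 = ⇑((V : PiLp 2 (fun _ : Fin (m + 1) => L2 a b)) 0 : L2 a b) :=
  sobolevDeriv_of_lt V (Nat.succ_pos m)

lemma integrableOn_sobolevDeriv {a b : ℝ} {m j : ℕ} (V : sobolev a b m) (hj : j ≤ m) :
    IntegrableOn (sobolevDeriv V j) (Ioo a b) := by
  rw [sobolevDeriv_of_lt V (by omega)]
  exact (Lp.memLp _).integrable (by norm_num)

lemma isWeakDeriv_sobolevDeriv {a b : ℝ} {m j : ℕ} (V : sobolev a b m) (hj : j < m) :
    IsWeakDeriv a b (sobolevDeriv V j) (sobolevDeriv V (j + 1)) := by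
  rw [sobolevDeriv_of_lt V (by omega), sobolevDeriv_of_lt V (by omega)]
  exact V.2 ⟨j, hj⟩

lemma integral_abs_le_norm {a b : ℝ} (g : L2 a b) :
    ∫ x in Ioo a b, |g x| ≤ √(b - a) * ‖g‖ := by
  have hm := (Lp.memLp g).aestronglyMeasurable
  have h := eLpNorm_le_eLpNorm_mul_rpow_measure_univ
    (μ := volume.restrict (Ioo a b)) (p := 1) (q := 2) (by norm_num) hm
  have h1 := integral_norm_eq_lintegral_enorm hm
  rw [← eLpNorm_one_eq_lintegral_enorm] at h1
  simp only [Real.norm_eq_abs] at h1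
  rw [h1, Lp.norm_def]
  rw [Measure.restrict_apply_univ, Real.volume_Ioo] at h
  norm_num at h
  refine (ENNReal.toReal_mono ?_ h).trans (le_of_eq ?_)
  · exact ENNReal.mul_ne_top (Lp.memLp g).2.ne (by simp)
  · rw [ENNReal.toReal_mul, mul_comm, ← ENNReal.toReal_rpow]
    congr 1
    rcases le_total 0 (b - a) with h0 | h0
    · rw [ENNReal.toReal_ofReal h0, Real.sqrt_eq_rpow]
    · rw [ENNReal.ofReal_of_nonpos h0, Real.sqrt_eq_zero_of_nonpos h0, ENNReal.toReal_zero,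
        Real.zero_rpow (by norm_num)]

lemma integral_abs_sobolevDeriv_le {a b : ℝ} {m j : ℕ} (V : sobolev a b m) (hj : j ≤ m) :
    ∫ x in Ioo a b, |sobolevDeriv V j x| ≤ √(b - a) * ‖V‖ := by
  rw [sobolevDeriv_of_lt V (by omega)]
  refine (integral_abs_le_norm _).trans (mul_le_mul_of_nonneg_left ?_ (Real.sqrt_nonneg _))
  exact PiLp.norm_apply_le (V : PiLp 2 (fun _ : Fin (m + 1) => L2 a b)) _

/-- The constant of the Sobolev inequality on `(a, b)`. -/
noncomputable def sobolevConst (a b : ℝ) : ℝ := (b - a)⁻¹ * √(b - a) + √(b - a)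

lemma sobolevConst_pos {a b : ℝ} (hab : a < b) : 0 < sobolevConst a b := by
  have : 0 < b - a := sub_pos.mpr hab
  unfold sobolevConst
  positivity

/-- The Sobolev embedding `Hᵐ ⊂ Cˢ` for `s < m` in one dimension. -/
lemma exists_contDiff_of_sobolev {a b : ℝ} (hab : a < b) {m s : ℕ} (hs : s < m)
    (V : sobolev a b m) : ∃ G : ℝ → ℝ, ContDiff ℝ s G ∧
      (∀ j ≤ s, sobolevDeriv V j =ᵐ[volume.restrict (Ioo a b)] iteratedDeriv j G) ∧
      ∀ j ≤ s, ∀ x ∈ Icc a b, |iteratedDeriv j G x| ≤ sobolevConst a b * ‖V‖ := by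
  obtain ⟨G, hG, hGj⟩ := exists_contDiff_representative hab s (sobolevDeriv V)
    (fun j hj => integrableOn_sobolevDeriv V (by omega))
    (fun j hj => isWeakDeriv_sobolevDeriv V (by omega))
  refine ⟨G, hG, hGj, fun j hj x hx => ?_⟩
  have hba : 0 < b - a := sub_pos.mpr hab
  have h := (isWeakDeriv_sobolevDeriv V (show j < m by omega)).abs_le hab
    (integrableOn_sobolevDeriv V (by omega)) (integrableOn_sobolevDeriv V (by omega))
    (hG.continuous_iteratedDeriv j (by exact_mod_cast hj)).continuousOn (hGj j hj) x hx
  have h1 := mul_le_mul_of_nonneg_left (integral_abs_sobolevDeriv_le V (show j ≤ m by omega))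
    (inv_pos.mpr hba).le
  have h2 := integral_abs_sobolevDeriv_le V (show j + 1 ≤ m by omega)
  rw [sobolevConst]
  linarith

/-- Evaluation at a point of `[a, b]` is a continuous linear functional on `Hᵐ`, `m ≥ 1`. -/
lemma exists_pointEval {a b : ℝ} (hab : a < b) {m : ℕ} (hm : 1 ≤ m) {x : ℝ} (hx : x ∈ Icc a b) :
    ∃ L : sobolev a b m →L[ℝ] ℝ, ∀ (V : sobolev a b m) (F : ℝ → ℝ), ContinuousOn F (Icc a b) →
      F =ᵐ[volume.restrict (Ioo a b)] sobolevDeriv V 0 → L V = F x := by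
  have hrep := fun V : sobolev a b m => exists_contDiff_of_sobolev hab (s := 0) (by omega) V
  choose G hG hGj hGb using hrep
  have hGc : ∀ V, ContinuousOn (G V) (Icc a b) := fun V => (hG V).continuous.continuousOn
  have hG0 : ∀ V, sobolevDeriv V 0 =ᵐ[volume.restrict (Ioo a b)] G V := fun V => by
    simpa using hGj V 0 le_rfl
  have huniq : ∀ (V : sobolev a b m) (F : ℝ → ℝ), ContinuousOn F (Icc a b) →
      F =ᵐ[volume.restrict (Ioo a b)] sobolevDeriv V 0 → G V x = F x := fun V F hF hFV =>
    eqOn_Icc_of_ae_eq_Ioo hab (hGc V) hF ((hFV.trans (hG0 V)).symm) hx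
  let l : sobolev a b m →ₗ[ℝ] ℝ :=
    { toFun := fun V => G V x
      map_add' := by
        intro V W
        refine huniq (V + W) (fun x => G V x + G W x) ((hGc V).add (hGc W)) ?_
        rw [sobolevDeriv_zero]
        have h1 := hG0 V
        have h2 := hG0 W
        rw [sobolevDeriv_zero] at h1 h2
        have h3 := Lp.coeFn_add ((V : PiLp 2 (fun _ : Fin (m + 1) => L2 a b)) 0 : L2 a b)
          ((W : PiLp 2 (fun _ : Fin (m + 1) => L2 a b)) 0 : L2 a b)
        filter_upwards [h1, h2, h3] with y h1 h2 h3
        rw [← h1, ← h2, Submodule.coe_add, PiLp.add_apply, h3, Pi.add_apply]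
      map_smul' := by
        intro c V
        refine huniq (c • V) (fun x => c * G V x) (continuousOn_const.mul (hGc V)) ?_
        rw [sobolevDeriv_zero]
        have h1 := hG0 V
        rw [sobolevDeriv_zero] at h1
        have h3 := Lp.coeFn_smul c ((V : PiLp 2 (fun _ : Fin (m + 1) => L2 a b)) 0 : L2 a b)
        filter_upwards [h1, h3] with y h1 h3
        rw [← h1, Submodule.coe_smul, PiLp.smul_apply, h3, Pi.smul_apply, smul_eq_mul] }
  refine ⟨l.mkContinuous (sobolevConst a b) fun V => ?_, fun V F hF hFV => huniq V F hF hFV⟩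
  have := hGb V 0 le_rfl x hx
  rwa [iteratedDeriv_zero] at this

/-! ### Regularity of the solution -/

/-- A family of functionals that evaluate continuous representatives at the points of `[a, b]`. -/
def IsPointEval {a b : ℝ} {m : ℕ} (L : ℝ → sobolev a b m →L[ℝ] ℝ) : Prop :=
  ∀ x ∈ Icc a b, ∀ (V : sobolev a b m) (F : ℝ → ℝ), ContinuousOn F (Icc a b) →
    F =ᵐ[volume.restrict (Ioo a b)] sobolevDeriv V 0 → L x V = F x

lemma exists_isPointEval {a b : ℝ} (hab : a < b) {m : ℕ} (hm : 1 ≤ m) :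
    ∃ L : ℝ → sobolev a b m →L[ℝ] ℝ, IsPointEval L := by
  classical
  have h : ∀ x, ∃ L : sobolev a b m →L[ℝ] ℝ, x ∈ Icc a b → ∀ (V : sobolev a b m) (F : ℝ → ℝ),
      ContinuousOn F (Icc a b) →
      F =ᵐ[volume.restrict (Ioo a b)] sobolevDeriv V 0 → L V = F x := by
    intro x
    by_cases hx : x ∈ Icc a b
    · obtain ⟨L, hL⟩ := exists_pointEval hab hm hx
      exact ⟨L, fun _ => hL⟩
    · exact ⟨0, fun h => absurd h hx⟩
  choose L hL using h
  exact ⟨L, fun x hx => hL x hx⟩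

lemma hasDerivWithinAt_pointEval {a b T : ℝ} {m : ℕ} {L : ℝ → sobolev a b m →L[ℝ] ℝ}
    (hL : IsPointEval L) {v : ℝ → ℝ → ℝ} {V : ℝ → sobolev a b m}
    (hV : ContDiffOn ℝ 1 V (Icc 0 T))
    (hvV : ∀ t ∈ Icc 0 T, v t =ᵐ[volume.restrict (Ioo a b)] sobolevDeriv (V t) 0)
    (hvc : ∀ t ∈ Icc 0 T, ContinuousOn (v t) (Icc a b)) {x t : ℝ} (hx : x ∈ Icc a b)
    (ht : t ∈ Icc 0 T) :
    HasDerivWithinAt (fun s => v s x) (L x (derivWithin V (Icc 0 T) t)) (Icc 0 T) t := by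
  have h1 : HasDerivWithinAt V (derivWithin V (Icc 0 T) t) (Icc 0 T) t :=
    (hV.differentiableOn (by simp) t ht).hasDerivWithinAt
  have h2 := (L x).hasFDerivAt.comp_hasDerivWithinAt t h1
  refine h2.congr (fun s hs => ?_) ?_
  · exact (hL x hx (V s) (v s) (hvc s hs) (hvV s hs)).symm
  · exact (hL x hx (V t) (v t) (hvc t ht) (hvV t ht)).symm

/-- At positive times the solution is two orders smoother than `H²ʳ`: by the equation its second
derivative is the continuous representative of `∂ₜ u - f(u)`, which is in `H²ʳ`. -/
lemma exists_contDiff_solution {a b T : ℝ} (hab : a < b) (hT : 0 < T) {r : ℕ} (hr : 1 ≤ r)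
    {f u₀ : ℝ → ℝ} {u : ℝ → ℝ → ℝ} (hu : IsSolution a b T f u₀ u)
    {L : ℝ → sobolev a b (2 * r) →L[ℝ] ℝ} (hL : IsPointEval L)
    {V F : ℝ → sobolev a b (2 * r)} (hV : ContDiffOn ℝ 1 V (Icc 0 T))
    (huV : ∀ t ∈ Icc 0 T, u t =ᵐ[volume.restrict (Ioo a b)] sobolevDeriv (V t) 0)
    (hfF : ∀ t ∈ Icc 0 T,
      (fun x => f (u t x)) =ᵐ[volume.restrict (Ioo a b)] sobolevDeriv (F t) 0)
    (hfc : ∀ t ∈ Icc 0 T, ContinuousOn (fun x => f (u t x)) (Icc a b)) {t : ℝ}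
    (ht : t ∈ Ioc 0 T) :
    ∃ v : ℝ → ℝ, ContDiff ℝ (r + 2 : ℕ) v ∧ (∀ x ∈ Icc a b, v x = u t x) ∧
      (∀ x ∈ Icc a b, |iteratedDeriv (r + 2) v x| ≤
        sobolevConst a b * ‖derivWithin V (Icc 0 T) t - F t‖) ∧
      deriv v a = 0 ∧ deriv v b = 0 ∧
      ∀ x ∈ Icc a b, L x (derivWithin V (Icc 0 T) t) = deriv (deriv v) x + f (u t x) := by
  have htc : t ∈ Icc 0 T := Ioc_subset_Icc_self ht
  have ha : a ∈ Icc a b := left_mem_Icc.mpr hab.le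
  have hb : b ∈ Icc a b := right_mem_Icc.mpr hab.le
  obtain ⟨W, hW, hWj, hWb⟩ := exists_contDiff_of_sobolev hab (show r < 2 * r by omega)
    (derivWithin V (Icc 0 T) t - F t)
  have hW0 := hWj 0 (by omega)
  rw [iteratedDeriv_zero] at hW0
  have hWL : ∀ x ∈ Icc a b, L x (derivWithin V (Icc 0 T) t) = W x + f (u t x) := by
    intro x hx
    have h1 := hL x hx _ W hW.continuous.continuousOn hW0.symm
    have h2 := hL x hx (F t) _ (hfc t htc) (hfF t htc)
    rw [map_sub, h2] at h1
    linarith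
  -- the continuously differentiable representative of the solution
  obtain ⟨G, hG, hGj, -⟩ := exists_contDiff_of_sobolev hab (show 1 < 2 * r by omega) (V t)
  have hG0 := hGj 0 (by omega)
  have hG1 := hGj 1 le_rfl
  rw [iteratedDeriv_zero] at hG0
  rw [iteratedDeriv_one] at hG1
  have hGu : EqOn G (u t) (Icc a b) := eqOn_Icc_of_ae_eq_Ioo hab hG.continuous.continuousOn
    (hu.continuousOn t htc) (hG0.symm.trans (huV t htc).symm)
  have hGc : Continuous (deriv G) := hG.continuous_deriv (by simp)
  have hGd : ∀ x, HasDerivAt G (deriv G x) x := fun x =>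
    (hG.differentiable (by simp) x).hasDerivAt
  have hint2 := integrableOn_sobolevDeriv (V t) (show 2 ≤ 2 * r by omega)
  have hrep := (isWeakDeriv_sobolevDeriv (V t) (show 1 < 2 * r by omega)).eqOn_integral hab
    (integrableOn_sobolevDeriv (V t) (by omega)) hint2 hGc.continuousOn hG1
  -- the second weak derivative is the second derivative in the equation
  have hW2 : sobolevDeriv (V t) 2 =ᵐ[volume.restrict (Ioo a b)] W := by
    have hleb := (intervalIntegrable_of_integrableOn_Ioo hab hint2).ae_hasDerivAt_integral
    filter_upwards [hu.equation t ht, ae_restrict_of_ae hleb, ae_restrict_mem measurableSet_Ioo]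
      with x hx hx2 hxm
    obtain ⟨ut, uxx, h1, h2, h3⟩ := hx
    have hxc := Ioo_subset_Icc_self hxm
    have hut : ut = L x (derivWithin V (Icc 0 T) t) :=
      (uniqueDiffOn_Icc hT t htc).eq_deriv _ h1
        (hasDerivWithinAt_pointEval hL hV huV hu.continuousOn hxc htc)
    have hx3 := hx2 (by rwa [uIcc_of_le hab.le]) a (by rwa [uIcc_of_le hab.le])
    have hev : deriv (u t) =ᶠ[nhds x]
        fun y => deriv G a + ∫ s in a..y, sobolevDeriv (V t) 2 s := by
      filter_upwards [isOpen_Ioo.mem_nhds hxm] with y hy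
      rw [← hrep y (Ioo_subset_Icc_self hy)]
      refine Filter.EventuallyEq.deriv_eq ?_
      filter_upwards [isOpen_Ioo.mem_nhds hy] with z hz
      exact (hGu (Ioo_subset_Icc_self hz)).symm
    have huxx : uxx = sobolevDeriv (V t) 2 x :=
      h2.unique ((hx3.const_add (deriv G a)).congr_of_eventuallyEq hev)
    have := hWL x hxc
    rw [← hut] at this
    rw [← huxx]
    linarith
  obtain ⟨hP, hPd⟩ := contDiff_primitive hW a (deriv G a)
  set P : ℝ → ℝ := fun x => deriv G a + ∫ s in a..x, W s with hPdef
  have hPG : ∀ x ∈ Icc a b, deriv G x = P x := by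
    intro x hx
    rw [hrep x hx, hPdef]
    congr 1
    refine intervalIntegral.integral_congr_ae ?_
    rw [Filter.EventuallyEq, restrict_Ioo_eq_restrict_Ioc,
      ae_restrict_iff' measurableSet_Ioc] at hW2
    filter_upwards [hW2] with s hs hsm
    rw [uIoc_of_le hx.1] at hsm
    exact hs ⟨hsm.1, hsm.2.trans hx.2⟩
  obtain ⟨hv, hvd⟩ := contDiff_primitive hP a (G a)
  set v : ℝ → ℝ := fun x => G a + ∫ s in a..x, P s with hvdef
  have hvu : ∀ x ∈ Icc a b, v x = u t x := by
    intro x hx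
    rw [← hGu hx, hvdef]
    have h1 : ∫ s in a..x, P s = ∫ s in a..x, deriv G s := by
      refine intervalIntegral.integral_congr fun s hs => ?_
      rw [uIcc_of_le hx.1] at hs
      exact (hPG s ⟨hs.1, hs.2.trans hx.2⟩).symm
    simp only
    rw [h1, intervalIntegral.integral_eq_sub_of_hasDerivAt (fun s _ => hGd s)
      (hGc.intervalIntegrable _ _)]
    ring
  have hneu : ∀ x ∈ Icc a b, HasDerivWithinAt (u t) 0 (Icc a b) x → deriv v x = 0 := by
    intro x hx h
    have h1 : HasDerivWithinAt v 0 (Icc a b) x := h.congr hvu (hvu x hx)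
    have h2 : HasDerivAt v (deriv v x) x := (hv.differentiable (by simp) x).hasDerivAt
    exact (uniqueDiffOn_Icc hab x hx).eq_deriv _ h2.hasDerivWithinAt h1
  refine ⟨v, hv, hvu, fun x hx => ?_, hneu a ha (hu.neumann t ht).1, hneu b hb (hu.neumann t ht).2,
    fun x hx => ?_⟩
  · rw [iteratedDeriv_succ', iteratedDeriv_succ', hvd, hPd]
    exact hWb r le_rfl x hx
  · rw [hvd, hPd]
    exact hWL x hx

/-! ### Extrapolation in time -/

section Extrapolation

open Polynomial

/-- Neighbouring nodes are `τ` apart and no node is further than `k τ` from a point of the step, so each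
factor of the Lagrange basis polynomial is at most `k`. -/
lemma abs_eval_extrapBasis_le {τ : ℝ} (hτ : 0 < τ) {k n j : ℕ} (hj : j ∈ Finset.Icc 1 k)
    {s : ℝ} (hs : s ∈ Icc (((n : ℝ) - 1) * τ) (n * τ)) :
    |(extrapBasis τ k n j).eval s| ≤ (k : ℝ) ^ k := by
  rw [Finset.mem_Icc] at hj
  have hk1 : (1 : ℝ) ≤ k := by exact_mod_cast hj.1.trans hj.2
  rw [extrapBasis, Lagrange.basis, eval_prod, Finset.abs_prod]
  calc _ ≤ ∏ _i ∈ (Finset.Icc 1 k).erase j, (k : ℝ) := by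
        refine Finset.prod_le_prod (fun _ _ => abs_nonneg _) fun i hi => ?_
        rw [Finset.mem_erase, Finset.mem_Icc] at hi
        have hi1 : (1 : ℝ) ≤ i := by exact_mod_cast hi.2.1
        have hik : (i : ℝ) ≤ k := by exact_mod_cast hi.2.2
        simp only [Lagrange.basisDivisor, eval_mul, eval_C, eval_sub, eval_X]
        have h1 : τ ≤ |((n : ℝ) - j) * τ - (n - i) * τ| := by
          have h2 : ((n : ℝ) - j) * τ - (n - i) * τ = ((i : ℝ) - j) * τ := by ring
          rw [h2, abs_mul, abs_of_pos hτ]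
          have h3 : (1 : ℝ) ≤ |(i : ℝ) - j| := by
            have : (1 : ℤ) ≤ |(i : ℤ) - j| := Int.one_le_abs (by omega)
            exact_mod_cast this
          nlinarith
        have h4 : |s - (n - i) * τ| ≤ k * τ := by
          rw [abs_le]
          constructor <;> nlinarith [hs.1, hs.2]
        rw [abs_mul, abs_inv, inv_mul_le_iff₀ (hτ.trans_le h1)]
        nlinarith
    _ ≤ (k : ℝ) ^ k := by
        rw [Finset.prod_const]
        refine pow_le_pow_right₀ hk1 ?_
        rw [Finset.card_erase_of_mem (Finset.mem_Icc.mpr hj), Nat.card_Icc]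
        omega

lemma injOn_extrapNodes {τ : ℝ} (hτ : 0 < τ) (k n : ℕ) :
    Set.InjOn (fun i : ℕ => ((n : ℝ) - i) * τ) (Finset.Icc 1 k : Set ℕ) := by
  intro i _ j _ h
  have h2 := mul_right_cancel₀ hτ.ne' h
  exact_mod_cast (sub_right_inj.mp h2)

lemma sum_extrapBasis_mul_pow {τ : ℝ} (hτ : 0 < τ) {k n i : ℕ} (hi : i < k) (x₀ s : ℝ) :
    ∑ j ∈ Finset.Icc 1 k, (extrapBasis τ k n j).eval s * (((n : ℝ) - j) * τ - x₀) ^ i =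
      (s - x₀) ^ i := by
  have hdeg : ((X - C x₀ : ℝ[X]) ^ i).degree < (Finset.Icc 1 k).card := by
    rw [degree_pow, degree_X_sub_C, Nat.card_Icc]
    simpa using hi
  have h := Lagrange.eq_interpolate (injOn_extrapNodes hτ k n) hdeg
  have h2 := congrArg (Polynomial.eval s) h
  rw [Lagrange.interpolate_apply, eval_finsetSum] at h2
  simp only [eval_pow, eval_sub, eval_X, eval_C, eval_mul] at h2
  rw [h2]
  exact Finset.sum_congr rfl fun j _ => mul_comm _ _

/-- The error of polynomial extrapolation from `k` equidistant values is of order `τᵏ`. -/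
lemma exists_extrapolation_error_le {E : Type*} [NormedAddCommGroup E] [NormedSpace ℝ E]
    {T : ℝ} (hT : 0 < T) {k : ℕ} (hk : 1 ≤ k) {W : ℝ → E} (hW : ContDiffOn ℝ k W (Icc 0 T)) :
    ∃ C : ℝ, 0 < C ∧ ∀ N n : ℕ, 1 ≤ N → k ≤ n → n ≤ N →
      ∀ s ∈ Icc (((n : ℝ) - 1) * (T / N)) (n * (T / N)),
      ‖W s - ∑ j ∈ Finset.Icc 1 k, (extrapBasis (T / N) k n j).eval s •
        W (((n - j : ℕ) : ℝ) * (T / N))‖ ≤ C * (T / N) ^ k := by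
  have hcont : ContinuousOn (iteratedDerivWithin k W (Icc 0 T)) (Icc 0 T) :=
    hW.continuousOn_iteratedDerivWithin le_rfl (uniqueDiffOn_Icc hT)
  obtain ⟨B, hB⟩ := isCompact_Icc.exists_bound_of_continuousOn hcont
  have hB0 : 0 ≤ B := (norm_nonneg _).trans (hB 0 (left_mem_Icc.mpr hT.le))
  refine ⟨(B * k ^ k + 1) * (1 + k * k ^ k), by positivity, fun N n hN hkn hnN s hs => ?_⟩
  obtain ⟨m, rfl⟩ : ∃ m, k = m + 1 := ⟨k - 1, by omega⟩
  set k := m + 1 with hkdef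
  have hN0 : (0 : ℝ) < N := by exact_mod_cast hN
  set τ := T / N with hτdef
  have hτ : 0 < τ := div_pos hT hN0
  have hNτ : (N : ℝ) * τ = T := by rw [hτdef]; field_simp
  have hnN' : (n : ℝ) ≤ N := by exact_mod_cast hnN
  have hkn' : (k : ℝ) ≤ n := by exact_mod_cast hkn
  have hk1 : (1 : ℝ) ≤ k := by exact_mod_cast hk
  set x₀ : ℝ := (n - k) * τ with hx₀
  have hx₀0 : 0 ≤ x₀ := mul_nonneg (by linarith) hτ.le
  have hx₀T : x₀ < T := by rw [← hNτ, hx₀]; nlinarith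
  have hsub : Icc x₀ T ⊆ Icc 0 T := Icc_subset_Icc_left hx₀0
  set p : ℝ → E := fun x => taylorWithinEval W m (Icc x₀ T) x₀ x with hp
  have htaylor : ∀ x ∈ Icc x₀ (x₀ + k * τ), ‖W x - p x‖ ≤ B * k ^ k * τ ^ k := by
    intro x hx
    have hxT : x ≤ T := by
      have : x₀ + k * τ ≤ T := by rw [← hNτ, hx₀]; nlinarith
      linarith [hx.2]
    have h := taylor_mean_remainder_bound (f := W) (n := m) (C := B) hx₀T.le
      (by exact_mod_cast hW.mono hsub) (⟨hx.1, hxT⟩ : x ∈ Icc x₀ T) (fun y hy => by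
        rw [iteratedDerivWithin, iteratedFDerivWithin_subset hsub (uniqueDiffOn_Icc hx₀T)
          (uniqueDiffOn_Icc hT) hW hy]
        exact hB y (hsub hy))
    refine h.trans ?_
    have hfac : (1 : ℝ) ≤ m.factorial := by
      exact_mod_cast Nat.one_le_iff_ne_zero.mpr m.factorial_ne_zero
    have hxx : 0 ≤ x - x₀ := by linarith [hx.1]
    calc B * (x - x₀) ^ (m + 1) / m.factorial ≤ B * (x - x₀) ^ (m + 1) :=
          div_le_self (by positivity) hfac
      _ ≤ B * (k * τ) ^ (m + 1) :=
          mul_le_mul_of_nonneg_left (pow_le_pow_left₀ hxx (by linarith [hx.2]) _) hB0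
      _ = _ := by rw [mul_pow]; ring
  -- extrapolation reproduces the Taylor polynomial
  have hrepr : p s = ∑ j ∈ Finset.Icc 1 k, (extrapBasis τ k n j).eval s •
      p (((n - j : ℕ) : ℝ) * τ) := by
    simp only [hp, taylor_within_apply, Finset.smul_sum, smul_smul]
    rw [Finset.sum_comm]
    refine Finset.sum_congr rfl fun i hi => ?_
    rw [← Finset.sum_smul]
    congr 1
    have hi' : i < k := by
      have := Finset.mem_range.mp hi
      omega
    rw [← sum_extrapBasis_mul_pow (n := n) hτ hi' x₀ s, Finset.mul_sum]
    refine Finset.sum_congr rfl fun j hj => ?_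
    rw [Finset.mem_Icc] at hj
    rw [Nat.cast_sub (hj.2.trans hkn)]
    ring
  have hsplit : W s - ∑ j ∈ Finset.Icc 1 k, (extrapBasis τ k n j).eval s •
      W (((n - j : ℕ) : ℝ) * τ) = (W s - p s) - ∑ j ∈ Finset.Icc 1 k,
        (extrapBasis τ k n j).eval s • (W (((n - j : ℕ) : ℝ) * τ) - p (((n - j : ℕ) : ℝ) * τ)) := by
    simp only [smul_sub, Finset.sum_sub_distrib]
    rw [← hrepr]
    abel
  have hsum : ‖∑ j ∈ Finset.Icc 1 k, (extrapBasis τ k n j).eval s •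
      (W (((n - j : ℕ) : ℝ) * τ) - p (((n - j : ℕ) : ℝ) * τ))‖ ≤
      ∑ _j ∈ Finset.Icc 1 k, (k : ℝ) ^ k * (B * k ^ k * τ ^ k) := by
    refine norm_sum_le_of_le _ fun j hj => ?_
    rw [norm_smul, Real.norm_eq_abs]
    refine mul_le_mul (abs_eval_extrapBasis_le hτ hj hs) (htaylor _ ?_) (norm_nonneg _)
      (by positivity)
    rw [Finset.mem_Icc] at hj
    have hj1 : (1 : ℝ) ≤ j := by exact_mod_cast hj.1
    have hjk : (j : ℝ) ≤ k := by exact_mod_cast hj.2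
    rw [Nat.cast_sub (hj.2.trans hkn), hx₀]
    constructor <;> nlinarith
  have hs' : s ∈ Icc x₀ (x₀ + k * τ) := by
    rw [hx₀]
    constructor <;> nlinarith [hs.1, hs.2]
  rw [hsplit]
  rw [Finset.sum_const, Nat.card_Icc, nsmul_eq_mul, Nat.add_sub_cancel] at hsum
  calc _ ≤ B * k ^ k * τ ^ k + k * ((k : ℝ) ^ k * (B * k ^ k * τ ^ k)) :=
        (norm_sub_le _ _).trans (add_le_add (htaylor s hs') hsum)
    _ = B * k ^ k * (1 + k * k ^ k) * τ ^ k := by ring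
    _ ≤ (B * k ^ k + 1) * (1 + k * k ^ k) * τ ^ k := by
        have : (0 : ℝ) ≤ (1 + k * k ^ k) * τ ^ k := by positivity
        nlinarith

end Extrapolation

/-! ### Variation of constants and the lumped norm -/

lemma hasDerivAt_exp_smul_apply {ι : Type*} [Fintype ι] [DecidableEq ι] (A : Matrix ι ι ℝ)
    (g j : ι) (t : ℝ) :
    HasDerivAt (fun s : ℝ => NormedSpace.exp (s • A) g j)
      ((NormedSpace.exp (t • A) * A) g j) t := by
  let : NormedRing (Matrix ι ι ℝ) := Matrix.linftyOpNormedRing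
  let : NormedAlgebra ℝ (Matrix ι ι ℝ) := Matrix.linftyOpNormedAlgebra
  have h := hasDerivAt_exp_smul_const (𝕂 := ℝ) A t
  let l : Matrix ι ι ℝ →ₗ[ℝ] ℝ :=
    { toFun := fun N => N g j
      map_add' := fun _ _ => rfl
      map_smul' := fun _ _ => rfl }
  exact (LinearMap.toContinuousLinearMap l).hasFDerivAt.comp_hasDerivAt t h

lemma continuousOn_exp_mulVec {ι : Type*} [Fintype ι] [DecidableEq ι] (A : Matrix ι ι ℝ) (q : ℝ)
    {G : ℝ → ι → ℝ} {S : Set ℝ} (hG : ContinuousOn G S) :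
    ContinuousOn (fun s => NormedSpace.exp ((q - s) • A) *ᵥ G s) S := by
  have hE : Continuous (fun s : ℝ => NormedSpace.exp ((q - s) • A)) :=
    (continuous_exp_smul A).comp (continuous_const.sub continuous_id)
  refine continuousOn_pi.mpr fun g => ?_
  simp only [Matrix.mulVec, dotProduct]
  refine continuousOn_finsetSum _ fun j _ => ?_
  exact (hE.matrix_elem g j).continuousOn.mul (continuousOn_pi.mp hG j)

/-- The variation of constants formula, for an arbitrary function of time in place of the solution
of the linear system. -/
lemma variation_of_constants {ι : Type*} [Fintype ι] [DecidableEq ι] (A : Matrix ι ι ℝ)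
    {y y' : ℝ → ι → ℝ} {p q : ℝ} (hpq : p ≤ q)
    (hy : ∀ s ∈ Icc p q, ∀ g, HasDerivWithinAt (fun s => y s g) (y' s g) (Icc p q) s)
    (hy' : ContinuousOn y' (Icc p q)) :
    y q = NormedSpace.exp ((q - p) • A) *ᵥ y p +
      ∫ s in p..q, NormedSpace.exp ((q - s) • A) *ᵥ (y' s - A *ᵥ y s) := by
  have hyc : ContinuousOn y (Icc p q) :=
    continuousOn_pi.mpr fun g s hs => (hy s hs g).continuousWithinAt
  have hAy : ContinuousOn (fun s => A *ᵥ y s) (Icc p q) := by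
    refine continuousOn_pi.mpr fun g => ?_
    simp only [Matrix.mulVec, dotProduct]
    exact continuousOn_finsetSum _ fun j _ => continuousOn_const.mul (continuousOn_pi.mp hyc j)
  have hd : ∀ s ∈ Ioo p q, HasDerivAt (fun s => NormedSpace.exp ((q - s) • A) *ᵥ y s)
      (NormedSpace.exp ((q - s) • A) *ᵥ (y' s - A *ᵥ y s)) s := by
    intro s hs
    refine hasDerivAt_pi.mpr fun g => ?_
    have h1 : ∀ j, HasDerivAt (fun s : ℝ => NormedSpace.exp ((q - s) • A) g j)
        (-(NormedSpace.exp ((q - s) • A) * A) g j) s := by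
      intro j
      have := (hasDerivAt_exp_smul_apply A g j (q - s)).comp s
        ((hasDerivAt_id s).const_sub q)
      exact this.congr_deriv (by simp)
    have h2 : ∀ j, HasDerivAt (fun s => y s j) (y' s j) s := fun j =>
      (hy s (Ioo_subset_Icc_self hs) j).hasDerivAt (Icc_mem_nhds hs.1 hs.2)
    have h3 := HasDerivAt.fun_sum (u := Finset.univ) (fun j _ => (h1 j).mul (h2 j))
    refine h3.congr_deriv ?_
    rw [Matrix.mulVec_sub, Matrix.mulVec_mulVec]
    simp only [Pi.sub_apply, Matrix.mulVec, dotProduct, Finset.sum_add_distrib, neg_mul,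
      Finset.sum_neg_distrib]
    ring
  have hint : IntervalIntegrable
      (fun s => NormedSpace.exp ((q - s) • A) *ᵥ (y' s - A *ᵥ y s)) volume p q := by
    refine ContinuousOn.intervalIntegrable ?_
    rw [uIcc_of_le hpq]
    exact continuousOn_exp_mulVec A q (hy'.sub hAy)
  rw [intervalIntegral.integral_eq_sub_of_hasDerivAt_of_le hpq
    (continuousOn_exp_mulVec A q hyc) hd hint]
  simp

/-- The linear map onto the Euclidean space which turns the lumped norm into the Euclidean one. -/
noncomputable def lumpedEmbedding (a b : ℝ) (M r : ℕ) :
    (Fin (M * r + 1) → ℝ) →L[ℝ] EuclideanSpace ℝ (Fin (M * r + 1)) :=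
  LinearMap.toContinuousLinearMap
    { toFun := fun v => WithLp.toLp 2 fun g => √(nodeWeight a b M r g) * v g
      map_add' := fun v w => by ext g; simp [mul_add]
      map_smul' := fun c v => by ext g; simp [mul_left_comm] }

lemma norm_lumpedEmbedding {a b : ℝ} (hab : a < b) {M r : ℕ} (hM : 1 ≤ M) (hr : 1 ≤ r)
    (v : Fin (M * r + 1) → ℝ) : ‖lumpedEmbedding a b M r v‖ = lumpedNorm a b M r v := by
  rw [EuclideanSpace.norm_eq, lumpedNorm]
  congr 1
  refine Finset.sum_congr rfl fun g _ => ?_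
  change ‖√(nodeWeight a b M r g) * v g‖ ^ 2 = _
  rw [Real.norm_eq_abs, sq_abs, mul_pow, Real.sq_sqrt (nodeWeight_pos hab hM hr g).le, mul_comm]

lemma lumpedNorm_add_le {a b : ℝ} (hab : a < b) {M r : ℕ} (hM : 1 ≤ M) (hr : 1 ≤ r)
    (v w : Fin (M * r + 1) → ℝ) :
    lumpedNorm a b M r (v + w) ≤ lumpedNorm a b M r v + lumpedNorm a b M r w := by
  simp only [← norm_lumpedEmbedding hab hM hr, map_add]
  exact norm_add_le _ _

lemma lumpedNorm_sub_le {a b : ℝ} (hab : a < b) {M r : ℕ} (hM : 1 ≤ M) (hr : 1 ≤ r)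
    (v w : Fin (M * r + 1) → ℝ) :
    lumpedNorm a b M r (v - w) ≤ lumpedNorm a b M r v + lumpedNorm a b M r w := by
  simp only [← norm_lumpedEmbedding hab hM hr, map_sub]
  exact norm_sub_le _ _

lemma lumpedNorm_sub_comm {a b : ℝ} (hab : a < b) {M r : ℕ} (hM : 1 ≤ M) (hr : 1 ≤ r)
    (v w : Fin (M * r + 1) → ℝ) : lumpedNorm a b M r (v - w) = lumpedNorm a b M r (w - v) := by
  simp only [← norm_lumpedEmbedding hab hM hr, map_sub]
  exact norm_sub_rev _ _

lemma lumpedNorm_smul {a b : ℝ} (hab : a < b) {M r : ℕ} (hM : 1 ≤ M) (hr : 1 ≤ r)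
    (c : ℝ) (v : Fin (M * r + 1) → ℝ) :
    lumpedNorm a b M r (c • v) = |c| * lumpedNorm a b M r v := by
  simp only [← norm_lumpedEmbedding hab hM hr, map_smul, norm_smul, Real.norm_eq_abs]

lemma lumpedNorm_sum_le {a b : ℝ} (hab : a < b) {M r : ℕ} (hM : 1 ≤ M) (hr : 1 ≤ r)
    {ι : Type*} (S : Finset ι) (v : ι → Fin (M * r + 1) → ℝ) :
    lumpedNorm a b M r (∑ j ∈ S, v j) ≤ ∑ j ∈ S, lumpedNorm a b M r (v j) := by
  simp only [← norm_lumpedEmbedding hab hM hr, map_sum]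
  exact norm_sum_le _ _

lemma lumpedNorm_mono {a b : ℝ} (hab : a < b) {M r : ℕ} (hM : 1 ≤ M) (hr : 1 ≤ r) {c : ℝ}
    (hc : 0 ≤ c) {v w : Fin (M * r + 1) → ℝ} (h : ∀ g, |v g| ≤ c * |w g|) :
    lumpedNorm a b M r v ≤ c * lumpedNorm a b M r w := by
  rw [lumpedNorm, lumpedNorm, ← Real.sqrt_sq hc, ← Real.sqrt_mul (sq_nonneg c), Finset.mul_sum]
  refine Real.sqrt_le_sqrt (Finset.sum_le_sum fun g _ => ?_)
  rw [← mul_assoc, ← mul_pow]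
  refine mul_le_mul_of_nonneg_right ?_ (nodeWeight_pos hab hM hr g).le
  rw [← sq_abs, ← sq_abs (c * w g), abs_mul, abs_of_nonneg hc]
  exact pow_le_pow_left₀ (abs_nonneg _) (h g) 2

lemma lumpedNorm_integral_le {a b : ℝ} (hab : a < b) {M r : ℕ} (hM : 1 ≤ M) (hr : 1 ≤ r)
    {G : ℝ → Fin (M * r + 1) → ℝ} {p q C : ℝ} (hpq : p ≤ q)
    (hG : IntervalIntegrable G volume p q)
    (hC : ∀ s ∈ Ioc p q, lumpedNorm a b M r (G s) ≤ C) :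
    lumpedNorm a b M r (∫ s in p..q, G s) ≤ C * (q - p) := by
  rw [← norm_lumpedEmbedding hab hM hr, ← ContinuousLinearMap.intervalIntegral_comp_comm _ hG]
  refine (intervalIntegral.norm_integral_le_of_norm_le_const (C := C) fun s hs => ?_).trans
    (le_of_eq (by rw [abs_of_nonneg (sub_nonneg.mpr hpq)]))
  rw [uIoc_of_le hpq] at hs
  rw [norm_lumpedEmbedding hab hM hr]
  exact hC s hs

/-! ### A discrete Gronwall inequality for multistep methods -/

lemma multistep_gronwall {e : ℕ → ℝ} {N k : ℕ} {τ B δ : ℝ} (hk : 1 ≤ k) (he : ∀ n, 0 ≤ e n)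
    (hτ : 0 ≤ τ) (hB : 0 ≤ B) (hδ : 0 ≤ δ)
    (hstep : ∀ n, k ≤ n → n ≤ N →
      e n ≤ e (n - 1) + τ * (B * ∑ j ∈ Finset.Icc 1 k, e (n - j) + δ)) :
    ∀ n ≤ N, e n ≤ Real.exp (B * k * (N * τ)) * (∑ m ∈ Finset.range k, e m + N * τ * δ) := by
  set S := ∑ m ∈ Finset.range k, e m with hS
  have hS0 : 0 ≤ S := Finset.sum_nonneg fun m _ => he m
  set x : ℝ := 1 + B * k * τ with hx
  have hx1 : 1 ≤ x := by
    have : 0 ≤ B * k * τ := by positivity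
    linarith
  have hx0 : 0 ≤ x := zero_le_one.trans hx1
  have hmono : ∀ {i n : ℕ}, i ≤ n → x ^ i * (S + i * τ * δ) ≤ x ^ n * (S + n * τ * δ) := by
    intro i n hin
    have hin' : (i : ℝ) ≤ n := by exact_mod_cast hin
    refine mul_le_mul (pow_le_pow_right₀ hx1 hin) ?_ (by positivity) (by positivity)
    have := mul_le_mul_of_nonneg_right (mul_le_mul_of_nonneg_right hin' hτ) hδ
    linarith
  have hmain : ∀ n ≤ N, e n ≤ x ^ n * (S + n * τ * δ) := by
    intro n
    induction n using Nat.strong_induction_on with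
    | _ n ih =>
      intro hn
      by_cases hnk : n < k
      · have h1 : e n ≤ S := Finset.single_le_sum (f := e) (fun m _ => he m) (by simpa using hnk)
        have h2 : (0 : ℝ) ≤ n * τ * δ := by positivity
        have h3 : 1 ≤ x ^ n := one_le_pow₀ hx1
        nlinarith
      · have hkn : k ≤ n := not_lt.mp hnk
        set Q := x ^ (n - 1) * (S + (n - 1 : ℕ) * τ * δ) with hQ
        have hprev : ∀ j ∈ Finset.Icc 1 k, e (n - j) ≤ Q := by
          intro j hj
          rw [Finset.mem_Icc] at hj
          exact (ih (n - j) (by omega) (by omega)).trans (hmono (by omega))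
        have hsum : ∑ j ∈ Finset.Icc 1 k, e (n - j) ≤ k * Q := by
          refine (Finset.sum_le_sum hprev).trans (le_of_eq ?_)
          rw [Finset.sum_const, Nat.card_Icc, nsmul_eq_mul, Nat.add_sub_cancel]
        have h1 := hstep n hkn hn
        have h2 := hprev 1 (by simp [hk])
        have h3 : τ * (B * ∑ j ∈ Finset.Icc 1 k, e (n - j) + δ) ≤ τ * (B * (k * Q) + δ) :=
          mul_le_mul_of_nonneg_left (add_le_add (mul_le_mul_of_nonneg_left hsum hB) le_rfl) hτ
        have hxn : x ^ n = x * x ^ (n - 1) := by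
          rw [← pow_succ', Nat.sub_add_cancel (hk.trans hkn)]
        have hn1 : (n : ℝ) = (n - 1 : ℕ) + 1 := by
          rw [Nat.cast_sub (hk.trans hkn)]; simp
        have h4 : τ * δ ≤ x ^ n * (τ * δ) :=
          le_mul_of_one_le_left (by positivity) (one_le_pow₀ hx1)
        calc e n ≤ Q + τ * (B * (k * Q) + δ) := by linarith
          _ = x * Q + τ * δ := by rw [hx]; ring
          _ ≤ x * Q + x ^ n * (τ * δ) := by linarith
          _ = _ := by rw [hQ, hn1, hxn]; ring
  intro n hn
  refine (hmain n hn).trans ((hmono hn).trans ?_)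
  refine mul_le_mul_of_nonneg_right ?_ (by positivity)
  calc x ^ N ≤ Real.exp (B * k * τ) ^ N := by
        refine pow_le_pow_left₀ hx0 ?_ N
        rw [hx, add_comm]
        exact Real.add_one_le_exp _
    _ = _ := by rw [← Real.exp_nat_mul]; congr 1; ring

/-! ### Consistency of the scheme -/

lemma sobolevDeriv_zero_sub_sum {a b : ℝ} {m : ℕ} {ι : Type*} (S : Finset ι) (c : ι → ℝ)
    (V : sobolev a b m) (W : ι → sobolev a b m) :
    sobolevDeriv (V - ∑ j ∈ S, c j • W j) 0 =ᵐ[volume.restrict (Ioo a b)]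
      fun x => sobolevDeriv V 0 x - ∑ j ∈ S, c j * sobolevDeriv (W j) 0 x := by
  classical
  induction S using Finset.induction_on generalizing V with
  | empty => simp
  | insert i S hi ih =>
    have h := ih (V - c i • W i)
    rw [Finset.sum_insert hi, ← sub_sub]
    have h1 : sobolevDeriv (V - c i • W i) 0 =ᵐ[volume.restrict (Ioo a b)]
        fun x => sobolevDeriv V 0 x - c i * sobolevDeriv (W i) 0 x := by
      simp only [sobolevDeriv_zero]
      have h2 := Lp.coeFn_sub ((V : PiLp 2 (fun _ : Fin (m + 1) => L2 a b)) 0 : L2 a b)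
        (c i • ((W i : PiLp 2 (fun _ : Fin (m + 1) => L2 a b)) 0 : L2 a b))
      have h3 := Lp.coeFn_smul (c i)
        ((W i : PiLp 2 (fun _ : Fin (m + 1) => L2 a b)) 0 : L2 a b)
      filter_upwards [h2, h3] with x h2 h3
      rw [Submodule.coe_sub, PiLp.sub_apply, Submodule.coe_smul, PiLp.smul_apply, h2,
        Pi.sub_apply, h3, Pi.smul_apply, smul_eq_mul]
    filter_upwards [h, h1] with x h h1
    rw [h, h1, Finset.sum_insert hi, sub_sub]

lemma l2norm_congr {a b : ℝ} (hab : a < b) {v w : ℝ → ℝ}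
    (h : v =ᵐ[volume.restrict (Ioo a b)] w) : l2norm a b v = l2norm a b w := by
  rw [l2norm, l2norm, ← setIntegral_Ioo_eq hab, ← setIntegral_Ioo_eq hab]
  congr 1
  refine integral_congr_ae ?_
  filter_upwards [h] with x hx
  rw [hx]

lemma l2norm_congr_Icc {a b : ℝ} (hab : a < b) {v w : ℝ → ℝ} (h : EqOn v w (Icc a b)) :
    l2norm a b v = l2norm a b w :=
  l2norm_congr hab ((ae_restrict_mem measurableSet_Ioo).mono
    fun _ hx => h (Ioo_subset_Icc_self hx))

lemma l2norm_sobolevDeriv_zero_le {a b : ℝ} (hab : a < b) {m : ℕ} (V : sobolev a b m) :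
    l2norm a b (sobolevDeriv V 0) ≤ ‖V‖ := by
  rw [sobolevDeriv_zero]
  have h1 : ‖(V : PiLp 2 (fun _ : Fin (m + 1) => L2 a b)) 0‖ ≤ ‖V‖ :=
    PiLp.norm_apply_le (V : PiLp 2 (fun _ : Fin (m + 1) => L2 a b)) 0
  refine le_trans (le_of_eq ?_) h1
  set g : L2 a b := (V : PiLp 2 (fun _ : Fin (m + 1) => L2 a b)) 0
  rw [l2norm, ← setIntegral_Ioo_eq hab, ← Real.sqrt_sq (norm_nonneg g),
    ← real_inner_self_eq_norm_sq, L2.inner_def]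
  congr 1
  refine integral_congr_ae (Filter.Eventually.of_forall fun x => ?_)
  simp [sq]

/-- The extrapolation error at the nodes: in `L²` it is of order `τᵏ` by the smoothness in time,
and as its `r`-th space derivative is bounded, the passage to the lumped norm costs only `hʳ`. -/
lemma exists_lumpedNorm_extrapolation_le {a b T : ℝ} (hab : a < b) (hT : 0 < T) {r k : ℕ}
    (hr : 1 ≤ r) (hk : 1 ≤ k) {φ : ℝ → ℝ → ℝ} {W : ℝ → sobolev a b 0}
    {F : ℝ → sobolev a b (2 * r)} (hW : ContDiffOn ℝ k W (Icc 0 T))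
    (hφW : ∀ t ∈ Icc 0 T, φ t =ᵐ[volume.restrict (Ioo a b)] sobolevDeriv (W t) 0)
    (hF : ContinuousOn F (Icc 0 T))
    (hφF : ∀ t ∈ Icc 0 T, φ t =ᵐ[volume.restrict (Ioo a b)] sobolevDeriv (F t) 0)
    (hφ : ∀ t ∈ Icc 0 T, ContinuousOn (φ t) (Icc a b)) :
    ∃ C : ℝ, 0 < C ∧ ∀ M N n : ℕ, 1 ≤ M → 1 ≤ N → k ≤ n → n ≤ N →
      ∀ s ∈ Icc (((n : ℝ) - 1) * (T / N)) (n * (T / N)),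
      lumpedNorm a b M r (nodalVec a b M r (φ s) - ∑ j ∈ Finset.Icc 1 k,
        (extrapBasis (T / N) k n j).eval s • nodalVec a b M r (φ (((n - j : ℕ) : ℝ) * (T / N)))) ≤
        C * ((T / N) ^ k + meshSize a b M ^ r) := by
  obtain ⟨C₁, hC₁, hext⟩ := exists_extrapolation_error_le hT hk hW
  obtain ⟨C₂, hC₂, hequiv⟩ := exists_l2norm_equiv_lumpedNorm hab hr
  obtain ⟨B, hB⟩ := isCompact_Icc.exists_bound_of_continuousOn hF
  have hB0 : 0 ≤ B := (norm_nonneg _).trans (hB 0 (left_mem_Icc.mpr hT.le))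
  have hS := sobolevConst_pos hab
  set K : ℝ := sobolevConst a b * (B + k * ((k : ℝ) ^ k * B)) with hK
  have hK0 : 0 ≤ K := by positivity
  refine ⟨C₂ * (C₁ + K), by positivity, fun M N n hM hN hkn hnN s hs => ?_⟩
  have hN0 : (0 : ℝ) < N := by exact_mod_cast hN
  have hE := hext N n hN hkn hnN s hs
  set τ := T / N with hτdef
  have hτ : 0 < τ := div_pos hT hN0
  have hNτ : (N : ℝ) * τ = T := by rw [hτdef]; field_simp
  have hnN' : (n : ℝ) ≤ N := by exact_mod_cast hnN
  have hn1 : (1 : ℝ) ≤ n := by exact_mod_cast hk.trans hkn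
  have hsT : s ∈ Icc 0 T := by
    rw [← hNτ]
    constructor <;> nlinarith [hs.1, hs.2]
  have hjT : ∀ j ∈ Finset.Icc 1 k, ((n - j : ℕ) : ℝ) * τ ∈ Icc 0 T := by
    intro j _
    have h1 : ((n - j : ℕ) : ℝ) ≤ N := by exact_mod_cast (Nat.sub_le n j).trans hnN
    rw [← hNτ]
    exact ⟨by positivity, mul_le_mul_of_nonneg_right h1 hτ.le⟩
  set l : ℕ → ℝ := fun j => (extrapBasis τ k n j).eval s with hl
  set ψ : ℝ → ℝ := fun x => φ s x - ∑ j ∈ Finset.Icc 1 k, l j * φ (((n - j : ℕ) : ℝ) * τ) x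
    with hψ
  have hae : ∀ {m : ℕ} (Z : ℝ → sobolev a b m),
      (∀ t ∈ Icc 0 T, φ t =ᵐ[volume.restrict (Ioo a b)] sobolevDeriv (Z t) 0) →
      ψ =ᵐ[volume.restrict (Ioo a b)] sobolevDeriv
        (Z s - ∑ j ∈ Finset.Icc 1 k, l j • Z (((n - j : ℕ) : ℝ) * τ)) 0 := by
    intro m Z hZ
    have h1 := sobolevDeriv_zero_sub_sum (Finset.Icc 1 k) l (Z s)
      (fun j => Z (((n - j : ℕ) : ℝ) * τ))
    have h2 : ∀ᵐ x ∂(volume.restrict (Ioo a b)), ∀ j ∈ Finset.Icc 1 k,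
        φ (((n - j : ℕ) : ℝ) * τ) x = sobolevDeriv (Z (((n - j : ℕ) : ℝ) * τ)) 0 x :=
      (Finset.eventually_all _).mpr fun j hj => hZ _ (hjT j hj)
    filter_upwards [h1, h2, hZ s hsT] with x h1 h2 h3
    rw [h1, hψ]
    simp only
    rw [h3, Finset.sum_congr rfl fun j hj => by rw [h2 j hj]]
  have hψc : ContinuousOn ψ (Icc a b) :=
    (hφ s hsT).sub (continuousOn_finsetSum _ fun j hj => continuousOn_const.mul (hφ _ (hjT j hj)))
  have hψ2 : l2norm a b ψ ≤ C₁ * τ ^ k := by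
    rw [l2norm_congr hab (hae W hφW)]
    exact (l2norm_sobolevDeriv_zero_le hab _).trans hE
  obtain ⟨G, hG, hGj, hGb⟩ := exists_contDiff_of_sobolev hab (show r < 2 * r by omega)
    (F s - ∑ j ∈ Finset.Icc 1 k, l j • F (((n - j : ℕ) : ℝ) * τ))
  have hG0 := hGj 0 (by omega)
  rw [iteratedDeriv_zero] at hG0
  have hGψ : EqOn G ψ (Icc a b) := eqOn_Icc_of_ae_eq_Ioo hab hG.continuous.continuousOn hψc
    (((hae F hφF).trans hG0).symm)
  have hnorm : ‖F s - ∑ j ∈ Finset.Icc 1 k, l j • F (((n - j : ℕ) : ℝ) * τ)‖ ≤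
      B + k * ((k : ℝ) ^ k * B) := by
    refine (norm_sub_le _ _).trans (add_le_add (hB s hsT) ?_)
    have h1 : ‖∑ j ∈ Finset.Icc 1 k, l j • F (((n - j : ℕ) : ℝ) * τ)‖ ≤
        ∑ _j ∈ Finset.Icc 1 k, (k : ℝ) ^ k * B := by
      refine norm_sum_le_of_le _ fun j hj => ?_
      rw [norm_smul, Real.norm_eq_abs]
      exact mul_le_mul (abs_eval_extrapBasis_le hτ hj hs) (hB _ (hjT j hj)) (norm_nonneg _)
        (by positivity)
    rwa [Finset.sum_const, Nat.card_Icc, nsmul_eq_mul, Nat.add_sub_cancel] at h1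
  have hGK : ∀ x ∈ Icc a b, |iteratedDeriv r G x| ≤ K := fun x hx =>
    (hGb r le_rfl x hx).trans (mul_le_mul_of_nonneg_left hnorm hS.le)
  have hzero : IsFEFunction a b M r (fun _ => 0) := fun i _ =>
    ⟨0, by simp, fun x _ => by simp⟩
  have h := (hequiv M hM G (fun _ => 0) K hG hGK hzero).2
  simp only [sub_zero] at h
  have hvec : nodalVec a b M r (φ s) - ∑ j ∈ Finset.Icc 1 k, l j •
      nodalVec a b M r (φ (((n - j : ℕ) : ℝ) * τ)) = nodalVec a b M r G := by
    funext g
    rw [nodalVec, hGψ (node_mem_Icc hab hM hr g)]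
    simp [hψ, nodalVec, Finset.sum_apply]
  rw [hvec]
  rw [l2norm_congr_Icc hab hGψ] at h
  refine h.trans ?_
  have hh : 0 ≤ meshSize a b M ^ r := (pow_pos (meshSize_pos hab hM) r).le
  have hτk : 0 ≤ τ ^ k := by positivity
  rw [mul_assoc C₂]
  refine mul_le_mul_of_nonneg_left ?_ hC₂.le
  nlinarith [mul_nonneg hK0 hτk, mul_nonneg hC₁.le hh]

/-- The truncation error of the lumped space discretization, uniformly in time. -/
lemma exists_lumpedNorm_truncation_le {a b T : ℝ} (hab : a < b) (hT : 0 < T) {r : ℕ} (hr : 1 ≤ r)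
    {f u₀ : ℝ → ℝ} {u : ℝ → ℝ → ℝ} (hu : IsSolution a b T f u₀ u)
    {L : ℝ → sobolev a b (2 * r) →L[ℝ] ℝ} (hL : IsPointEval L)
    {V F : ℝ → sobolev a b (2 * r)} (hV : ContDiffOn ℝ 1 V (Icc 0 T))
    (huV : ∀ t ∈ Icc 0 T, u t =ᵐ[volume.restrict (Ioo a b)] sobolevDeriv (V t) 0)
    (hF : ContinuousOn F (Icc 0 T))
    (hfF : ∀ t ∈ Icc 0 T,
      (fun x => f (u t x)) =ᵐ[volume.restrict (Ioo a b)] sobolevDeriv (F t) 0)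
    (hfc : ∀ t ∈ Icc 0 T, ContinuousOn (fun x => f (u t x)) (Icc a b)) :
    ∃ C : ℝ, 0 < C ∧ ∀ M : ℕ, 1 ≤ M → ∀ t ∈ Ioc 0 T,
      lumpedNorm a b M r ((fun g => L (node a b M r g) (derivWithin V (Icc 0 T) t)) -
        ((massMatrix a b M r)⁻¹ * stiffMatrix a b M r) *ᵥ nodalVec a b M r (u t) -
        nodalVec a b M r (fun x => f (u t x))) ≤ C * meshSize a b M ^ r := by
  obtain ⟨C, hC, hres⟩ := exists_lumpedNorm_residual_le hab hr
  have hcont : ContinuousOn (fun t => derivWithin V (Icc 0 T) t - F t) (Icc 0 T) :=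
    (hV.continuousOn_derivWithin (uniqueDiffOn_Icc hT) le_rfl).sub hF
  obtain ⟨B, hB⟩ := isCompact_Icc.exists_bound_of_continuousOn hcont
  have hB0 : 0 ≤ B := (norm_nonneg _).trans (hB 0 (left_mem_Icc.mpr hT.le))
  have hS := sobolevConst_pos hab
  refine ⟨C * (sobolevConst a b * B + 1), by positivity, fun M hM t ht => ?_⟩
  obtain ⟨v, hv, hvu, hvb, hva, hvb', hvL⟩ :=
    exists_contDiff_solution hab hT hr hu hL hV huV hfF hfc ht
  have h := hres M hM v (sobolevConst a b * B) hv (fun x hx => (hvb x hx).trans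
    (mul_le_mul_of_nonneg_left (hB t (Ioc_subset_Icc_self ht)) hS.le)) hva hvb'
  have h1 : nodalVec a b M r (u t) = nodalVec a b M r v := by
    funext g
    exact (hvu _ (node_mem_Icc hab hM hr g)).symm
  have h2 : (fun g => L (node a b M r g) (derivWithin V (Icc 0 T) t)) =
      nodalVec a b M r (deriv (deriv v)) + nodalVec a b M r (fun x => f (u t x)) := by
    funext g
    exact hvL _ (node_mem_Icc hab hM hr g)
  rw [h1, h2, add_sub_right_comm, add_sub_cancel_right]
  refine h.trans (mul_le_mul_of_nonneg_right ?_ (pow_pos (meshSize_pos hab hM) r).le)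
  exact mul_le_mul_of_nonneg_left (by linarith) hC.le

/-- The equivalence of the `L²` norm and of the lumped norm for the error, uniformly in time. -/
lemma exists_l2norm_error_equiv {a b T : ℝ} (hab : a < b) (hT : 0 < T) {r : ℕ} (hr : 1 ≤ r)
    {u : ℝ → ℝ → ℝ} {V : ℝ → sobolev a b (2 * r)} (hV : ContinuousOn V (Icc 0 T))
    (huV : ∀ t ∈ Icc 0 T, u t =ᵐ[volume.restrict (Ioo a b)] sobolevDeriv (V t) 0)
    (huc : ∀ t ∈ Icc 0 T, ContinuousOn (u t) (Icc a b)) :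
    ∃ C : ℝ, 0 < C ∧ ∀ M : ℕ, 1 ≤ M → ∀ t ∈ Icc 0 T, ∀ w : ℝ → ℝ, IsFEFunction a b M r w →
      l2norm a b (fun x => u t x - w x) ≤
        C * (lumpedNorm a b M r (nodalVec a b M r w - nodalVec a b M r (u t)) +
          meshSize a b M ^ r) ∧
      lumpedNorm a b M r (nodalVec a b M r w - nodalVec a b M r (u t)) ≤
        C * (l2norm a b (fun x => u t x - w x) + meshSize a b M ^ r) := by
  obtain ⟨C, hC, hequiv⟩ := exists_l2norm_equiv_lumpedNorm hab hr
  obtain ⟨B, hB⟩ := isCompact_Icc.exists_bound_of_continuousOn hV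
  have hB0 : 0 ≤ B := (norm_nonneg _).trans (hB 0 (left_mem_Icc.mpr hT.le))
  have hS := sobolevConst_pos hab
  set K := sobolevConst a b * B with hK
  have hK0 : 0 ≤ K := by positivity
  refine ⟨C * (1 + K), by positivity, fun M hM t ht w hw => ?_⟩
  obtain ⟨G, hG, hGj, hGb⟩ := exists_contDiff_of_sobolev hab (show r < 2 * r by omega) (V t)
  have hG0 := hGj 0 (by omega)
  rw [iteratedDeriv_zero] at hG0
  have hGu : EqOn G (u t) (Icc a b) := eqOn_Icc_of_ae_eq_Ioo hab hG.continuous.continuousOn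
    (huc t ht) (hG0.symm.trans (huV t ht).symm)
  have h := hequiv M hM G w K hG (fun x hx => (hGb r le_rfl x hx).trans
    (mul_le_mul_of_nonneg_left (hB t ht) hS.le)) hw
  rw [l2norm_congr_Icc hab (w := fun x => u t x - w x) fun x hx => by simp only; rw [hGu hx]] at h
  have hvec : nodalVec a b M r (fun x => G x - w x) =
      nodalVec a b M r (u t) - nodalVec a b M r w := by
    funext g
    rw [nodalVec, hGu (node_mem_Icc hab hM hr g)]
    rfl
  rw [hvec, lumpedNorm_sub_comm hab hM hr] at h
  have hh : 0 ≤ meshSize a b M ^ r := (pow_pos (meshSize_pos hab hM) r).le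
  have hmono : ∀ {z : ℝ}, 0 ≤ z →
      C * (z + K * meshSize a b M ^ r) ≤ C * (1 + K) * (z + meshSize a b M ^ r) := by
    intro z hz
    rw [mul_assoc C]
    refine mul_le_mul_of_nonneg_left ?_ hC.le
    nlinarith [mul_nonneg hK0 hz]
  exact ⟨h.1.trans (hmono (lumpedNorm_nonneg ..)), h.2.trans (hmono (l2norm_nonneg ..))⟩

/-! ### One step of the scheme -/

lemma abs_clamp_le {α : ℝ} (hα : 0 < α) (x : ℝ) : |min (max x (-α)) α| ≤ α :=
  abs_le.mpr ⟨le_min (le_max_right _ _) (by linarith), min_le_right _ _⟩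

/-- The cut-off does not increase the distance to values in `[-α, α]`. -/
lemma abs_clamp_sub_le {α x y : ℝ} (hy : |y| ≤ α) : |min (max x (-α)) α - y| ≤ |x - y| := by
  have h1 := abs_min_sub_min_le_max (max x (-α)) α y α
  have h2 := abs_max_sub_max_le_max x (-α) y (-α)
  rw [abs_le] at hy
  rw [min_eq_left hy.2, sub_self, abs_zero, max_eq_left (abs_nonneg (max x (-α) - y))] at h1
  rw [max_eq_left hy.1, sub_self, abs_zero, max_eq_left (abs_nonneg (x - y))] at h2
  exact h1.trans h2

/-- The stability of one step, before the cut-off: as the semigroup is contractive in the lumped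
norm, the defect is only integrated over the step. -/
lemma lumpedNorm_expStep_sub_le {a b : ℝ} (hab : a < b) {M r : ℕ} (hM : 1 ≤ M) (hr : 1 ≤ r)
    {τ C : ℝ} (hτ : 0 ≤ τ) {k n : ℕ} (hn : 1 ≤ n) (f : ℝ → ℝ) (U : ℕ → Fin (M * r + 1) → ℝ)
    {y y' : ℝ → Fin (M * r + 1) → ℝ}
    (hy : ∀ s ∈ Icc (((n : ℝ) - 1) * τ) (n * τ), ∀ g,
      HasDerivWithinAt (fun s => y s g) (y' s g) (Icc (((n : ℝ) - 1) * τ) (n * τ)) s)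
    (hy' : ContinuousOn y' (Icc (((n : ℝ) - 1) * τ) (n * τ)))
    (hC : ∀ s ∈ Ioc (((n : ℝ) - 1) * τ) (n * τ),
      lumpedNorm a b M r ((∑ j ∈ Finset.Icc 1 k, (extrapBasis τ k n j).eval s •
        fun g => f (U (n - j) g)) -
        (y' s - ((massMatrix a b M r)⁻¹ * stiffMatrix a b M r) *ᵥ y s)) ≤ C) :
    lumpedNorm a b M r (expStep a b M r τ k f U n - y (n * τ)) ≤
      lumpedNorm a b M r (U (n - 1) - y (((n - 1 : ℕ) : ℝ) * τ)) + τ * C := by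
  set A := (massMatrix a b M r)⁻¹ * stiffMatrix a b M r with hA
  set p := ((n : ℝ) - 1) * τ with hp
  set q := (n : ℝ) * τ with hq
  have hpq' : q - p = τ := by rw [hp, hq]; ring
  have hpq : p ≤ q := by linarith
  have hcast : ((n - 1 : ℕ) : ℝ) * τ = p := by rw [Nat.cast_sub hn, Nat.cast_one]
  set Φ : ℝ → Fin (M * r + 1) → ℝ := fun s => ∑ j ∈ Finset.Icc 1 k,
    (extrapBasis τ k n j).eval s • fun g => f (U (n - j) g) with hΦ
  have hΦc : Continuous Φ := continuous_finsetSum _ fun j _ =>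
    (extrapBasis τ k n j).continuous.smul continuous_const
  have hyc : ContinuousOn y (Icc p q) :=
    continuousOn_pi.mpr fun g s hs => (hy s hs g).continuousWithinAt
  have hAy : ContinuousOn (fun s => A *ᵥ y s) (Icc p q) :=
    (LinearMap.continuous_of_finiteDimensional (Matrix.mulVecLin A)).comp_continuousOn hyc
  have hdc : ContinuousOn (fun s => y' s - A *ᵥ y s) (Icc p q) := hy'.sub hAy
  have hint : ∀ {G : ℝ → Fin (M * r + 1) → ℝ}, ContinuousOn G (Icc p q) → IntervalIntegrable
      (fun s => NormedSpace.exp ((q - s) • A) *ᵥ G s) volume p q := by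
    intro G hG
    refine ContinuousOn.intervalIntegrable ?_
    rw [uIcc_of_le hpq]
    exact continuousOn_exp_mulVec A q hG
  have hvar := variation_of_constants A hpq hy hy'
  have heq : expStep a b M r τ k f U n - y q =
      NormedSpace.exp (τ • A) *ᵥ (U (n - 1) - y p) +
        ∫ s in p..q, NormedSpace.exp ((q - s) • A) *ᵥ (Φ s - (y' s - A *ᵥ y s)) := by
    rw [hvar, hpq', expStep, Matrix.mulVec_sub]
    simp only [Matrix.mulVec_sub (_ : Matrix _ _ ℝ) (Φ _)]
    rw [intervalIntegral.integral_sub (hint hΦc.continuousOn) (hint hdc)]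
    abel
  rw [heq, hcast]
  refine (lumpedNorm_add_le hab hM hr _ _).trans
    (add_le_add (lumpedNorm_exp_le hab hM hr _ hτ) ?_)
  refine (lumpedNorm_integral_le hab hM hr hpq (hint (hΦc.continuousOn.sub hdc)) (C := C)
    fun s hs => ?_).trans (le_of_eq (by rw [hpq', mul_comm]))
  exact (lumpedNorm_exp_le hab hM hr _ (by linarith [hs.2])).trans (hC s hs)

lemma IsExpCutoff.abs_node_le {a b α τ : ℝ} (hα : 0 < α) {M r k N : ℕ} {f : ℝ → ℝ} {uh : ℕ → ℝ → ℝ}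
    (h : IsExpCutoff a b M r τ k N α f uh) {n : ℕ} (hkn : k ≤ n) (hnN : n ≤ N)
    (g : Fin (M * r + 1)) : |uh n (node a b M r g)| ≤ α := by
  rw [h.step n hkn hnN g]
  exact abs_clamp_le hα _

/-- The recursion for the error of the scheme. The defect of a step is split into the effect of
earlier errors, the extrapolation error and the truncation error. -/
lemma IsExpCutoff.error_recursion {a b α T τ : ℝ} (hab : a < b) {M r k N : ℕ}
    (hM : 1 ≤ M) (hr : 1 ≤ r) (hk : 1 ≤ k) (hτ : 0 < τ) (hNτ : (N : ℝ) * τ = T)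
    {f : ℝ → ℝ} {uh : ℕ → ℝ → ℝ} (h : IsExpCutoff a b M r τ k N α f uh)
    (hbound : ∀ n ≤ N, ∀ g : Fin (M * r + 1), |uh n (node a b M r g)| ≤ α)
    {K δ₁ δ₂ : ℝ} (hK : 0 ≤ K)
    (hf : ∀ x ∈ Icc (-α) α, ∀ y ∈ Icc (-α) α, |f x - f y| ≤ K * |x - y|)
    {u : ℝ → ℝ → ℝ} (huα : ∀ t ∈ Icc 0 T, ∀ x ∈ Icc a b, |u t x| ≤ α)
    {y' : ℝ → Fin (M * r + 1) → ℝ}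
    (hy : ∀ t ∈ Icc 0 T, ∀ g,
      HasDerivWithinAt (fun s => u s (node a b M r g)) (y' t g) (Icc 0 T) t)
    (hy' : ContinuousOn y' (Icc 0 T))
    (hext : ∀ n, k ≤ n → n ≤ N → ∀ s ∈ Icc (((n : ℝ) - 1) * τ) (n * τ),
      lumpedNorm a b M r (nodalVec a b M r (fun x => f (u s x)) - ∑ j ∈ Finset.Icc 1 k,
        (extrapBasis τ k n j).eval s •
          nodalVec a b M r (fun x => f (u (((n - j : ℕ) : ℝ) * τ) x))) ≤ δ₁)
    (htrunc : ∀ t ∈ Ioc 0 T, lumpedNorm a b M r (y' t -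
        ((massMatrix a b M r)⁻¹ * stiffMatrix a b M r) *ᵥ nodalVec a b M r (u t) -
        nodalVec a b M r (fun x => f (u t x))) ≤ δ₂)
    {e : ℕ → ℝ} (he : ∀ n, e n =
      lumpedNorm a b M r (nodalVec a b M r (uh n) - nodalVec a b M r (u (n * τ))))
    {n : ℕ} (hkn : k ≤ n) (hnN : n ≤ N) :
    e n ≤ e (n - 1) +
      τ * ((k : ℝ) ^ k * K * ∑ j ∈ Finset.Icc 1 k, e (n - j) + (δ₁ + δ₂)) := by
  have hn1 : (1 : ℝ) ≤ n := by exact_mod_cast hk.trans hkn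
  have htime : ∀ m ≤ N, (m : ℝ) * τ ∈ Icc 0 T := by
    intro m hm
    have : (m : ℝ) ≤ N := by exact_mod_cast hm
    rw [← hNτ]
    exact ⟨by positivity, mul_le_mul_of_nonneg_right this hτ.le⟩
  have hp0 : 0 ≤ ((n : ℝ) - 1) * τ := mul_nonneg (by linarith) hτ.le
  have hsub : Icc (((n : ℝ) - 1) * τ) (n * τ) ⊆ Icc 0 T := Icc_subset_Icc hp0 (htime n hnN).2
  have hcut : e n ≤ lumpedNorm a b M r (expStep a b M r τ k f
      (fun m => nodalVec a b M r (uh m)) n - nodalVec a b M r (u (n * τ))) := by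
    rw [he n, ← one_mul (lumpedNorm a b M r (expStep a b M r τ k f _ n - _))]
    refine lumpedNorm_mono hab hM hr zero_le_one fun g => ?_
    rw [one_mul, Pi.sub_apply, Pi.sub_apply]
    simp only [nodalVec]
    rw [h.step n hkn hnN g]
    exact abs_clamp_sub_le (huα _ (htime n hnN) _ (node_mem_Icc hab hM hr g))
  rw [he (n - 1)]
  refine hcut.trans (lumpedNorm_expStep_sub_le hab hM hr hτ.le (hk.trans hkn) f
    (fun m => nodalVec a b M r (uh m)) (y := fun s => nodalVec a b M r (u s)) (y' := y')
    (fun s hs g => (hy s (hsub hs) g).mono hsub) (hy'.mono hsub) fun s hs => ?_)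
  have hs0 : s ∈ Ioc 0 T := ⟨hp0.trans_lt hs.1, hs.2.trans (htime n hnN).2⟩
  set Φ := nodalVec a b M r (fun x => f (u s x))
  set Ψ : ℕ → Fin (M * r + 1) → ℝ := fun m => nodalVec a b M r (fun x => f (u ((m : ℝ) * τ) x))
    with hΨ
  set Θ := y' s - ((massMatrix a b M r)⁻¹ * stiffMatrix a b M r) *ᵥ nodalVec a b M r (u s)
    with hΘ
  have hsplit : (∑ j ∈ Finset.Icc 1 k, (extrapBasis τ k n j).eval s •
        fun g => f (nodalVec a b M r (uh (n - j)) g)) - Θ =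
      (∑ j ∈ Finset.Icc 1 k, (extrapBasis τ k n j).eval s •
        ((fun g => f (nodalVec a b M r (uh (n - j)) g)) - Ψ (n - j))) -
      (Φ - ∑ j ∈ Finset.Icc 1 k, (extrapBasis τ k n j).eval s • Ψ (n - j)) - (Θ - Φ) := by
    simp only [smul_sub, Finset.sum_sub_distrib]
    abel
  have hlip : lumpedNorm a b M r (∑ j ∈ Finset.Icc 1 k, (extrapBasis τ k n j).eval s •
      ((fun g => f (nodalVec a b M r (uh (n - j)) g)) - Ψ (n - j))) ≤
      (k : ℝ) ^ k * K * ∑ j ∈ Finset.Icc 1 k, e (n - j) := by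
    refine (lumpedNorm_sum_le hab hM hr _ _).trans ?_
    rw [Finset.mul_sum]
    refine Finset.sum_le_sum fun j hj => ?_
    have hjN : n - j ≤ N := (Nat.sub_le n j).trans hnN
    rw [lumpedNorm_smul hab hM hr, mul_assoc, he (n - j)]
    refine mul_le_mul (abs_eval_extrapBasis_le hτ hj (Ioc_subset_Icc_self hs)) ?_
      (lumpedNorm_nonneg ..) (by positivity)
    refine lumpedNorm_mono hab hM hr hK fun g => ?_
    exact hf _ (abs_le.mp (hbound _ hjN g)) _
      (abs_le.mp (huα _ (htime _ hjN) _ (node_mem_Icc hab hM hr g)))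
  rw [hsplit]
  refine (lumpedNorm_sub_le hab hM hr _ _).trans ?_
  have h1 := lumpedNorm_sub_le hab hM hr
    (∑ j ∈ Finset.Icc 1 k, (extrapBasis τ k n j).eval s •
        ((fun g => f (nodalVec a b M r (uh (n - j)) g)) - Ψ (n - j)))
    (Φ - ∑ j ∈ Finset.Icc 1 k, (extrapBasis τ k n j).eval s • Ψ (n - j))
  have h2 := hext n hkn hnN s (Ioc_subset_Icc_self hs)
  have h3 := htrunc s hs0
  linarith

/-! ### The error bound -/

/-- The error estimate of the second part, with the maximum principle as a bound on `u`. -/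
lemma exists_error_bound {a b T α : ℝ} (hab : a < b) (hT : 0 < T) (hα : 0 < α)
    {r k : ℕ} (hr : 1 ≤ r) (hk : 1 ≤ k) {f u₀ : ℝ → ℝ} {u : ℝ → ℝ → ℝ}
    (hu : IsSolution a b T f u₀ u) (huα : ∀ t ∈ Icc 0 T, ∀ x ∈ Icc a b, |u t x| ≤ α)
    (hf : LocallyLipschitzOn (Icc (-α) α) f) (hu1 : MemCSobolev a b T 1 (2 * r) u)
    (hfk : MemCSobolev a b T k 0 (fun t x => f (u t x)))
    (hf0 : MemCSobolev a b T 0 (2 * r) (fun t x => f (u t x))) :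
    ∃ c : ℝ, 0 < c ∧ ∀ M N : ℕ, 1 ≤ M → 1 ≤ N → ∀ uh : ℕ → ℝ → ℝ,
      IsExpCutoff a b M r (T / N) k N α f uh →
      (∀ n < k, ∀ g : Fin (M * r + 1), |uh n (node a b M r g)| ≤ α) →
      ∀ n, k ≤ n → n ≤ N →
        l2norm a b (fun x => u (n * (T / N)) x - uh n x) ≤
          c * ((T / N) ^ k + meshSize a b M ^ r) +
            c * ∑ m ∈ Finset.range k, l2norm a b (fun x => u (m * (T / N)) x - uh m x) := by
  obtain ⟨V, hV, huV⟩ := hu1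
  obtain ⟨W, hW, hfW⟩ := hfk
  obtain ⟨F, hF, hfF⟩ := hf0
  simp only [← sobolevDeriv_zero] at huV hfW hfF
  have hV1 : ContDiffOn ℝ 1 V (Icc 0 T) := by exact_mod_cast hV
  have hFc : ContinuousOn F (Icc 0 T) := hF.continuousOn
  obtain ⟨K, hK⟩ := hf.exists_lipschitzOnWith_of_compact isCompact_Icc
  have hlip : ∀ x ∈ Icc (-α) α, ∀ y ∈ Icc (-α) α, |f x - f y| ≤ (K : ℝ) * |x - y| :=
    fun x hx y hy => by simpa [Real.dist_eq] using hK.dist_le_mul x hx y hy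
  have hfc : ∀ t ∈ Icc 0 T, ContinuousOn (fun x => f (u t x)) (Icc a b) := fun t ht =>
    hK.continuousOn.comp (hu.continuousOn t ht) fun x hx => abs_le.mp (huα t ht x hx)
  obtain ⟨L, hL⟩ := exists_isPointEval hab (m := 2 * r) (by omega)
  obtain ⟨C₁, hC₁, hext⟩ := exists_lumpedNorm_extrapolation_le hab hT hr hk hW hfW hFc hfF hfc
  obtain ⟨C₂, hC₂, htrunc⟩ := exists_lumpedNorm_truncation_le hab hT hr hu hL hV1 huV hFc hfF hfc
  obtain ⟨C₃, hC₃, hequiv⟩ := exists_l2norm_error_equiv hab hT hr hV1.continuousOn huV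
    hu.continuousOn
  set E := Real.exp ((k : ℝ) ^ k * K * k * T) with hE
  have hE0 : 0 < E := Real.exp_pos _
  refine ⟨C₃ * (E * (C₃ + C₃ * k + T * (C₁ + C₂)) + 1), by positivity,
    fun M N hM hN uh huh hstart n hkn hnN => ?_⟩
  have hN0 : (0 : ℝ) < N := by exact_mod_cast hN
  have hext' := fun n => hext M N n hM hN
  set τ := T / N with hτdef
  have hτ : 0 < τ := div_pos hT hN0
  have hNτ : (N : ℝ) * τ = T := by rw [hτdef]; field_simp
  have htime : ∀ m ≤ N, (m : ℝ) * τ ∈ Icc 0 T := by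
    intro m hm
    have : (m : ℝ) ≤ N := by exact_mod_cast hm
    rw [← hNτ]
    exact ⟨by positivity, mul_le_mul_of_nonneg_right this hτ.le⟩
  have hbound : ∀ n ≤ N, ∀ g : Fin (M * r + 1), |uh n (node a b M r g)| ≤ α := fun n hn g =>
    (lt_or_ge n k).elim (fun h => hstart n h g) fun h => huh.abs_node_le hα h hn g
  set η := τ ^ k + meshSize a b M ^ r with hη
  have hh : 0 ≤ meshSize a b M ^ r := (pow_pos (meshSize_pos hab hM) r).le
  have hτk : 0 ≤ τ ^ k := by positivity
  have hhη : meshSize a b M ^ r ≤ η := by linarith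
  have hη0 : 0 ≤ η := by linarith
  set y' : ℝ → Fin (M * r + 1) → ℝ :=
    fun t g => L (node a b M r g) (derivWithin V (Icc 0 T) t) with hy'
  have hy'c : ContinuousOn y' (Icc 0 T) := continuousOn_pi.mpr fun g =>
    (L (node a b M r g)).continuous.comp_continuousOn
      (hV1.continuousOn_derivWithin (uniqueDiffOn_Icc hT) le_rfl)
  set e : ℕ → ℝ := fun n =>
    lumpedNorm a b M r (nodalVec a b M r (uh n) - nodalVec a b M r (u (n * τ))) with he
  set ℓ : ℕ → ℝ := fun m => l2norm a b (fun x => u (m * τ) x - uh m x) with hℓ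
  have hrec : ∀ n, k ≤ n → n ≤ N → e n ≤ e (n - 1) + τ * ((k : ℝ) ^ k * K *
      ∑ j ∈ Finset.Icc 1 k, e (n - j) + (C₁ * η + C₂ * meshSize a b M ^ r)) :=
    fun n hkn hnN => huh.error_recursion hab hM hr hk hτ hNτ hbound K.coe_nonneg hlip huα
      (fun t ht g => hasDerivWithinAt_pointEval hL hV1 huV hu.continuousOn
        (node_mem_Icc hab hM hr g) ht) hy'c (fun n => hext' n) (htrunc M hM) (fun _ => rfl)
      hkn hnN
  have hgron := multistep_gronwall hk (fun n => lumpedNorm_nonneg ..) hτ.le (by positivity)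
    (by positivity) hrec n hnN
  rw [hNτ, ← hE] at hgron
  have hstartsum : ∑ m ∈ Finset.range k, e m ≤
      C₃ * ∑ m ∈ Finset.range k, ℓ m + C₃ * k * η := by
    have h1 : ∀ m ∈ Finset.range k, e m ≤ C₃ * ℓ m + C₃ * η := by
      intro m hm
      have hmN : m ≤ N := ((Finset.mem_range.mp hm).le.trans hkn).trans hnN
      have h2 := (hequiv M hM _ (htime m hmN) _ (huh.isFEFunction m hmN)).2
      have h3 := mul_le_mul_of_nonneg_left hhη hC₃.le
      rw [mul_add] at h2
      exact h2.trans (by linarith)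
    refine (Finset.sum_le_sum h1).trans (le_of_eq ?_)
    rw [Finset.sum_add_distrib, Finset.sum_const, Finset.card_range, ← Finset.mul_sum, nsmul_eq_mul]
    ring
  have hfinal := (hequiv M hM _ (htime n hnN) _ (huh.isFEFunction n hnN)).1
  set S := ∑ m ∈ Finset.range k, ℓ m with hS
  have hS0 : 0 ≤ S := Finset.sum_nonneg fun m _ => l2norm_nonneg ..
  have h4 : e n ≤ E * (C₃ * S + C₃ * k * η + T * ((C₁ + C₂) * η)) := by
    refine hgron.trans (mul_le_mul_of_nonneg_left (add_le_add hstartsum ?_) hE0.le)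
    refine mul_le_mul_of_nonneg_left ?_ hT.le
    have := mul_le_mul_of_nonneg_left hhη hC₂.le
    linarith
  calc ℓ n ≤ C₃ * (e n + meshSize a b M ^ r) := hfinal
    _ ≤ C₃ * (E * (C₃ * S + C₃ * k * η + T * ((C₁ + C₂) * η)) + η) :=
        mul_le_mul_of_nonneg_left (add_le_add h4 hhη) hC₃.le
    _ ≤ C₃ * (E * (C₃ + C₃ * k + T * (C₁ + C₂)) + 1) * η +
        C₃ * (E * (C₃ + C₃ * k + T * (C₁ + C₂)) + 1) * S := by
        have h5 : 0 ≤ C₃ * (E * (C₃ * k + T * (C₁ + C₂)) + 1) * S := by positivity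
        have h6 : 0 ≤ C₃ * (E * C₃) * η := by positivity
        linarith

end ExpCutoff

theorem theorem3p3 (a b T α : ℝ) (hab : a < b) (hT : 0 < T) (hα : 0 < α)
    (r k : ℕ) (hr : 1 ≤ r) (hk : 1 ≤ k)
    (f u₀ : ℝ → ℝ) (u : ℝ → ℝ → ℝ) (hu : IsSolution a b T f u₀ u)
    (hu₀ : ∀ x ∈ Set.Icc a b, |u₀ x| ≤ α)
    (hmax : (∀ x ∈ Set.Icc a b, |u₀ x| ≤ α) →
      ∀ t ∈ Set.Icc 0 T, ∀ x ∈ Set.Icc a b, |u t x| ≤ α) :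
    (∀ M N : ℕ, 1 ≤ M → 1 ≤ N → ∀ uh : ℕ → ℝ → ℝ,
      IsExpCutoff a b M r (T / N) k N α f uh →
      (∀ n < k, ∀ g : Fin (M * r + 1), |uh n (node a b M r g)| ≤ α) →
      ∀ n, k ≤ n → n ≤ N → ∀ g : Fin (M * r + 1), |uh n (node a b M r g)| ≤ α) ∧
    (LocallyLipschitzOn (Set.Icc (-α) α) f →
      MemCSobolev a b T 1 (2 * r) u →
      MemCSobolev a b T k 0 (fun t x => f (u t x)) →
      MemCSobolev a b T 0 (2 * r) (fun t x => f (u t x)) →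
      ∃ c : ℝ, 0 < c ∧ ∀ M N : ℕ, 1 ≤ M → 1 ≤ N → ∀ uh : ℕ → ℝ → ℝ,
        IsExpCutoff a b M r (T / N) k N α f uh →
        (∀ n < k, ∀ g : Fin (M * r + 1), |uh n (node a b M r g)| ≤ α) →
        ∀ n, k ≤ n → n ≤ N →
          l2norm a b (fun x => u (n * (T / N)) x - uh n x) ≤
            c * ((T / N) ^ k + meshSize a b M ^ r) +
              c * ∑ m ∈ Finset.range k,
                l2norm a b (fun x => u (m * (T / N)) x - uh m x)) := by
  have huα := hmax hu₀
  refine ⟨fun M N hM hN uh huh _ n hkn hnN g => huh.abs_node_le hα hkn hnN g, ?_⟩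
  intro hf hu1 hfk hf0
  exact exists_error_bound hab hT hα hr hk hu huα hf hu1 hfk hf0
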